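/- Let $\Bbbk$ be an algebraically closed field of arbitrary characteristic; projective varieties are irreducible and reduced (nonempty closed irreducible sets of closed points). Let $V=\Bbbk^{N+1}$, let $\mathbb{P}^N$ be the projective space of lines in $V$, let $\mathbb{G}(m,\mathbb{P}^N)$ ($m\ge -1$) be the Grassmannian of $m$-planes $L\subset\mathbb{P}^N$, identified with $(m+1)$-dimensional subspaces $\hat L\subset V$, and let $\mathcal{U}_{\mathbb{G}(m,\mathbb{P}^N)}=\{([L],x)\mid x\in L\}\subset\mathbb{G}(m,\mathbb{P}^N)\times\mathbb{P}^N$. For an $n$-dimensional projective variety $X\subset\mathbb{P}^N$, the Gauss map $\gamma_X:X\dashrightarrow\mathbb{G}(n,\mathbb{P}^N)$ sends a smooth point $x$ to the embedded tangent space $\mathbb{T}_xX$. Write $\gamma_X(X)$ for the image of the smooth locus and $\Gamma(X)\subset\mathbb{G}(n,\mathbb{P}^N)\times\mathbb{P}^N$ for the closure of $\{(\gamma_X(x),x)\mid x\in X \text{ smooth}\}$. A rational map $f:Z\dashrightarrow Z'$ is called separable (onto the closure of its image) if the rank of the differential $d_zf:T_zZ\to T_{f(z)}Z'$ at a general point $z$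 equals $\dim\overline{f(Z)}$. For a projective variety $Y\subset\mathbb{G}(n,\mathbb{P}^N)$ and a smooth point $[L]\in Y$, the inclusion $T_{[L]}Y\subset T_{[L]}\mathbb{G}(n,\mathbb{P}^N)=\operatorname{Hom}(\hat L,V/\hat L)$ corresponds to a linear map $\Phi_{[L]}:\hat L\to\operatorname{Hom}(T_{[L]}Y,V/\hat L)$, $l\mapsto(\varphi\mapsto\varphi(l))$. Let $n^-+1$ (with $-1\le n^-\le n$) be the dimension of $\ker\Phi_{[L]}$ for general $[L]\in Y$. The shrinking map $\sigma_Y:Y\dashrightarrow\mathbb{G}(n^-,\mathbb{P}^N)$ sends $[L]$ to the $n^-$-plane of $\ker\Phi_{[L]}\subset V$; it is defined on the largest open set $Y^\circ$ of smooth points of $Y$ on which $\dim\ker\Phi=n^-+1$. Let $\sigma_Y^*\mathcal{U}_{\mathbb{G}(n^-,\mathbb{P}^N)}\subset\mathbb{G}(n,\mathbb{P}^N)\times\mathbb{P}^N$ be the closure of $\{([L],x)\mid [L]\in Y^\circ,\ x\in\sigma_Y([L])\}$. (A) Let $X\subset\mathbb{P}^N$ be an $n$-dimensional projective variety and $Y\subset\mathbb{G}(n,\mathbb{P}^N)$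 a projective variety. The following are equivalent: 1. $\gamma_X$ is separable and $Y=\overline{\gamma_X(X)}$; 2. $\Gamma(X)=\sigma_Y^*\mathcal{U}_{\mathbb{G}(n^-,\mathbb{P}^N)}$ in $\mathbb{G}(n,\mathbb{P}^N)\times\mathbb{P}^N$; 3. the second projection $\sigma_Y^*\mathcal{U}_{\mathbb{G}(n^-,\mathbb{P}^N)}\to\mathbb{P}^N$ is separable and generically finite onto its image, and its image equals $X$. (B) Consequently, if $X\subset\mathbb{P}^N$ is an $n$-dimensional projective variety with $\gamma_X$ separable and $Y=\overline{\gamma_X(X)}$, then for all points $[L]$ of a nonempty open subset of $Y$ the closure of the fibre $\gamma_X^{-1}([L])$ is a linear subspace of $\mathbb{P}^N$, of dimension $n-\dim Y$. (C) Consequently, a projective variety $Y\subset\mathbb{G}(n,\mathbb{P}^N)$ is of the form $\overline{\gamma_X(X)}$ for some $n$-dimensional projective variety $X\subset\mathbb{P}^N$ with $\gamma_X$ separable if and only if the second projection $\sigma_Y^*\mathcal{U}_{\mathbb{G}(n^-,\mathbb{P}^N)}\to\mathbb{P}^N$ is separable and generically finite onto its image, and this image has dimension $n$. -/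

import Mathlib

open Topology

noncomputable section

namespace GaussMaps

/-! ### Spaces with homogeneous coordinates

Projective spaces, Grassmannians and products of these are quotients of an open subset of an affine
space `ι → k`: the nonzero vectors for a projective space, the frames (tuples of `d` linearly
independent vectors) for a Grassmannian of `d`-dimensional subspaces. -/

/-- `IsRep a m` says that the point `a` of the affine space `ι → k` is a system of homogeneous
coordinates of the point `m`. -/
class HomogCoord (k : Type*) [Field k] (M : Type*) (ι : outParam Type) where
  IsRep : (ι → k) → M → Prop

/-- The projective space `ℙ^N` (points are lines through the origin of `k^(N+1)`). -/
abbrev PSpace (k : Type*) [Field k] (N : ℕ) : Type _ := Projectivization k (Fin (N + 1) → k)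

/-- The Grassmannian of `d`-dimensional linear subspaces of `k^(N+1)`, i.e. of `(d-1)`-planes of
`ℙ^N`. So `𝔾(n, ℙ^N)` is `Grass k (n + 1) N`; and `Grass k 0 N`, which is `𝔾(-1, ℙ^N)`, is a point
(the empty plane). -/
def Grass (k : Type*) [Field k] (d N : ℕ) : Type _ :=
  {L : Submodule k (Fin (N + 1) → k) // Module.finrank k L = d}

/-- The `i`-th vector of the tuple of vectors with matrix of coordinates `a`. -/
def row {k : Type*} {d N : ℕ} (a : Fin d × Fin (N + 1) → k) (i : Fin d) : Fin (N + 1) → k :=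
  fun j => a (i, j)

/-- Homogeneous coordinates of a point of `ℙ^N`: the nonzero vectors of the line. -/
instance (k : Type*) [Field k] (N : ℕ) : HomogCoord k (PSpace k N) (Fin (N + 1)) where
  IsRep v p := ∃ hv : v ≠ 0, Projectivization.mk k v hv = p

/-- Homogeneous coordinates of a point of a Grassmannian: the frames (bases) of the subspace; `d`
vectors that span a `d`-dimensional space are automatically independent. -/
instance (k : Type*) [Field k] (d N : ℕ) : HomogCoord k (Grass k d N) (Fin d × Fin (N + 1)) where
  IsRep a L := Submodule.span k (Set.range (row a)) = L.1

instance (k : Type*) [Field k] (M M' : Type*) (ι κ : Type) [HomogCoord k M ι]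
    [HomogCoord k M' κ] : HomogCoord k (M × M') (ι ⊕ κ) where
  IsRep a m := HomogCoord.IsRep (fun i => a (Sum.inl i)) m.1 ∧
    HomogCoord.IsRep (fun j => a (Sum.inr j)) m.2

section Topology

variable (k : Type*) [Field k] (M : Type*) {ι : Type} [HomogCoord k M ι]

/-- The Zariski topology: a set is closed if its preimage in the space of homogeneous coordinates is
cut out by polynomial equations. (On a product this is the Zariski topology of the product variety,
not the product topology.) -/
@[reducible] def zariski : TopologicalSpace M :=
  TopologicalSpace.ofClosed
    {Z | ∃ S : Set (MvPolynomial ι k), ∀ (m : M) (a : ι → k), HomogCoord.IsRep a m →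
      (m ∈ Z ↔ ∀ F ∈ S, MvPolynomial.eval a F = 0)}
    ⟨{1}, fun m a _ => by simp⟩
    (by
      intro 𝒜 h𝒜
      refine ⟨{F | ∃ Z ∈ 𝒜, ∀ (m : M) (a : ι → k), HomogCoord.IsRep a m → m ∈ Z →
        MvPolynomial.eval a F = 0}, fun m a ha => ⟨?_, ?_⟩⟩
      · rintro hm F ⟨Z, hZ, hF⟩
        exact hF m a ha (hm Z hZ)
      · intro h Z hZ
        obtain ⟨S, hS⟩ := h𝒜 hZ
        exact (hS m a ha).2 fun F hF =>
          h F ⟨Z, hZ, fun m' a' ha' hm' => (hS m' a' ha').1 hm' F hF⟩)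
    (by
      rintro Z ⟨S, hS⟩ W ⟨T, hT⟩
      refine ⟨{H | ∃ F ∈ S, ∃ G ∈ T, H = F * G}, fun m a ha => ⟨?_, ?_⟩⟩
      · rintro (hm | hm) H ⟨F, hF, G, hG, rfl⟩
        · simp [(hS m a ha).1 hm F hF]
        · simp [(hT m a ha).1 hm G hG]
      · intro h
        by_cases hm : m ∈ Z
        · exact Or.inl hm
        · refine Or.inr ((hT m a ha).2 fun G hG => ?_)
          have : ∃ F ∈ S, MvPolynomial.eval a F ≠ 0 := by
            by_contra hcon
            push Not at hcon
            exact hm ((hS m a ha).2 hcon)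
          obtain ⟨F, hF, hF0⟩ := this
          have := h (F * G) ⟨F, hF, G, hG, rfl⟩
          rw [map_mul] at this
          exact (mul_eq_zero.1 this).resolve_left hF0)

variable {M}

/-- Zariski closure. -/
def zclosure (Z : Set M) : Set M := closure[zariski k M] Z

/-- The dimension of a subset (Krull dimension for the induced Zariski topology). -/
def zdim (Z : Set M) : WithBot ℕ∞ :=
  @topologicalKrullDim Z ((zariski k M).induced Subtype.val)

/-- A projective variety in `M`: a closed irreducible (in particular nonempty) subset. -/
structure IsProjVariety (Z : Set M) : Prop where
  closed : IsClosed[zariski k M] Z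
  irreducible : @IsIrreducible M (zariski k M) Z

end Topology

section Tangent

variable {k : Type*} [Field k] {M M' : Type*} {ι κ : Type} [HomogCoord k M ι]
  [HomogCoord k M' κ] [Fintype ι] [Fintype κ]

/-- The affine cone over `Z`: all homogeneous coordinates of all points of `Z`. -/
def cone (k : Type*) [Field k] {M : Type*} {ι : Type} [HomogCoord k M ι] (Z : Set M) :
    Set (ι → k) :=
  {a | ∃ m ∈ Z, HomogCoord.IsRep a m}

/-- The differential of a polynomial `F` at the point `a` of affine space. -/
def polyDiff (F : MvPolynomial ι k) (a : ι → k) : (ι → k) →ₗ[k] k :=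
  ∑ i, MvPolynomial.eval a (MvPolynomial.pderiv i F) • LinearMap.proj i

/-- The Zariski tangent space at `a` of the affine cone over `Z`: the common kernel of the
differentials at `a` of all the polynomials that vanish on the cone. -/
def coneTangent (Z : Set M) (a : ι → k) : Submodule k (ι → k) :=
  ⨅ F ∈ MvPolynomial.vanishingIdeal k (cone k Z), LinearMap.ker (polyDiff F a)

/-! ### Rational maps, their differentials, rank and separability

A rational map is a partial function `f : M →. M'`. -/

/-- `P` is a local expression by polynomials in the homogeneous coordinates, on a neighbourhood of
`m` in `Z`, of the map `f`; in particular `f` is defined and is a morphism there. -/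
def IsLocalExpr (Z : Set M) (f : M →. M') (m : M) (P : κ → MvPolynomial ι k) : Prop :=
  ∃ U : Set M, IsOpen[zariski k M] U ∧ m ∈ U ∧ ∀ x ∈ U ∩ Z, ∃ y ∈ f x, ∀ a : ι → k,
    HomogCoord.IsRep a x → HomogCoord.IsRep (fun j => MvPolynomial.eval a (P j)) y

/-- The differential `d_m f : T_m Z → T_{f(m)} M'` has rank `r`. In coordinates `a` of `m`, the
tangent space `T_m Z` is the image of `coneTangent Z a`; the tangent space of `M'` at `y = f(m)`, in
the coordinates `b = P(a)` of `y`, is `κ → k` modulo the tangent space of the fibre over `y`, which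
is `coneTangent {y} b`; and `d_m f` is induced by the differential of `P` at `a`. -/
def HasDiffRank (k : Type*) [Field k] {M M' : Type*} {ι κ : Type} [HomogCoord k M ι]
    [HomogCoord k M' κ] [Fintype ι] [Fintype κ] (Z : Set M) (f : M →. M') (m : M) (r : ℕ) : Prop :=
  ∃ y ∈ f m, ∃ a : ι → k, HomogCoord.IsRep a m ∧ ∃ P : κ → MvPolynomial ι k,
    IsLocalExpr Z f m P ∧
    Module.finrank k ((coneTangent Z a).map
      ((coneTangent {y} (fun j => MvPolynomial.eval a (P j))).mkQ ∘ₗ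
        LinearMap.pi fun j => polyDiff (P j) a)) = r

/-- The rational map `f : Z ⇢ M'` has rank `r`: so has its differential at general points. -/
def HasRank (k : Type*) [Field k] {M M' : Type*} {ι κ : Type} [HomogCoord k M ι]
    [HomogCoord k M' κ] [Fintype ι] [Fintype κ] (Z : Set M) (f : M →. M') (r : ℕ) : Prop :=
  ∃ U : Set M, IsOpen[zariski k M] U ∧ (U ∩ Z).Nonempty ∧ ∀ m ∈ U ∩ Z, HasDiffRank k Z f m r

/-- The rational map `f : Z ⇢ M'` is separable (onto the closure of its image): its rank is the
dimension of its image. -/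
def IsSeparableMap (k : Type*) [Field k] {M M' : Type*} {ι κ : Type} [HomogCoord k M ι]
    [HomogCoord k M' κ] [Fintype ι] [Fintype κ] (Z : Set M) (f : M →. M') : Prop :=
  ∃ r : ℕ, HasRank k Z f r ∧ zdim k (zclosure k (f.image Z)) = r

/-- `f : Z ⇢ M'` is generically finite onto its image: its fibres over the points of a nonempty open
subset of the image are finite. -/
def IsGenericallyFinite (k : Type*) [Field k] {M M' : Type*} {κ : Type}
    [HomogCoord k M' κ] (Z : Set M) (f : M →. M') : Prop :=
  ∃ U : Set M', IsOpen[zariski k M'] U ∧ (U ∩ f.image Z).Nonempty ∧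
    ∀ y ∈ U, {m | m ∈ Z ∧ y ∈ f m}.Finite

end Tangent

variable {k : Type*} [Field k] {d n N : ℕ}

/-- The universal family of planes: pairs of a plane and a point of it. -/
def univFamily (k : Type*) [Field k] (d N : ℕ) : Set (Grass k d N × PSpace k N) :=
  {z | z.2.submodule ≤ z.1.1}

/-! ### The Gauss map -/

/-- The linear subspace of `k^(N+1)` whose projectivization is the embedded tangent space `𝕋_x X`:
the tangent space of the affine cone over `X` at a representative of `x`. -/
def embTangent (X : Set (PSpace k N)) (x : PSpace k N) : Submodule k (Fin (N + 1) → k) :=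
  coneTangent X x.rep

/-- The Gauss map of an `n`-dimensional `X ⊆ ℙ^N`. It is defined at the smooth points of `X`, which
are the points whose embedded tangent space has (projective) dimension `n`. -/
def gaussMap (n : ℕ) (X : Set (PSpace k N)) : PSpace k N →. Grass k (n + 1) N :=
  fun x => ⟨x ∈ X ∧ Module.finrank k (embTangent X x) = n + 1, fun h => ⟨embTangent X x, h.2⟩⟩

/-- The graph `Γ(X)` of the Gauss map: the closure of the set of the points `(γ(x), x)`. -/
def gaussGraph (n : ℕ) (X : Set (PSpace k N)) : Set (Grass k (n + 1) N × PSpace k N) :=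
  zclosure k {z | z.1 ∈ gaussMap n X z.2}

/-! ### The shrinking map of a subvariety of a Grassmannian -/

/-- The Zariski tangent space of `Y` at `L`, as a subspace of the tangent space
`Hom(L, k^(N+1)/L)` of the Grassmannian: a tangent vector `b` at the frame `a` of `L` corresponds to
the homomorphism that maps the `i`-th vector of `a` to the class of the `i`-th vector of `b`. -/
def grassTangent (Y : Set (Grass k d N)) (L : Grass k d N) :
    Submodule k (L.1 →ₗ[k] ((Fin (N + 1) → k) ⧸ L.1)) where
  carrier := {φ | ∀ a : Fin d × Fin (N + 1) → k, HomogCoord.IsRep a L →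
    ∃ b ∈ coneTangent Y a, ∀ (i : Fin d) (h : row a i ∈ L.1), φ ⟨row a i, h⟩ = L.1.mkQ (row b i)}
  zero_mem' := fun a _ => ⟨0, Submodule.zero_mem _, fun i _ => by
    rw [show row (0 : Fin d × Fin (N + 1) → k) i = 0 from rfl, map_zero, LinearMap.zero_apply]⟩
  add_mem' := by
    intro φ ψ hφ hψ a ha
    obtain ⟨b, hb, hb'⟩ := hφ a ha
    obtain ⟨c, hc, hc'⟩ := hψ a ha
    refine ⟨b + c, Submodule.add_mem _ hb hc, fun i h => ?_⟩
    rw [LinearMap.add_apply, hb' i h, hc' i h, ← map_add]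
    rfl
  smul_mem' := by
    intro t φ hφ a ha
    obtain ⟨b, hb, hb'⟩ := hφ a ha
    refine ⟨t • b, Submodule.smul_mem _ t hb, fun i h => ?_⟩
    rw [LinearMap.smul_apply, hb' i h, ← map_smul]
    rfl

/-- `L` is a smooth point of `Y`. -/
def IsSmoothPt (Y : Set (Grass k d N)) (L : Grass k d N) : Prop :=
  L ∈ Y ∧ (Module.finrank k (grassTangent Y L) : WithBot ℕ∞) = zdim k Y

/-- The homomorphism `Φ : L → Hom(T_L Y, k^(N+1)/L)`, `l ↦ (φ ↦ φ(l))`, that corresponds to the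
inclusion `T_L Y → Hom(L, k^(N+1)/L)`. -/
def Phi (Y : Set (Grass k d N)) (L : Grass k d N) :
    L.1 →ₗ[k] (grassTangent Y L →ₗ[k] ((Fin (N + 1) → k) ⧸ L.1)) :=
  (grassTangent Y L).subtype.flip

/-- The kernel of `Φ` at `L`, as a subspace of `k^(N+1)`. -/
def kerPhi (Y : Set (Grass k d N)) (L : Grass k d N) : Submodule k (Fin (N + 1) → k) :=
  (LinearMap.ker (Phi Y L)).map L.1.subtype

/-- On `U ∩ Y` all points are smooth and the kernel of `Φ` has dimension `r`. -/
def HasKerDimOn (Y U : Set (Grass k d N)) (r : ℕ) : Prop :=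
  ∀ L ∈ U ∩ Y, IsSmoothPt Y L ∧ Module.finrank k (kerPhi Y L) = r

/-- The number `n⁻ + 1`: the dimension of the kernel of `Φ` at a general point of `Y`. (For an
irreducible `Y` there is exactly one `r` as below.) -/
def shrinkRank (Y : Set (Grass k d N)) : ℕ :=
  sInf {r | ∃ U : Set (Grass k d N), IsOpen[zariski k (Grass k d N)] U ∧ (U ∩ Y).Nonempty ∧
    HasKerDimOn Y U r}

/-- The shrinking map `σ_Y : Y ⇢ 𝔾(n⁻, ℙ^N)`, `L ↦ ker Φ_L`, defined on the largest open set of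
smooth points of `Y` on which the kernel of `Φ` has dimension `n⁻ + 1`. -/
def shrinkMap (Y : Set (Grass k d N)) : Grass k d N →. Grass k (shrinkRank Y) N :=
  fun L => ⟨L ∈ Y ∧ Module.finrank k (kerPhi Y L) = shrinkRank Y ∧
      ∃ U : Set (Grass k d N), IsOpen[zariski k (Grass k d N)] U ∧ L ∈ U ∧
        HasKerDimOn Y U (shrinkRank Y),
    fun h => ⟨kerPhi Y L, h.2.1⟩⟩

/-- The pull-back `σ_Y^* 𝒰`: the closure of the set of the pairs `(L, x)` such that `σ_Y` is defined
at `L` and `(σ_Y(L), x)` belongs to the universal family over `𝔾(n⁻, ℙ^N)`. -/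
def shrinkPullback (Y : Set (Grass k d N)) : Set (Grass k d N × PSpace k N) :=
  zclosure k {z | ∃ E ∈ shrinkMap Y z.1, (E, z.2) ∈ univFamily k (shrinkRank Y) N}

/-- The second projection `𝔾 × ℙ^N → ℙ^N`, as a partial function defined everywhere. -/
def proj₂ (k : Type*) [Field k] (d N : ℕ) : Grass k d N × PSpace k N →. PSpace k N :=
  PFun.lift Prod.snd

end GaussMaps

end

noncomputable section

set_option linter.unusedSectionVars false

namespace GaussMaps

open MvPolynomial HomogCoord

universe w

/-! ### Differentials of polynomials -/

section Differential

variable {k : Type*} [Field k] {ι κ : Type} [Fintype ι] [Fintype κ]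

/-! Write γ for the Gauss map, Γ for its graph and σ*U for the pull-back of the universal family.
The heart is the second fundamental form. Near a smooth point γ is given by a polynomial frame P(c)
of the tangent space at c of the cone over X. For F vanishing on X the relation dF_c(P_i(c)) = 0
holds along the cone; differentiating it in a tangent direction v gives Hess F(v, P_i(c)) +
dF_c(dP_i(v)) = 0 (`hess_add_polyDiff_frameDiff`). So dγ(v) = 0 exactly when every such Hessian
pairs v to zero with the tangent space (`frameDiff_mem_rowsIn_iff`). If the tangent space of Y is
the image of dγ, the same relation read in the other slot describes ker Φ by the same condition
(`mem_kerPhi_iff_hess`). Hessians are symmetric in every characteristic, so ker Φ is the kernel of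
dγ on the cone, and it contains the point c itself (`hess_self_eq_zero`).

(1 ⇒ 2) Separability says that the image of dγ fills the tangent space of Y at general points. Hence
general points of Γ lie in σ*U, and ker Φ has dimension n + 1 - dim Y. The irreducible closed sets Γ
⊆ σ*U then have the same dimension and coincide. (2 ⇒ 1) A tangent vector b of Y lifts to a tangent
vector (b, w) of σ*U = Γ. Comparing the Hessian relations of (b, w) and (dP(w), w) shows that b is
dγ(w), so dγ is onto. (2 ⇒ 3) Γ has a single point over each smooth point of X and a local section
there; completeness of the Grassmannian makes the projection surjective. (3 ⇒ 2) If x lies in ker Φ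
at L, then moving L inside Y moves x inside L to first order, so tangent vectors of σ*U project into
L (`inr_mem_of_mem_coneTangent_shrinkPullback`). Separability makes these projections fill the
tangent space at x, and equality of dimensions gives L = T_x X.

For (B): over a general L the fibre of γ consists of the smooth points of X in the linear space
ℙ(ker Φ), and it is dense there. For (C): apply (A) to the image of σ*U, which is closed by
`isClosed_image_snd`.

Everything is computed on affine cones of homogeneous coordinates. Dimension is read off from
tangent spaces of cones (`zdim_eq_coneDim_sub`); the algebraic input is that over a perfect field
the Kähler differentials of a function field have rank the transcendence degree
(`finrank_kaehlerDifferential`). Families of linear spaces (tangent spaces, kernels, normal spaces)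
are handled by local polynomial frames coming from Cramer's rule (`exists_frame`). -/

theorem polyDiff_apply (F : MvPolynomial ι k) (a v : ι → k) :
    polyDiff F a v = ∑ i, eval a (pderiv i F) * v i := by
  simp [polyDiff]

@[simp] theorem polyDiff_add (F G : MvPolynomial ι k) (a v : ι → k) :
    polyDiff (F + G) a v = polyDiff F a v + polyDiff G a v := by
  simp [polyDiff_apply, add_mul, Finset.sum_add_distrib]

@[simp] theorem polyDiff_mul (F G : MvPolynomial ι k) (a v : ι → k) :
    polyDiff (F * G) a v = eval a F * polyDiff G a v + eval a G * polyDiff F a v := by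
  simp only [polyDiff_apply, Derivation.leibniz, smul_eq_mul, map_add, map_mul, add_mul,
    Finset.sum_add_distrib, Finset.mul_sum, mul_assoc]

@[simp] theorem polyDiff_C (c : k) (a v : ι → k) : polyDiff (C c : MvPolynomial ι k) a v = 0 := by
  simp [polyDiff_apply]

@[simp] theorem polyDiff_zero (a v : ι → k) : polyDiff (0 : MvPolynomial ι k) a v = 0 := by
  simpa using polyDiff_C (0 : k) a v

@[simp] theorem polyDiff_X (i : ι) (a v : ι → k) :
    polyDiff (X i : MvPolynomial ι k) a v = v i := by
  classical
  simp [polyDiff_apply, pderiv_X, Pi.single_apply, apply_ite, ite_mul]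

@[simp] theorem polyDiff_sub (F G : MvPolynomial ι k) (a v : ι → k) :
    polyDiff (F - G) a v = polyDiff F a v - polyDiff G a v := by
  simp [polyDiff_apply, sub_mul, Finset.sum_sub_distrib]

theorem polyDiff_sum {α : Type*} (s : Finset α) (F : α → MvPolynomial ι k) (a v : ι → k) :
    polyDiff (∑ x ∈ s, F x) a v = ∑ x ∈ s, polyDiff (F x) a v := by
  classical
  induction s using Finset.induction_on with
  | empty => simp
  | insert x s hx ih => simp [Finset.sum_insert hx, ih]

theorem eval_bind₁ {σ τ : Type*} (P : τ → MvPolynomial σ k) (F : MvPolynomial τ k) (a : σ → k) :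
    eval a (bind₁ P F) = eval (fun j => eval a (P j)) F := by
  induction F using MvPolynomial.induction_on with
  | C c => simp
  | add F G hF hG => simp [hF, hG]
  | mul_X F j hF => simp [hF]

/-- The chain rule. -/
theorem polyDiff_bind₁ (P : κ → MvPolynomial ι k) (F : MvPolynomial κ k) (a v : ι → k) :
    polyDiff (bind₁ P F) a v =
      polyDiff F (fun j => eval a (P j)) (fun j => polyDiff (P j) a v) := by
  induction F using MvPolynomial.induction_on with
  | C c => simp
  | add F G hF hG => simp [hF, hG]
  | mul_X F j hF =>
    simp [hF, eval_bind₁]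

/-- The commutator of two derivations is a derivation, and this one kills the variables. -/
theorem pderiv_pderiv_comm {σ : Type*} (i j : σ) (F : MvPolynomial σ k) :
    pderiv i (pderiv j F) = pderiv j (pderiv i F) := by
  classical
  have h : ⁅(pderiv i : Derivation k (MvPolynomial σ k) (MvPolynomial σ k)),
      (pderiv j : Derivation k (MvPolynomial σ k) (MvPolynomial σ k))⁆ = 0 := by
    refine MvPolynomial.derivation_ext fun l => ?_
    simp [Derivation.commutator_apply, pderiv_X, Pi.single_apply, apply_ite]
  have := DFunLike.congr_fun h F
  rw [Derivation.commutator_apply] at this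
  simpa [sub_eq_zero] using this

/-- The polynomial whose value at a point is the derivative of `F` in the direction `w`. -/
def dirDeriv (F : MvPolynomial ι k) (w : ι → k) : MvPolynomial ι k := ∑ i, C (w i) * pderiv i F

/-- The second derivative of `F` at `a` in the directions `v` and `w`. -/
def hess (F : MvPolynomial ι k) (a v w : ι → k) : k := polyDiff (dirDeriv F w) a v

theorem hess_eq (F : MvPolynomial ι k) (a v w : ι → k) :
    hess F a v w = ∑ i, w i * polyDiff (pderiv i F) a v := by
  simp [hess, dirDeriv, polyDiff_sum]

/-- Partial derivatives commute in every characteristic. This symmetry is what identifies the kernel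
of `Φ` with the kernel of the differential of the Gauss map. -/
theorem hess_comm (F : MvPolynomial ι k) (a v w : ι → k) : hess F a v w = hess F a w v := by
  simp only [hess_eq, polyDiff_apply, Finset.mul_sum]
  rw [Finset.sum_comm]
  refine Finset.sum_congr rfl fun i _ => Finset.sum_congr rfl fun j _ => ?_
  rw [pderiv_pderiv_comm i j]
  ring

theorem hess_sum_right {α : Type*} [Fintype α] (F : MvPolynomial ι k) (a v : ι → k) (c : α → k)
    (w : α → ι → k) : hess F a v (∑ x, c x • w x) = ∑ x, c x * hess F a v (w x) := by
  simp only [hess_eq, Finset.sum_apply, Pi.smul_apply, smul_eq_mul, Finset.sum_mul,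
    Finset.mul_sum]
  rw [Finset.sum_comm]
  simp [mul_assoc]

/-- The derivative along a vector `v` of the pairing of the differential of `F` with a polynomial
vector field `P`. -/
theorem polyDiff_pairing (F : MvPolynomial ι k) (P : ι → MvPolynomial ι k) (a v : ι → k) :
    polyDiff (∑ i, pderiv i F * P i) a v =
      hess F a v (fun i => eval a (P i)) + polyDiff F a (fun i => polyDiff (P i) a v) := by
  rw [polyDiff_sum, hess_eq, polyDiff_apply F, ← Finset.sum_add_distrib]
  exact Finset.sum_congr rfl fun i _ => by rw [polyDiff_mul]; ring

end Differential

/-! ### Frames of the solution spaces of linear systems with coefficients in a ring -/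

section Frame

variable {R : Type*} [CommRing R] {q : Type*} [Fintype q]

/-- The solution space of the linear system `𝓔` with coefficients specialized by `e`. -/
def kerAt {L : Type*} [Field L] (e : R →+* L) (𝓔 : Set (q → R)) : Submodule L (q → L) where
  carrier := {v | ∀ E ∈ 𝓔, ∑ i, e (E i) * v i = 0}
  zero_mem' := by simp
  add_mem' := by
    intro v w hv hw E hE
    simp [mul_add, Finset.sum_add_distrib, hv E hE, hw E hE]
  smul_mem' := by
    intro c v hv E hE
    have := congrArg (c * ·) (hv E hE)
    simpa [Finset.mul_sum, mul_left_comm] using this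

theorem mem_kerAt {L : Type*} [Field L] {e : R →+* L} {𝓔 : Set (q → R)} {v : q → L} :
    v ∈ kerAt e 𝓔 ↔ ∀ E ∈ 𝓔, ∑ i, e (E i) * v i = 0 := Iff.rfl

/-- A maximal independent set of specialized equations is completed by unit vectors to a basis, and
the basis is lifted to a square matrix over `R`. The rows marked by `p` are equations of the system,
and at `e₀` they already cut out the whole solution space. -/
theorem exists_frame_aux [DecidableEq q] {L : Type*} [Field L] (e₀ : R →+* L)
    (he₀ : ∀ f : q → L, f ∈ Set.range (fun i => (Pi.single i 1 : q → L)) →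
      ∃ g : q → R, (fun i => e₀ (g i)) = f) (𝓔 : Set (q → R)) :
    ∃ (p : q → Prop) (M : Matrix q q R), (∀ i, p i → M i ∈ 𝓔) ∧ e₀ M.det ≠ 0 ∧
      ∀ v : q → L, (∀ i, p i → ∑ j, e₀ (M i j) * v j = 0) → v ∈ kerAt e₀ 𝓔 := by
  set A : Set (q → L) := (fun (E : q → R) i => e₀ (E i)) '' 𝓔 with hA
  obtain ⟨b, hbA, hbs, hbi⟩ := exists_linearIndependent L A
  have hbi' : LinearIndepOn L id b := hbi
  set T : Set (q → L) := b ∪ Set.range (fun i => (Pi.single i 1 : q → L)) with hT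
  obtain ⟨b', hb'T, hbb', hTs, hb'i⟩ :=
    exists_linearIndepOn_id_extension hbi' (Set.subset_union_left : b ⊆ T)
  have hspan : ⊤ ≤ Submodule.span L (Set.range ((↑) : b' → q → L)) := by
    rw [Subtype.range_coe]
    have : Submodule.span L (Set.range (fun i => (Pi.single i 1 : q → L))) = ⊤ := by
      have := (Pi.basisFun L q).span_eq
      convert this using 3
      ext i : 1
      simp [Pi.basisFun_apply]
    rw [← this]
    exact Submodule.span_le.2 fun x hx => hTs (Or.inr hx)
  let B : Module.Basis b' L (q → L) := Module.Basis.mk (v := ((↑) : b' → q → L)) hb'i hspan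
  let σ : b' ≃ q := B.indexEquiv (Pi.basisFun L q)
  have hlift : ∀ β : b', ∃ g : q → R, (fun i => e₀ (g i)) = (β : q → L) ∧
      ((β : q → L) ∈ b → g ∈ 𝓔) := by
    intro β
    by_cases hβ : (β : q → L) ∈ b
    · obtain ⟨E, hE, h⟩ := hbA hβ
      exact ⟨E, h, fun _ => hE⟩
    · rcases hb'T β.2 with h | h
      · exact absurd h hβ
      · obtain ⟨g, hg⟩ := he₀ _ h
        exact ⟨g, hg, fun h => absurd h hβ⟩
  choose g hg hg' using hlift
  have hMv : ∀ i j, e₀ (g (σ.symm i) j) = (σ.symm i : q → L) j := fun i j =>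
    congrFun (hg (σ.symm i)) j
  refine ⟨fun i => (σ.symm i : q → L) ∈ b, Matrix.of fun i => g (σ.symm i),
    fun i hi => hg' _ hi, ?_, ?_⟩
  · have hli : LinearIndependent L (fun i => (σ.symm i : q → L)) :=
      hb'i.comp σ.symm σ.symm.injective
    have h2 : IsUnit (Matrix.of fun i => (σ.symm i : q → L)) :=
      Matrix.linearIndependent_rows_iff_isUnit.1 hli
    have h3 : e₀ (Matrix.of fun i => g (σ.symm i)).det =
        (Matrix.of fun i => (σ.symm i : q → L)).det := by
      rw [RingHom.map_det]
      congr 1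
      ext i j
      simp [hMv]
    rw [h3]
    exact ((Matrix.isUnit_iff_isUnit_det _).1 h2).ne_zero
  · intro v hv E hE
    have hmem : (fun i => e₀ (E i)) ∈ Submodule.span L b := by
      rw [hbs]
      exact Submodule.subset_span ⟨E, hE, rfl⟩
    let φ : (q → L) →ₗ[L] L := ∑ i, v i • LinearMap.proj i
    have hφ : ∀ f, φ f = ∑ i, f i * v i := fun f => by simp [φ, mul_comm]
    have : Submodule.span L b ≤ LinearMap.ker φ := by
      refine Submodule.span_le.2 fun β hβ => ?_
      have := hv (σ ⟨β, hbb' hβ⟩) (by simpa using hβ)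
      simp only [Matrix.of_apply, hMv] at this
      simpa [hφ] using this
    simpa [hφ] using this hmem

/-- Cramer's rule: `v` is a multiple of `adj(M) (M v)`, and `M v` vanishes at the indices in `p` if
`v` solves the system. Only an inclusion is available, because away from `e₀` the system may contain
further independent equations. -/
theorem frame_of_minor [DecidableEq q] {𝓔 : Set (q → R)} {p : q → Prop} {M : Matrix q q R}
    (hp : ∀ i, p i → M i ∈ 𝓔) {L' : Type w} [Field L'] (e : R →+* L') (he : e M.det ≠ 0) :
    LinearIndependent L' (fun (j : {i // ¬ p i}) i => e (M.adjugate i j)) ∧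
      kerAt e 𝓔 ≤ Submodule.span L' (Set.range fun (j : {i // ¬ p i}) i => e (M.adjugate i j)) := by
  classical
  have hadj : e.mapMatrix M.adjugate * e.mapMatrix M = e M.det • 1 := by
    rw [← map_mul, Matrix.adjugate_mul]
    ext i j
    by_cases h : i = j
    · subst h; simp
    · simp [h]
  have hunit : IsUnit (e.mapMatrix M.adjugate) := by
    rw [Matrix.isUnit_iff_isUnit_det, isUnit_iff_ne_zero]
    intro h0
    have := congrArg Matrix.det hadj
    rw [Matrix.det_mul, h0, zero_mul, Matrix.det_smul, Matrix.det_one, mul_one] at this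
    exact pow_ne_zero _ he this.symm
  constructor
  · have := (Matrix.linearIndependent_cols_iff_isUnit.2 hunit).comp
      (Subtype.val : {i // ¬ p i} → q) Subtype.val_injective
    exact this
  · intro v hv
    have h1 : e M.det • v = (e.mapMatrix M.adjugate).mulVec ((e.mapMatrix M).mulVec v) := by
      rw [Matrix.mulVec_mulVec, hadj, Matrix.smul_mulVec, Matrix.one_mulVec]
    have h2 : v = (e M.det)⁻¹ • ∑ j : {i // ¬ p i}, ((e.mapMatrix M).mulVec v) j • fun i => e (M.adjugate i j) := by
      rw [eq_inv_smul_iff₀ he, h1]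
      ext i
      simp only [Finset.sum_apply, Pi.smul_apply, smul_eq_mul]
      rw [← Finset.sum_subtype (Finset.univ.filter (¬ p ·)) (p := fun i => ¬ p i)
        (f := fun j => ((e.mapMatrix M).mulVec v) j * e (M.adjugate i j)) (by simp),
        Finset.sum_filter]
      refine Finset.sum_congr rfl fun j _ => ?_
      split_ifs with h
      · rw [show (e.mapMatrix M).mulVec v j = 0 from hv _ (hp j h), mul_zero]
      · exact mul_comm (e (M.adjugate i j)) _
    rw [h2]
    exact Submodule.smul_mem _ _ (Submodule.sum_mem _ fun j _ =>
      Submodule.smul_mem _ _ (Submodule.subset_span ⟨j, rfl⟩))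

/-- The solution space of a linear system over `R` has, in a neighbourhood of a point `e₀` of the
spectrum, a bound by the span of a frame of vectors with coefficients in `R`, which at `e₀` is a
frame of the solution space. -/
theorem exists_frame {L : Type*} [Field L] (e₀ : R →+* L) (𝓔 : Set (q → R)) :
    ∃ (Q : Fin (Module.finrank L (kerAt e₀ 𝓔)) → q → R) (D : R), e₀ D ≠ 0 ∧
      (∀ j, (fun i => e₀ (Q j i)) ∈ kerAt e₀ 𝓔) ∧
      ∀ {L' : Type w} [Field L'] (e : R →+* L'), e D ≠ 0 →
        LinearIndependent L' (fun j i => e (Q j i)) ∧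
        kerAt e 𝓔 ≤ Submodule.span L' (Set.range fun j i => e (Q j i)) := by
  classical
  obtain ⟨p, M, hp, hM, hker⟩ := exists_frame_aux e₀ (by
    rintro f ⟨i, rfl⟩
    refine ⟨Pi.single i 1, ?_⟩
    ext j
    by_cases h : j = i
    · subst h; simp
    · simp [h]) 𝓔
  let J := {i // ¬ p i}
  let Q' : J → q → R := fun j i => M.adjugate i j
  have hmem : ∀ j : J, (fun i => e₀ (Q' j i)) ∈ kerAt e₀ 𝓔 := by
    intro j
    refine hker _ fun i hi => ?_
    have h := congrFun (congrFun (Matrix.mul_adjugate M) i) j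
    have hij : i ≠ j := fun h => j.2 (h ▸ hi)
    rw [Matrix.mul_apply] at h
    have := congrArg e₀ h
    simpa [map_sum, hij] using this
  have hcard : Module.finrank L (kerAt e₀ 𝓔) = Fintype.card J := by
    obtain ⟨h1, h2⟩ := frame_of_minor hp e₀ hM
    have h3 : kerAt e₀ 𝓔 = Submodule.span L (Set.range fun (j : J) i => e₀ (Q' j i)) := by
      refine le_antisymm h2 (Submodule.span_le.2 ?_)
      rintro _ ⟨j, rfl⟩
      exact hmem j
    rw [h3, finrank_span_eq_card h1]
  let τ : Fin (Module.finrank L (kerAt e₀ 𝓔)) ≃ J := (finCongr hcard).trans (Fintype.equivFin J).symm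
  refine ⟨fun j => Q' (τ j), M.det, hM, fun j => hmem _, fun e he => ?_⟩
  obtain ⟨h1, h2⟩ := frame_of_minor hp e he
  refine ⟨h1.comp τ τ.injective, h2.trans (Submodule.span_mono ?_)⟩
  rintro _ ⟨j, rfl⟩
  exact ⟨τ.symm j, by simp [Q']⟩

end Frame

/-! ### Restriction of polynomials to lines, composition with linear maps -/

section Lines

variable {k : Type*} [Field k] {ι : Type}

/-- The parametrization of the line through `a` in the direction `v`. -/
def linePoly (a v : ι → k) (i : ι) : MvPolynomial Unit k := C (a i) + C (v i) * X ()

theorem eval_bind₁_linePoly (a v : ι → k) (t : Unit → k) (F : MvPolynomial ι k) :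
    eval t (bind₁ (linePoly a v) F) = eval (a + t () • v) F := by
  rw [eval_bind₁]
  congr 2
  ext i
  simp [linePoly, mul_comm]

/-- On the line both polynomials become nonzero polynomials in one variable, so their product is
nonzero and, over an infinite field, has a non-root. -/
theorem exists_line_eval_ne_zero [Infinite k] {a b : ι → k} {F G : MvPolynomial ι k}
    (hF : eval a F ≠ 0) (hG : eval b G ≠ 0) :
    ∃ t : k, eval (a + t • (b - a)) F ≠ 0 ∧ eval (a + t • (b - a)) G ≠ 0 := by
  by_contra! hcon
  have h : bind₁ (linePoly a (b - a)) F * bind₁ (linePoly a (b - a)) G = 0 := by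
    refine MvPolynomial.funext fun t => ?_
    rw [map_mul, eval_bind₁_linePoly, eval_bind₁_linePoly, map_zero, mul_eq_zero]
    by_contra! h
    exact h.2 (hcon _ h.1)
  rcases mul_eq_zero.1 h with h | h
  · refine hF ?_
    have := eval_bind₁_linePoly a (b - a) 0 F
    simpa [h] using this.symm
  · refine hG ?_
    have := eval_bind₁_linePoly a (b - a) 1 G
    simpa [h] using this.symm

theorem polyDiff_eq_zero_of_line [Infinite k] [Fintype ι] {a v : ι → k} {F : MvPolynomial ι k}
    (h : ∀ t : k, eval (a + t • v) F = 0) : polyDiff F a v = 0 := by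
  have h0 : bind₁ (linePoly a v) F = 0 :=
    MvPolynomial.funext fun t => by rw [eval_bind₁_linePoly, h, map_zero]
  have := polyDiff_bind₁ (linePoly a v) F 0 1
  rw [h0] at this
  simpa [linePoly] using this.symm

variable [Fintype ι] {κ : Type}

/-- The coordinates of a linear map, as polynomials. -/
def linPoly (g : (ι → k) →ₗ[k] (κ → k)) (j : κ) : MvPolynomial ι k := by
  classical exact ∑ i, C (g (Pi.single i 1) j) * X i

theorem linear_apply_eq_sum (g : (ι → k) →ₗ[k] (κ → k)) (a : ι → k) (j : κ) [DecidableEq ι] :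
    g a j = ∑ i, g (Pi.single i 1) j * a i := by
  conv_lhs => rw [pi_eq_sum_univ' a, map_sum, Finset.sum_apply]
  refine Finset.sum_congr rfl fun i _ => ?_
  rw [map_smul, Pi.smul_apply, smul_eq_mul, mul_comm]

@[simp] theorem eval_linPoly (g : (ι → k) →ₗ[k] (κ → k)) (a : ι → k) (j : κ) :
    eval a (linPoly g j) = g a j := by
  classical
  rw [linear_apply_eq_sum]
  simp only [linPoly, map_sum, map_mul, eval_C, eval_X]

@[simp] theorem polyDiff_linPoly (g : (ι → k) →ₗ[k] (κ → k)) (a v : ι → k) (j : κ) :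
    polyDiff (linPoly g j) a v = g v j := by
  classical
  rw [linear_apply_eq_sum]
  simp only [linPoly, polyDiff_sum, polyDiff_mul, polyDiff_C, polyDiff_X, eval_C, mul_zero,
    add_zero]

theorem eval_bind₁_linPoly (g : (ι → k) →ₗ[k] (κ → k)) (F : MvPolynomial κ k) (a : ι → k) :
    eval a (bind₁ (linPoly g) F) = eval (g a) F := by
  rw [eval_bind₁]
  simp

theorem polyDiff_bind₁_linPoly [Fintype κ] (g : (ι → k) →ₗ[k] (κ → k)) (F : MvPolynomial κ k)
    (a v : ι → k) : polyDiff (bind₁ (linPoly g) F) a v = polyDiff F (g a) (g v) := by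
  rw [polyDiff_bind₁]
  simp

end Lines

/-! ### Spaces in which the coordinates of a point form an open part of a linear space -/

/-- Homogeneous coordinates such that the coordinates of each point form an open part of a linear
space of a fixed dimension, permuted transitively by linear automorphisms that preserve the
points. -/
class FibreCoord (k : Type*) [Field k] (M : Type*) {ι : Type} [HomogCoord k M ι] where
  fibre : M → Submodule k (ι → k)
  fdim : ℕ
  disc : M → MvPolynomial ι k
  finrank_fibre : ∀ m : M, Module.finrank k (fibre m) = fdim
  isRep_iff : ∀ (a : ι → k) (m : M), IsRep a m ↔ a ∈ fibre m ∧ eval a (disc m) ≠ 0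
  exists_isRep : ∀ m : M, ∃ a : ι → k, IsRep a m
  isRep_unique : ∀ {a : ι → k} {m m' : M}, IsRep a m → IsRep a m' → m = m'
  exists_trans : ∀ {a b : ι → k} {m : M}, IsRep a m → IsRep b m →
    ∃ g : (ι → k) ≃ₗ[k] (ι → k), g a = b ∧ ∀ (m' : M) (c : ι → k), IsRep c m' → IsRep (g c) m'

/-! ### The ideal of the affine cone. -/

section Ideal

variable (k : Type*) [Field k] {M : Type*} {ι : Type} [HomogCoord k M ι]

/-- The ideal of the polynomials that vanish on the affine cone over `Z`. -/
abbrev coneIdeal (Z : Set M) : Ideal (MvPolynomial ι k) := vanishingIdeal k (cone k Z)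

variable {k}

theorem mem_coneIdeal {Z : Set M} {F : MvPolynomial ι k} :
    F ∈ coneIdeal k Z ↔ ∀ m ∈ Z, ∀ a : ι → k, IsRep a m → eval a F = 0 := by
  rw [mem_vanishingIdeal_iff]
  constructor
  · intro h m hm a ha
    simpa [aeval_eq_eval] using h a ⟨m, hm, ha⟩
  · rintro h a ⟨m, hm, ha⟩
    simpa [aeval_eq_eval] using h m hm a ha

theorem coneIdeal_anti {Z W : Set M} (h : Z ⊆ W) : coneIdeal k W ≤ coneIdeal k Z :=
  fun _ hF => mem_coneIdeal.2 fun m hm => mem_coneIdeal.1 hF m (h hm)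

theorem mem_coneTangent [Fintype ι] {Z : Set M} {a v : ι → k} :
    v ∈ coneTangent Z a ↔ ∀ F ∈ coneIdeal k Z, polyDiff F a v = 0 := by
  simp [coneTangent]

theorem coneTangent_anti [Fintype ι] {Z W : Set M} (h : Z ⊆ W) (a : ι → k) :
    coneTangent Z a ≤ coneTangent W a := fun _ hv =>
  mem_coneTangent.2 fun F hF => mem_coneTangent.1 hv F (coneIdeal_anti h hF)

/-- The points some of whose coordinates are not zeros of `F`. -/
def basicOpen (M : Type*) {ι : Type} [HomogCoord k M ι] (F : MvPolynomial ι k) : Set M :=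
  {m | ∃ a : ι → k, IsRep a m ∧ eval a F ≠ 0}

theorem notMem_coneIdeal {Z : Set M} {F : MvPolynomial ι k} :
    F ∉ coneIdeal k Z ↔ (Z ∩ basicOpen M F).Nonempty := by
  rw [mem_coneIdeal]
  push Not
  constructor
  · rintro ⟨m, hm, a, ha, h⟩
    exact ⟨m, hm, a, ha, h⟩
  · rintro ⟨m, hm, a, ha, h⟩
    exact ⟨m, hm, a, ha, h⟩

theorem exists_of_isOpen {U : Set M} (hU : IsOpen[zariski k M] U) {m : M} (hm : m ∈ U)
    {a : ι → k} (ha : IsRep a m) : ∃ D : MvPolynomial ι k, eval a D ≠ 0 ∧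
      ∀ (m' : M) (a' : ι → k), IsRep a' m' → eval a' D ≠ 0 → m' ∈ U := by
  obtain ⟨S, hS⟩ : ∃ S : Set (MvPolynomial ι k), ∀ (m : M) (a : ι → k), HomogCoord.IsRep a m →
      (m ∈ Uᶜ ↔ ∀ F ∈ S, MvPolynomial.eval a F = 0) := hU
  have : ¬ ∀ F ∈ S, MvPolynomial.eval a F = 0 := fun h => (hS m a ha).2 h hm
  push Not at this
  obtain ⟨F, hF, h⟩ := this
  refine ⟨F, h, fun m' a' ha' h' => ?_⟩
  by_contra hcon
  exact h' ((hS m' a' ha').1 hcon F hF)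

end Ideal

/-! ### The Zariski topology in terms of cone ideals. -/

section Topology

variable {k : Type*} [Field k] {M : Type*} {ι : Type} [HomogCoord k M ι] [Fintype ι]
  [FibreCoord k M]

variable (k) in
theorem exists_rep (m : M) : ∃ a : ι → k, IsRep a m := FibreCoord.exists_isRep m

variable (k) in
-- The complement is cut out by all the polynomials whose nonvanishing forces membership in `U`. One
-- system of coordinates per point suffices, since a linear automorphism that preserves the points
-- carries the witness `D` to any other system.
theorem isOpen_of_forall {U : Set M} (h : ∀ m ∈ U, ∃ a : ι → k, IsRep a m ∧
    ∃ D : MvPolynomial ι k, eval a D ≠ 0 ∧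
      ∀ (m' : M) (a' : ι → k), IsRep a' m' → eval a' D ≠ 0 → m' ∈ U) :
    IsOpen[zariski k M] U := by
  refine ⟨{D | ∀ (m' : M) (a' : ι → k), IsRep a' m' → eval a' D ≠ 0 → m' ∈ U}, fun m a ha => ?_⟩
  constructor
  · intro hm F hF
    by_contra hcon
    exact hm (hF m a ha hcon)
  · intro hF hm
    obtain ⟨b, hb, D, hD, hD'⟩ := h m hm
    obtain ⟨g, hg, hg'⟩ := FibreCoord.exists_trans ha hb
    have := hF (bind₁ (linPoly g.toLinearMap) D) fun m' a' ha' h' => by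
      rw [eval_bind₁_linPoly] at h'
      exact hD' m' _ (hg' m' a' ha') h'
    rw [eval_bind₁_linPoly] at this
    exact hD (by simpa [hg] using this)

theorem isOpen_basicOpen (F : MvPolynomial ι k) : IsOpen[zariski k M] (basicOpen M F) :=
  isOpen_of_forall k fun _ ⟨a, ha, h⟩ => ⟨a, ha, F, h, fun _ a' ha' h' => ⟨a', ha', h'⟩⟩

/-- The sets `basicOpen` form a basis of the topology. The criterion may be tested at any one system
of coordinates of the point. -/
theorem mem_zclosure_iff {Z : Set M} {m : M} {a : ι → k} (ha : IsRep a m) :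
    m ∈ zclosure k Z ↔ ∀ F ∈ coneIdeal k Z, eval a F = 0 := by
  let _ := zariski k M
  rw [zclosure, mem_closure_iff]
  constructor
  · intro h F hF
    by_contra hcon
    obtain ⟨z, ⟨b, hb, hb'⟩, hz⟩ := h _ (isOpen_basicOpen F) ⟨a, ha, hcon⟩
    exact hb' (mem_coneIdeal.1 hF z hz b hb)
  · intro h o ho hm
    by_contra hcon
    obtain ⟨D, hD, hD'⟩ := exists_of_isOpen ho hm ha
    refine hD (h D (mem_coneIdeal.2 fun z hz b hb => ?_))
    by_contra h'
    exact hcon ⟨z, hD' z b hb h', hz⟩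

theorem subset_zclosure (Z : Set M) : Z ⊆ zclosure k Z :=
  @subset_closure M (zariski k M) Z

theorem isClosed_zclosure (Z : Set M) : IsClosed[zariski k M] (zclosure k Z) :=
  @isClosed_closure M (zariski k M) Z

theorem zclosure_eq {Z : Set M} (hZ : IsClosed[zariski k M] Z) : zclosure k Z = Z :=
  @IsClosed.closure_eq M (zariski k M) Z hZ

theorem zclosure_subset {Z W : Set M} (h : Z ⊆ W) (hW : IsClosed[zariski k M] W) :
    zclosure k Z ⊆ W := @closure_minimal M (zariski k M) Z W h hW

theorem zclosure_mono {Z W : Set M} (h : Z ⊆ W) : zclosure k Z ⊆ zclosure k W :=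
  @closure_mono M (zariski k M) Z W h

theorem coneIdeal_zclosure (Z : Set M) : coneIdeal k (zclosure k Z) = coneIdeal k Z :=
  le_antisymm (coneIdeal_anti (subset_zclosure Z)) fun F hF =>
    mem_coneIdeal.2 fun _ hm _ ha => (mem_zclosure_iff ha).1 hm F hF

theorem mem_of_coneIdeal {Z : Set M} (hZ : IsClosed[zariski k M] Z) {m : M} {a : ι → k}
    (ha : IsRep a m) (h : ∀ F ∈ coneIdeal k Z, eval a F = 0) : m ∈ Z := by
  rw [← zclosure_eq hZ]
  exact (mem_zclosure_iff ha).2 h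

theorem isClosed_of_forall {Z : Set M} (h : ∀ m, (∀ a : ι → k, IsRep a m →
    ∀ F ∈ coneIdeal k Z, eval a F = 0) → m ∈ Z) : IsClosed[zariski k M] Z := by
  have : zclosure k Z = Z := (subset_zclosure Z).antisymm' fun m hm =>
    h m fun a ha => (mem_zclosure_iff ha).1 hm
  rw [← this]
  exact isClosed_zclosure Z

/-- The coordinates of a point form an open part of a linear space; the line through two of them
contains coordinates that satisfy both open conditions and are still coordinates, the latter because
the discriminant is included as a factor. -/
theorem exists_isRep_eval_ne_zero [Infinite k] {m : M} {F G : MvPolynomial ι k}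
    (hF : m ∈ basicOpen M F) (hG : m ∈ basicOpen M G) :
    ∃ a : ι → k, IsRep a m ∧ eval a F ≠ 0 ∧ eval a G ≠ 0 := by
  obtain ⟨a, ha, hF⟩ := hF
  obtain ⟨b, hb, hG⟩ := hG
  obtain ⟨ha1, ha2⟩ := (FibreCoord.isRep_iff a m).1 ha
  have hb1 := ((FibreCoord.isRep_iff b m).1 hb).1
  obtain ⟨t, h1, h2⟩ := exists_line_eval_ne_zero (a := a) (b := b)
    (F := F * FibreCoord.disc m) (G := G) (by simp [hF, ha2]) hG
  rw [map_mul, mul_ne_zero_iff] at h1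
  exact ⟨_, (FibreCoord.isRep_iff _ m).2
    ⟨Submodule.add_mem _ ha1 (Submodule.smul_mem _ _ (Submodule.sub_mem _ hb1 ha1)), h1.2⟩,
    h1.1, h2⟩

/-- Irreducibility passes from `Z` to its cone because the fibres of the cone are irreducible. -/
theorem isPrime_coneIdeal [Infinite k] {Z : Set M} (hZ : @IsIrreducible M (zariski k M) Z) :
    (coneIdeal k Z).IsPrime := by
  refine ⟨?_, fun {F G} hFG => ?_⟩
  · rw [Ne, Ideal.eq_top_iff_one]
    obtain ⟨m, hm⟩ := hZ.1
    obtain ⟨a, ha⟩ := exists_rep k m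
    intro h
    simpa using mem_coneIdeal.1 h m hm a ha
  · by_contra! hcon
    obtain ⟨m, hm, hF, hG⟩ := hZ.2 _ _ (isOpen_basicOpen F) (isOpen_basicOpen G)
      (notMem_coneIdeal.1 hcon.1) (notMem_coneIdeal.1 hcon.2)
    obtain ⟨a, ha, h1, h2⟩ := exists_isRep_eval_ne_zero hF hG
    have := mem_coneIdeal.1 hFG m hm a ha
    rw [map_mul] at this
    exact mul_ne_zero h1 h2 this

theorem isIrreducible_of_isPrime {Z : Set M} (hZ : Z.Nonempty)
    (h : (coneIdeal k Z).IsPrime) : @IsIrreducible M (zariski k M) Z := by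
  refine ⟨hZ, fun U V hU hV ⟨x, hx, hxU⟩ ⟨y, hy, hyV⟩ => ?_⟩
  obtain ⟨a, ha⟩ := exists_rep k x
  obtain ⟨b, hb⟩ := exists_rep k y
  obtain ⟨F, hF, hF'⟩ := exists_of_isOpen hU hxU ha
  obtain ⟨G, hG, hG'⟩ := exists_of_isOpen hV hyV hb
  have : F * G ∉ coneIdeal k Z := fun hFG => by
    rcases h.mem_or_mem hFG with h | h
    · exact hF (mem_coneIdeal.1 h x hx a ha)
    · exact hG (mem_coneIdeal.1 h y hy b hb)
  obtain ⟨z, hz, c, hc, hc'⟩ := notMem_coneIdeal.1 this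
  rw [map_mul, mul_ne_zero_iff] at hc'
  exact ⟨z, hz, hF' z c hc hc'.1, hG' z c hc hc'.2⟩

theorem isIrreducible_zclosure {Z : Set M} (hZ : @IsIrreducible M (zariski k M) Z) :
    @IsIrreducible M (zariski k M) (zclosure k Z) :=
  @IsIrreducible.closure M (zariski k M) Z hZ

theorem isProjVariety_zclosure {Z : Set M} (hZ : @IsIrreducible M (zariski k M) Z) :
    IsProjVariety k (zclosure k Z) := ⟨isClosed_zclosure Z, isIrreducible_zclosure hZ⟩

/-- A nonempty open part of an irreducible set is dense. -/
theorem subset_zclosure_inter {Z U : Set M} (hZ : @IsIrreducible M (zariski k M) Z)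
    (hU : IsOpen[zariski k M] U) (h : (U ∩ Z).Nonempty) : Z ⊆ zclosure k (U ∩ Z) := by
  let _ := zariski k M
  intro z hz
  rw [zclosure, mem_closure_iff]
  intro o ho hzo
  obtain ⟨y, hyU, hy⟩ := h
  obtain ⟨x, hx, hxo, hxU⟩ := hZ.2 o U ho hU ⟨z, hz, hzo⟩ ⟨y, hy, hyU⟩
  exact ⟨x, hxo, hxU, hx⟩

theorem isOpen_inter {U V : Set M} (hU : IsOpen[zariski k M] U) (hV : IsOpen[zariski k M] V) :
    IsOpen[zariski k M] (U ∩ V) := @IsOpen.inter M (zariski k M) U V hU hV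

end Topology

/-! ### Tangent spaces of affine cones. -/

section Tangent

variable {k : Type*} [Field k] {M : Type*} {ι : Type} [HomogCoord k M ι] [Fintype ι]
  [FibreCoord k M]

/-- A covector that vanishes on the fibre is itself an equation of the point. Conversely an equation
of the point, multiplied by the discriminant, vanishes on the whole linear fibre, in particular on
the lines through `a` in it. -/
theorem coneTangent_singleton [Infinite k] {m : M} {a : ι → k} (ha : IsRep a m) :
    coneTangent {m} a = FibreCoord.fibre m := by
  obtain ⟨ha1, ha2⟩ := (FibreCoord.isRep_iff a m).1 ha
  refine le_antisymm (fun v hv => ?_) fun v hv => mem_coneTangent.2 fun F hF => ?_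
  · by_contra hcon
    obtain ⟨f, hf, hf'⟩ := Submodule.exists_le_ker_of_notMem hcon
    let g : (ι → k) →ₗ[k] (Unit → k) := LinearMap.pi fun _ => f
    have := mem_coneTangent.1 hv (linPoly g ()) (mem_coneIdeal.2 fun m' hm' b hb => by
      rw [Set.mem_singleton_iff.1 hm'] at hb
      rw [eval_linPoly]
      exact hf' ((FibreCoord.isRep_iff b m).1 hb).1)
    rw [polyDiff_linPoly] at this
    exact hf this
  · have h := polyDiff_eq_zero_of_line (F := F * FibreCoord.disc m) (a := a) (v := v) fun t => by
      by_cases h : eval (a + t • v) (FibreCoord.disc (k := k) m) = 0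
      · simp [h]
      · rw [map_mul, mem_coneIdeal.1 hF m rfl _ ((FibreCoord.isRep_iff _ m).2
          ⟨Submodule.add_mem _ ha1 (Submodule.smul_mem _ t hv), h⟩), zero_mul]
    rw [polyDiff_mul, mem_coneIdeal.1 hF m rfl a ha, zero_mul, zero_add] at h
    exact (mul_eq_zero.1 h).resolve_left ha2

theorem fibre_le_coneTangent [Infinite k] {Z : Set M} {m : M} (hm : m ∈ Z) {a : ι → k}
    (ha : IsRep a m) : FibreCoord.fibre m ≤ coneTangent Z a := by
  rw [← coneTangent_singleton ha]
  exact coneTangent_anti (Set.singleton_subset_iff.2 hm) a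

theorem isRep_mem_fibre {m : M} {a : ι → k} (ha : IsRep a m) : a ∈ FibreCoord.fibre (k := k) m :=
  ((FibreCoord.isRep_iff a m).1 ha).1

theorem mem_coneTangent_self [Infinite k] {Z : Set M} {m : M} (hm : m ∈ Z) {a : ι → k}
    (ha : IsRep a m) : a ∈ coneTangent Z a :=
  fibre_le_coneTangent hm ha (isRep_mem_fibre ha)

theorem map_mem_coneTangent (Z : Set M) {g : (ι → k) →ₗ[k] (ι → k)}
    (hg : ∀ (m : M) (c : ι → k), IsRep c m → IsRep (g c) m) {a v : ι → k}
    (hv : v ∈ coneTangent Z a) : g v ∈ coneTangent Z (g a) :=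
  mem_coneTangent.2 fun F hF => by
    rw [← polyDiff_bind₁_linPoly]
    exact mem_coneTangent.1 hv _ (mem_coneIdeal.2 fun m hm c hc => by
      rw [eval_bind₁_linPoly]
      exact mem_coneIdeal.1 hF m hm _ (hg m c hc))

theorem finrank_coneTangent_eq (Z : Set M) {m : M} {a b : ι → k} (ha : IsRep a m)
    (hb : IsRep b m) :
    Module.finrank k (coneTangent Z a) = Module.finrank k (coneTangent Z b) := by
  have key : ∀ {a b : ι → k}, IsRep a m → IsRep b m →
      Module.finrank k (coneTangent Z a) ≤ Module.finrank k (coneTangent Z b) := by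
    intro a b ha hb
    obtain ⟨g, rfl, hg⟩ := FibreCoord.exists_trans ha hb
    rw [← LinearEquiv.finrank_map_eq g]
    refine Submodule.finrank_mono (Submodule.map_le_iff_le_comap.2 fun v hv => ?_)
    exact map_mem_coneTangent Z (g := g.toLinearMap) hg hv
  exact le_antisymm (key ha hb) (key hb ha)

/-- If `F` vanishes on a neighbourhood of a point of `Z`, then its differential vanishes on the
tangent space there. -/
theorem polyDiff_eq_zero_of_local {Z : Set M} {m : M} (hm : m ∈ Z) {a v : ι → k} (ha : IsRep a m)
    (hv : v ∈ coneTangent Z a) {F D : MvPolynomial ι k} (hD : eval a D ≠ 0)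
    (hF : ∀ z ∈ Z, ∀ b : ι → k, IsRep b z → eval b D ≠ 0 → eval b F = 0) : polyDiff F a v = 0 := by
  have h := mem_coneTangent.1 hv (D * F) (mem_coneIdeal.2 fun z hz b hb => by
    rw [map_mul]
    by_cases h : eval b D = 0
    · rw [h, zero_mul]
    · rw [hF z hz b hb h, mul_zero])
  rw [polyDiff_mul, hF m hm a ha hD, zero_mul, add_zero] at h
  exact (mul_eq_zero.1 h).resolve_left hD

/-- The equations of the tangent spaces of the cone over `Z`. -/
def tangentEqs (Z : Set M) : Set (ι → MvPolynomial ι k) :=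
  {E | ∃ F ∈ coneIdeal k Z, E = fun i => pderiv i F}

theorem coneTangent_eq_kerAt (Z : Set M) (a : ι → k) :
    coneTangent Z a = kerAt (eval a) (tangentEqs (k := k) Z) := by
  ext v
  rw [mem_coneTangent, mem_kerAt]
  constructor
  · rintro h _ ⟨F, hF, rfl⟩
    rw [← polyDiff_apply]
    exact h F hF
  · intro h F hF
    rw [polyDiff_apply]
    exact h _ ⟨F, hF, rfl⟩

end Tangent

/-! ### Local frames with polynomial coefficients, and semicontinuity. -/

section Frame

variable {k : Type*} [Field k] {ι q : Type} [Fintype q]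

theorem exists_frame_eval (𝓔 : Set (q → MvPolynomial ι k)) (a : ι → k) {s : ℕ}
    (hs : Module.finrank k (kerAt (eval a) 𝓔) = s) :
    ∃ (Q : Fin s → q → MvPolynomial ι k) (D : MvPolynomial ι k), eval a D ≠ 0 ∧
      ∀ b : ι → k, eval b D ≠ 0 →
        LinearIndependent k (fun j i => eval b (Q j i)) ∧
        kerAt (eval b) 𝓔 ≤ Submodule.span k (Set.range fun j i => eval b (Q j i)) ∧
        (Module.finrank k (kerAt (eval b) 𝓔) = s →
          Submodule.span k (Set.range fun j i => eval b (Q j i)) = kerAt (eval b) 𝓔) := by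
  subst hs
  obtain ⟨Q, D, hD, -, h⟩ := exists_frame (eval a) 𝓔
  refine ⟨Q, D, hD, fun b hb => ?_⟩
  obtain ⟨h1, h2⟩ := h (eval b) hb
  refine ⟨h1, h2, fun h3 => (Submodule.eq_of_le_of_finrank_eq h2 ?_).symm⟩
  rw [h3, finrank_span_eq_card h1, Fintype.card_fin]

theorem exists_finrank_kerAt_le (𝓔 : Set (q → MvPolynomial ι k)) (a : ι → k) :
    ∃ D : MvPolynomial ι k, eval a D ≠ 0 ∧ ∀ b : ι → k, eval b D ≠ 0 →
      Module.finrank k (kerAt (eval b) 𝓔) ≤ Module.finrank k (kerAt (eval a) 𝓔) := by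
  obtain ⟨Q, D, hD, h⟩ := exists_frame_eval 𝓔 a rfl
  refine ⟨D, hD, fun b hb => ?_⟩
  obtain ⟨h1, h2, -⟩ := h b hb
  refine (Submodule.finrank_mono h2).trans ?_
  rw [finrank_span_eq_card h1, Fintype.card_fin]

end Frame

/-! ### Krull dimension, transcendence degree and derivations -/

section Krull

/-- Incomparability sends chains of primes of `S` to strict chains of `R`; going up lifts chains of
`R`, starting from a prime over the first member. -/
theorem ringKrullDim_eq_of_integral_of_injective {R S : Type*} [CommRing R] [CommRing S]
    [IsDomain R] [IsDomain S] [Algebra R S] [Algebra.IsIntegral R S]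
    (hinj : Function.Injective (algebraMap R S)) : ringKrullDim S = ringKrullDim R := by
  apply le_antisymm
  · refine Order.krullDim_le_of_strictMono (PrimeSpectrum.comap (algebraMap R S)) fun p q hpq => ?_
    exact Ideal.IsIntegral.comap_lt_comap (R := R) (I := p.asIdeal) (J := q.asIdeal) hpq
  · refine iSup_le fun l => ?_
    have : (⊥ : Ideal S).LiesOver (⊥ : Ideal R) := ⟨by
      rw [Ideal.under_def, ← RingHom.ker_eq_comap_bot, (RingHom.injective_iff_ker_eq_bot _).1 hinj]⟩
    obtain ⟨Q, -, hQ, hQ'⟩ := Ideal.exists_ideal_ge_liesOver_of_le (p := (⊥ : Ideal R))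
      (q := l.head.asIdeal) (⊥ : Ideal S) bot_le
    obtain ⟨L, hL, -⟩ := Ideal.exists_ltSeries_of_hasGoingUp l Q
    rw [← hL]
    exact Order.LTSeries.length_le_krullDim L

/-- By Noether normalization both numbers are the number of variables of the polynomial subring. -/
theorem exists_ringKrullDim_eq_trdeg (k A : Type*) [Field k] [CommRing A] [IsDomain A]
    [Algebra k A] [Algebra.FiniteType k A] :
    ∃ s : ℕ, ringKrullDim A = s ∧ Algebra.trdeg k (FractionRing A) = s := by
  obtain ⟨s, g, hg, hgi⟩ := exists_integral_inj_algHom_of_fg k A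
  algebraize [g.toRingHom]
  have hint : Algebra.IsIntegral (MvPolynomial (Fin s) k) A := ⟨hgi⟩
  refine ⟨s, ?_, ?_⟩
  · rw [ringKrullDim_eq_of_integral_of_injective (R := MvPolynomial (Fin s) k) hg,
      MvPolynomial.ringKrullDim_of_isNoetherianRing, ringKrullDim_eq_zero_of_field]
    simp
  · have : FaithfulSMul (MvPolynomial (Fin s) k) A := (faithfulSMul_iff_algebraMap_injective _ _).2 hg
    have : Algebra.IsAlgebraic A (FractionRing A) := IsLocalization.isAlgebraic _ (nonZeroDivisors A)
    have h1 : IsTranscendenceBasis k (algebraMap (MvPolynomial (Fin s) k) A ∘ X) :=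
      (IsTranscendenceBasis.mvPolynomial (Fin s) k).algebraMap_comp
    have h2 := h1.algebraMap_comp (A := FractionRing A)
    simpa using h2.lift_cardinalMk_eq_trdeg.symm

theorem ringKrullDim_quotient_lt {R : Type*} [CommRing R] {I J : Ideal R} [I.IsPrime]
    (h : I < J) : ringKrullDim (R ⧸ J) + 1 ≤ ringKrullDim (R ⧸ I) := by
  obtain ⟨hle, x, hxJ, hxI⟩ := SetLike.lt_iff_le_and_exists.1 h
  refine ringKrullDim_succ_le_of_surjective (Ideal.Quotient.factor hle)
    (Ideal.Quotient.factor_surjective hle) (r := Ideal.Quotient.mk I x) ?_ ?_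
  · rw [mem_nonZeroDivisors_iff_ne_zero, Ne, Ideal.Quotient.eq_zero_iff_mem]
    exact hxI
  · rw [Ideal.Quotient.factor_mk, Ideal.Quotient.eq_zero_iff_mem]
    exact hxJ

end Krull

/-! ### Derivations of a function field and the gradient equations. -/

section Derivation

open scoped TensorProduct IntermediateField.algebraAdjoinAdjoin

/-- The map factors into an isomorphism onto the subalgebra generated by `x`, the localization to
its fraction field, and a separable extension; each is formally étale. -/
theorem formallyEtale_mvPolynomial_of_isSeparable {k K σ : Type*} [Field k] [Field K] [Algebra k K]
    {x : σ → K} (hx : AlgebraicIndependent k x)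
    [Algebra.IsSeparable (IntermediateField.adjoin k (Set.range x)) K]
    : (aeval x : MvPolynomial σ k →ₐ[k] K).toRingHom.FormallyEtale := by
  have h1 : (algebraMap (Algebra.adjoin k (Set.range x))
      (IntermediateField.adjoin k (Set.range x))).FormallyEtale := by
    rw [RingHom.formallyEtale_algebraMap]
    exact Algebra.FormallyEtale.of_isLocalization (nonZeroDivisors _)
  have h2 : (algebraMap (IntermediateField.adjoin k (Set.range x)) K).FormallyEtale := by
    rw [RingHom.formallyEtale_algebraMap]
    exact Algebra.FormallyEtale.of_isSeparable _ K
  have h3 : hx.aevalEquiv.toRingEquiv.toRingHom.FormallyEtale := by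
    let _ := hx.aevalEquiv.toRingEquiv.toRingHom.toAlgebra
    exact Algebra.FormallyEtale.of_equiv (AlgEquiv.ofBijective
      (Algebra.ofId (MvPolynomial σ k) (Algebra.adjoin k (Set.range x))) hx.aevalEquiv.bijective)
  have := (h3.comp h1).comp h2
  convert this using 1
  ext
  · simp
  · simp

/-- A perfect field admits a separating transcendence basis, and along the resulting formally étale
map the differentials are the base change of those of a polynomial ring. This is where arbitrary
characteristic is dealt with. -/
theorem finrank_kaehlerDifferential (k K : Type*) [Field k] [PerfectField k] [Field K] [Algebra k K]
    [Algebra.EssFiniteType k K] : (Module.finrank K Ω[K⁄k] : Cardinal) = Algebra.trdeg k K := by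
  obtain ⟨s, hs, hsep⟩ := exists_isTranscendenceBasis_and_isSeparable_of_perfectField k K
  have : Algebra.IsSeparable (IntermediateField.adjoin k (Set.range ((↑) : s → K))) K := by
    convert hsep <;> simp
  have hE := formallyEtale_mvPolynomial_of_isSeparable hs.1
  let _ : Algebra (MvPolynomial s k) K := (aeval ((↑) : s → K) : _ →ₐ[k] K).toAlgebra
  have : IsScalarTower k (MvPolynomial s k) K := IsScalarTower.of_algHom _
  have : Algebra.FormallyEtale (MvPolynomial s k) K := hE
  rw [← (KaehlerDifferential.tensorKaehlerEquivOfFormallyEtale k (MvPolynomial s k) K).finrank_eq,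
    Module.finrank_baseChange,
    Module.finrank_eq_card_basis (KaehlerDifferential.mvPolynomialBasis k s)]
  simpa using hs.lift_cardinalMk_eq_trdeg

variable {k : Type*} [Field k] {ι : Type} [Fintype ι]

/-- The gradients of the elements of an ideal. -/
def gradEqs (I : Ideal (MvPolynomial ι k)) : Set (ι → MvPolynomial ι k) :=
  {E | ∃ F ∈ I, E = fun i => pderiv i F}

theorem derivation_apply_eq_sum {K : Type*} [Field K] [Algebra k K] [Algebra (MvPolynomial ι k) K]
    [IsScalarTower k (MvPolynomial ι k) K] (d : Derivation k (MvPolynomial ι k) K)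
    (F : MvPolynomial ι k) : d F = ∑ i, algebraMap _ K (pderiv i F) * d (X i) := by
  classical
  induction F using MvPolynomial.induction_on with
  | C c =>
    have : d (C c) = 0 := d.map_algebraMap c
    simp [this]
  | add F G hF hG => simp [hF, hG, add_mul, Finset.sum_add_distrib]
  | mul_X F j hF =>
    simp only [Derivation.leibniz, pderiv_X, smul_eq_mul, map_add, map_mul, add_mul,
      Finset.sum_add_distrib, hF, Algebra.smul_def, Finset.mul_sum, mul_assoc]
    congr 1
    simp [Pi.single_apply, apply_ite]

variable (I : Ideal (MvPolynomial ι k)) [I.IsPrime] (K : Type*) [Field K] [Algebra k K]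
  [Algebra (MvPolynomial ι k) K] [IsScalarTower k (MvPolynomial ι k) K]
  [Algebra (MvPolynomial ι k ⧸ I) K] [IsScalarTower k (MvPolynomial ι k ⧸ I) K]
  [IsScalarTower (MvPolynomial ι k) (MvPolynomial ι k ⧸ I) K]
  [IsFractionRing (MvPolynomial ι k ⧸ I) K]

theorem algebraMap_eq_zero_iff_mem (F : MvPolynomial ι k) :
    algebraMap (MvPolynomial ι k) K F = 0 ↔ F ∈ I := by
  rw [IsScalarTower.algebraMap_apply _ (MvPolynomial ι k ⧸ I) K,
    FaithfulSMul.algebraMap_eq_zero_iff, Ideal.Quotient.algebraMap_eq,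
    Ideal.Quotient.eq_zero_iff_mem]

/-- The vector of the values of a derivation at the coordinate functions. -/
def derivationToKer : Derivation k K K →ₗ[K] kerAt (algebraMap (MvPolynomial ι k) K) (gradEqs I) where
  toFun D := ⟨fun i => D (algebraMap (MvPolynomial ι k) K (X i)), by
    rintro _ ⟨F, hF, rfl⟩
    have := derivation_apply_eq_sum (D.compAlgebraMap (MvPolynomial ι k)) F
    have h0 : D.compAlgebraMap (MvPolynomial ι k) F = 0 := by
      change D (algebraMap _ K F) = 0
      rw [(algebraMap_eq_zero_iff_mem I K F).2 hF, map_zero]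
    rw [h0] at this
    exact this.symm⟩
  map_add' _ _ := rfl
  map_smul' _ _ := rfl

/-- A derivation of the polynomial ring that kills an ideal descends to the quotient. -/
def quotientDerivation (d : Derivation k (MvPolynomial ι k) K) (hd : ∀ F ∈ I, d F = 0) :
    Derivation k (MvPolynomial ι k ⧸ I) K :=
  have key : ∀ {F G : MvPolynomial ι k}, Ideal.Quotient.mk I F = Ideal.Quotient.mk I G →
      d F = d G := fun {F G} h => by
    rw [← sub_eq_zero, ← map_sub]
    exact hd _ (Ideal.Quotient.eq.1 h)
  have out : ∀ x : MvPolynomial ι k ⧸ I, Ideal.Quotient.mk I (Quotient.out x) = x :=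
    fun x => Quotient.out_eq x
  Derivation.mk'
    { toFun := fun x => d (Quotient.out x)
      map_add' := fun x y => by
        rw [← map_add]
        exact key (by rw [out, map_add, out, out])
      map_smul' := fun c x => by
        rw [RingHom.id_apply, ← Derivation.map_smul]
        refine key ?_
        rw [out, ← Ideal.Quotient.mkₐ_eq_mk k, map_smul, Ideal.Quotient.mkₐ_eq_mk k, out] }
    fun x y => by
      have h : d (Quotient.out (x * y)) = d (Quotient.out x * Quotient.out y) :=
        key (by rw [out, map_mul, out, out])
      have h2 : ∀ (z : MvPolynomial ι k ⧸ I) (w : K), (Quotient.out z : MvPolynomial ι k) • w = z • w :=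
        fun z w => by
          rw [← IsScalarTower.algebraMap_smul (MvPolynomial ι k ⧸ I) (Quotient.out z) w]
          congr 1
          exact out z
      change d (Quotient.out (x * y)) = _
      rw [h, Derivation.leibniz, h2, h2]
      rfl

theorem quotientDerivation_mk (d : Derivation k (MvPolynomial ι k) K) (hd : ∀ F ∈ I, d F = 0)
    (F : MvPolynomial ι k) : quotientDerivation I K d hd (Ideal.Quotient.mk I F) = d F := by
  change d (Quotient.out (Ideal.Quotient.mk I F)) = d F
  rw [← sub_eq_zero, ← map_sub]
  exact hd _ (Ideal.Quotient.eq.1 (Quotient.out_eq (Ideal.Quotient.mk I F)))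

/-- A derivation that kills the coordinate functions kills the coordinate ring, hence all fractions.
Conversely a solution of the gradient equations gives a derivation of the polynomial ring that kills
`I`; it descends to the quotient and extends to `K`, localization being formally étale. -/
theorem derivationToKer_bijective : Function.Bijective (derivationToKer I K) := by
  constructor
  · rw [← LinearMap.ker_eq_bot, LinearMap.ker_eq_bot']
    intro D hD
    have hR : ∀ F : MvPolynomial ι k, D (algebraMap _ K F) = 0 := fun F => by
      have h := derivation_apply_eq_sum (D.compAlgebraMap (MvPolynomial ι k)) F
      refine h.trans (Finset.sum_eq_zero fun i _ => ?_)
      have : D (algebraMap _ K (X i)) = 0 := congrFun (congrArg Subtype.val hD) i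
      change _ * D (algebraMap _ K (X i)) = 0
      rw [this, mul_zero]
    have hA : ∀ x : MvPolynomial ι k ⧸ I, D (algebraMap _ K x) = 0 := fun x => by
      obtain ⟨F, rfl⟩ := Ideal.Quotient.mk_surjective x
      have := hR F
      rwa [IsScalarTower.algebraMap_apply (MvPolynomial ι k) (MvPolynomial ι k ⧸ I) K] at this
    ext x
    obtain ⟨a, b, hb, rfl⟩ := IsFractionRing.div_surjective (A := MvPolynomial ι k ⧸ I) x
    have hb0 : algebraMap (MvPolynomial ι k ⧸ I) K b ≠ 0 :=
      IsFractionRing.to_map_ne_zero_of_mem_nonZeroDivisors hb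
    have := hA a
    rw [← div_mul_cancel₀ (algebraMap (MvPolynomial ι k ⧸ I) K a) hb0, Derivation.leibniz, hA,
      smul_zero, zero_add, smul_eq_mul] at this
    exact (mul_eq_zero.1 this).resolve_left hb0
  · rintro ⟨v, hv⟩
    let d : Derivation k (MvPolynomial ι k) K := mkDerivation k v
    have hd : ∀ F ∈ I, d F = 0 := fun F hF => by
      rw [derivation_apply_eq_sum]
      simpa [d] using hv _ ⟨F, hF, rfl⟩
    have : Algebra.FormallyEtale (MvPolynomial ι k ⧸ I) K :=
      Algebra.FormallyEtale.of_isLocalization (nonZeroDivisors (MvPolynomial ι k ⧸ I))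
    let e := KaehlerDifferential.tensorKaehlerEquivOfFormallyEtale k (MvPolynomial ι k ⧸ I) K
    let f : Ω[K⁄k] →ₗ[K] K :=
      (quotientDerivation I K d hd).liftKaehlerDifferential.liftBaseChange K ∘ₗ e.symm.toLinearMap
    refine ⟨f.compDer (KaehlerDifferential.D k K), ?_⟩
    ext i
    change f (KaehlerDifferential.D k K (algebraMap _ K (X i))) = v i
    rw [IsScalarTower.algebraMap_apply _ (MvPolynomial ι k ⧸ I) K]
    simp only [f, e, LinearMap.comp_apply, LinearEquiv.coe_coe,
      KaehlerDifferential.tensorKaehlerEquivOfFormallyEtale_symm_D_algebraMap]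
    rw [LinearMap.liftBaseChange_tmul, Derivation.liftKaehlerDifferential_comp_D, one_smul]
    exact (quotientDerivation_mk I K d hd (X i)).trans (mkDerivation_X k v i)

theorem finrank_kerAt_gradEqs [PerfectField k] :
    (Module.finrank K (kerAt (algebraMap (MvPolynomial ι k) K) (gradEqs I)) : Cardinal) =
      Algebra.trdeg k K := by
  have : Algebra.EssFiniteType k K := by
    have := Algebra.EssFiniteType.of_isLocalization K (nonZeroDivisors (MvPolynomial ι k ⧸ I))
    exact Algebra.EssFiniteType.comp k (MvPolynomial ι k ⧸ I) K
  rw [← finrank_kaehlerDifferential k K,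
    ← (LinearEquiv.ofBijective _ (derivationToKer_bijective I K)).finrank_eq,
    ← (KaehlerDifferential.linearMapEquivDerivation k K (M := K)).finrank_eq,
    Subspace.dual_finrank_eq]

end Derivation

/-! ### The dimension of the tangent spaces at the points of an affine variety -/

section TangentDim

variable {k : Type*} [Field k] [IsAlgClosed k] {ι : Type} [Fintype ι]

/-- Closed points are compared with the generic point, where the solution space has dimension the
transcendence degree. A frame near a closed point also bounds the generic solution space, whence the
lower bound everywhere; a frame near the generic point gives equality on a dense open set. -/
theorem exists_finrank_kerAt_gradEqs (I : Ideal (MvPolynomial ι k)) [I.IsPrime] :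
    ∃ s : ℕ, ringKrullDim (MvPolynomial ι k ⧸ I) = s ∧
      (∀ a : ι → k, (∀ F ∈ I, eval a F = 0) →
        s ≤ Module.finrank k (kerAt (eval a) (gradEqs I))) ∧
      ∃ D : MvPolynomial ι k, D ∉ I ∧ ∀ a : ι → k, (∀ F ∈ I, eval a F = 0) → eval a D ≠ 0 →
        Module.finrank k (kerAt (eval a) (gradEqs I)) = s := by
  obtain ⟨s, hs, hs'⟩ := exists_ringKrullDim_eq_trdeg k (MvPolynomial ι k ⧸ I)
  have hK : Module.finrank (FractionRing (MvPolynomial ι k ⧸ I))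
      (kerAt (algebraMap (MvPolynomial ι k) (FractionRing (MvPolynomial ι k ⧸ I))) (gradEqs I)) =
      s := by
    have := finrank_kerAt_gradEqs I (FractionRing (MvPolynomial ι k ⧸ I))
    rw [hs'] at this
    exact_mod_cast this
  refine ⟨s, hs, fun a ha => ?_, ?_⟩
  · obtain ⟨Q, D, hD, -, h⟩ := exists_frame (eval a) (gradEqs I)
    have hDI : D ∉ I := fun h => hD (ha D h)
    obtain ⟨h1, h2⟩ := h (algebraMap (MvPolynomial ι k) (FractionRing (MvPolynomial ι k ⧸ I)))
      fun h => hDI ((algebraMap_eq_zero_iff_mem I _ D).1 h)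
    rw [← hK]
    refine (Submodule.finrank_mono h2).trans ?_
    rw [finrank_span_eq_card h1, Fintype.card_fin]
  · obtain ⟨Q, D, hD, hQ, h⟩ := exists_frame
      (algebraMap (MvPolynomial ι k) (FractionRing (MvPolynomial ι k ⧸ I))) (gradEqs I)
    refine ⟨D, fun h => hD ((algebraMap_eq_zero_iff_mem I _ D).2 h), fun a ha hDa => ?_⟩
    obtain ⟨h1, h2⟩ := h (eval a) hDa
    have h3 : kerAt (eval a) (gradEqs I) =
        Submodule.span k (Set.range fun j i => eval a (Q j i)) := by
      refine le_antisymm h2 (Submodule.span_le.2 ?_)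
      rintro _ ⟨j, rfl⟩ E hE
      -- The equation holds in the function field, so it belongs to `I` and holds at every zero of
      -- `I`.
      have := hQ j E hE
      simp_rw [← map_mul] at this
      rw [← map_sum, algebraMap_eq_zero_iff_mem I] at this
      simpa using ha _ this
    rw [h3, finrank_span_eq_card h1, Fintype.card_fin, hK]

end TangentDim

/-! ### The dimension of the affine cone. -/

section ConeDim

variable (k : Type*) [Field k] {M : Type*} {ι : Type} [HomogCoord k M ι] [Fintype ι]

/-- The dimension of the affine cone over `Z`, as the least dimension of its tangent spaces. -/
def coneDim (Z : Set M) : ℕ :=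
  sInf {r | ∃ a ∈ cone k Z, Module.finrank k (coneTangent Z a) = r}

variable {k}

theorem coneDim_le {Z : Set M} {m : M} (hm : m ∈ Z) {a : ι → k} (ha : IsRep a m) :
    coneDim k Z ≤ Module.finrank k (coneTangent Z a) := Nat.sInf_le ⟨a, ⟨m, hm, ha⟩, rfl⟩

variable [FibreCoord k M]

theorem exists_finrank_eq_coneDim {Z : Set M} (hZ : Z.Nonempty) :
    ∃ m ∈ Z, ∃ a : ι → k, IsRep a m ∧ Module.finrank k (coneTangent Z a) = coneDim k Z := by
  obtain ⟨m, hm⟩ := hZ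
  obtain ⟨a, ha⟩ := exists_rep k m
  obtain ⟨b, ⟨m', hm', hb⟩, h⟩ := Nat.sInf_mem (s := {r | ∃ a ∈ cone k Z,
    Module.finrank k (coneTangent Z a) = r}) ⟨_, a, ⟨m, hm, ha⟩, rfl⟩
  exact ⟨m', hm', b, hb, h⟩

theorem isOpen_finrank_coneTangent_le (Z : Set M) (r : ℕ) : IsOpen[zariski k M]
    {m | ∀ a : ι → k, IsRep a m → Module.finrank k (coneTangent Z a) ≤ r} := by
  refine isOpen_of_forall k fun m hm => ?_
  obtain ⟨a, ha⟩ := exists_rep k m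
  obtain ⟨D, hD, hD'⟩ := exists_finrank_kerAt_le (tangentEqs (k := k) Z) a
  refine ⟨a, ha, D, hD, fun m' a' ha' h' b hb => ?_⟩
  rw [finrank_coneTangent_eq Z hb ha', coneTangent_eq_kerAt]
  refine (hD' a' h').trans ?_
  rw [← coneTangent_eq_kerAt]
  exact hm a ha

theorem exists_isOpen_finrank_eq_coneDim {Z : Set M} (hZ : Z.Nonempty) :
    IsOpen[zariski k M]
      {m | ∀ a : ι → k, IsRep a m → Module.finrank k (coneTangent Z a) ≤ coneDim k Z} ∧
    ({m | ∀ a : ι → k, IsRep a m → Module.finrank k (coneTangent Z a) ≤ coneDim k Z} ∩ Z).Nonempty ∧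
    ∀ m ∈ {m | ∀ a : ι → k, IsRep a m → Module.finrank k (coneTangent Z a) ≤ coneDim k Z} ∩ Z,
      ∀ a : ι → k, IsRep a m → Module.finrank k (coneTangent Z a) = coneDim k Z := by
  refine ⟨isOpen_finrank_coneTangent_le Z _, ?_, fun m hm a ha =>
    le_antisymm (hm.1 a ha) (coneDim_le hm.2 ha)⟩
  obtain ⟨m, hm, a, ha, h⟩ := exists_finrank_eq_coneDim (k := k) hZ
  exact ⟨m, fun b hb => (finrank_coneTangent_eq Z hb ha).trans h |>.le, hm⟩

theorem fdim_le_coneDim [Infinite k] {Z : Set M} (hZ : Z.Nonempty) :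
    FibreCoord.fdim k M ι ≤ coneDim k Z := by
  obtain ⟨m, hm, a, ha, h⟩ := exists_finrank_eq_coneDim (k := k) hZ
  rw [← h, ← FibreCoord.finrank_fibre m]
  exact Submodule.finrank_mono (fibre_le_coneTangent hm ha)

/-- The Krull dimension bounds all tangent dimensions from below and is attained at a general point
of the cone, so it is their minimum. -/
theorem ringKrullDim_eq_coneDim [IsAlgClosed k] {Z : Set M} (hZ : @IsIrreducible M (zariski k M) Z) :
    ringKrullDim (MvPolynomial ι k ⧸ coneIdeal k Z) = coneDim k Z := by
  have : Infinite k := IsAlgClosed.instInfinite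
  have := isPrime_coneIdeal hZ
  obtain ⟨s, hs, hle, D, hD, hD'⟩ := exists_finrank_kerAt_gradEqs (coneIdeal k Z)
  rw [hs]
  norm_cast
  obtain ⟨m, hm, a, ha, h⟩ := notMem_coneIdeal.1 hD
  apply le_antisymm
  · obtain ⟨m, hm, a, ha, h⟩ := exists_finrank_eq_coneDim (k := k) hZ.1
    rw [← h, coneTangent_eq_kerAt]
    exact hle a fun F hF => mem_coneIdeal.1 hF m hm a ha
  · refine (coneDim_le hm ha).trans ?_
    rw [coneTangent_eq_kerAt]
    exact (hD' a (fun F hF => mem_coneIdeal.1 hF m hm a ha) h).le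

/-- Strictly smaller closed sets have strictly larger prime cone ideals, and the Krull dimension of
the quotient drops. Only the smaller set has to be closed. -/
theorem coneDim_lt [IsAlgClosed k] {Z W : Set M} (hZ : @IsIrreducible M (zariski k M) Z)
    (hW : @IsIrreducible M (zariski k M) W) (hZc : IsClosed[zariski k M] Z) (h : Z ⊂ W) :
    coneDim k Z < coneDim k W := by
  have : Infinite k := IsAlgClosed.instInfinite
  have := isPrime_coneIdeal hW
  have hlt : coneIdeal k W < coneIdeal k Z := by
    refine lt_of_le_of_ne (coneIdeal_anti h.1) fun heq => h.2 fun m hm => ?_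
    obtain ⟨a, ha⟩ := exists_rep k m
    exact mem_of_coneIdeal hZc ha fun F hF => mem_coneIdeal.1 (heq ▸ hF) m hm a ha
  have := ringKrullDim_quotient_lt hlt
  rw [ringKrullDim_eq_coneDim hZ, ringKrullDim_eq_coneDim hW] at this
  exact_mod_cast this

end ConeDim

/-! ### Affine charts and the dimension of projective varieties -/

section Topology

theorem isIrreducible_preimage_val {T : Type*} [TopologicalSpace T] {Z W : Set T} (hWZ : W ⊆ Z)
    (hW : IsIrreducible W) : IsIrreducible ((↑) ⁻¹' W : Set Z) := by
  refine ⟨?_, ?_⟩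
  · obtain ⟨w, hw⟩ := hW.1
    exact ⟨⟨w, hWZ hw⟩, hw⟩
  · rintro u v ⟨U, hU, rfl⟩ ⟨V, hV, rfl⟩ ⟨x, hx, hxU⟩ ⟨y, hy, hyV⟩
    obtain ⟨z, hz, hzU, hzV⟩ := hW.2 U V hU hV ⟨x, hx, hxU⟩ ⟨y, hy, hyV⟩
    exact ⟨⟨z, hWZ hz⟩, hz, hzU, hzV⟩

/-- A strictly monotone function with values between `e` and `t` bounds the length of chains. It
will be applied to `coneDim`, which is at least the dimension of the fibres of the cone. -/
theorem topologicalKrullDim_le_of_nat {T : Type*} [TopologicalSpace T] {Z : Set T}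
    (hZc : IsClosed Z) (f : Set T → ℕ) (e t : ℕ) (he : ∀ W, W ⊆ Z → IsIrreducible W → e ≤ f W)
    (ht : ∀ W, W ⊆ Z → IsIrreducible W → IsClosed W → f W ≤ t)
    (hf : ∀ W W', W' ⊆ Z → IsIrreducible W → IsIrreducible W' → IsClosed W → W ⊂ W' → f W < f W') :
    topologicalKrullDim Z ≤ ((t - e : ℕ) : WithBot ℕ∞) := by
  have hirr : ∀ C : TopologicalSpace.IrreducibleCloseds Z,
      IsIrreducible ((↑) '' (C : Set Z) : Set T) := fun C =>
    C.2.image _ continuous_subtype_val.continuousOn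
  have hcl : ∀ C : TopologicalSpace.IrreducibleCloseds Z, IsClosed ((↑) '' (C : Set Z) : Set T) :=
    fun C => hZc.isClosedEmbedding_subtypeVal.isClosedMap _ C.3
  have hsub : ∀ C : TopologicalSpace.IrreducibleCloseds Z, ((↑) '' (C : Set Z) : Set T) ⊆ Z :=
    fun C => Subtype.coe_image_subset Z _
  refine iSup_le fun p => ?_
  have hmono : StrictMono fun C : TopologicalSpace.IrreducibleCloseds Z =>
      f ((↑) '' (C : Set Z)) := fun C C' h => by
    refine hf _ _ (hsub C') (hirr C) (hirr C') (hcl C) ?_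
    exact ⟨Set.image_mono h.1, fun h' =>
      h.2 ((Set.image_subset_image_iff Subtype.val_injective).1 h')⟩
  have h := (p.map _ hmono).head_add_length_le_nat
  rw [LTSeries.head_map, LTSeries.last_map, LTSeries.map_length] at h
  have h1 := he _ (hsub p.head) (hirr p.head)
  have h2 := ht _ (hsub p.last) (hirr p.last) (hcl p.last)
  exact_mod_cast (by omega : p.length ≤ t - e)

end Topology

/-- An affine chart: a closed affine space of systems of coordinates that contains at most one
system of coordinates of each point. -/
structure Chart (k : Type*) [Field k] (M : Type*) {ι : Type} [HomogCoord k M ι]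
    [FibreCoord k M] where
  carrier : Set (ι → k)
  direction : Submodule k (ι → k)
  exists_isRep : ∀ a ∈ carrier, ∃ m : M, IsRep a m
  unique : ∀ {m : M} {a b : ι → k}, a ∈ carrier → b ∈ carrier → IsRep a m → IsRep b m → a = b
  exists_eqs : ∃ S : Set (MvPolynomial ι k), ∀ a, a ∈ carrier ↔ ∀ F ∈ S, eval a F = 0
  add_mem : ∀ {a v : ι → k}, a ∈ carrier → v ∈ direction → a + v ∈ carrier
  sup_eq_top : ∀ {a : ι → k} {m : M}, a ∈ carrier → IsRep a m →
    direction ⊔ FibreCoord.fibre m = ⊤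
  exists_lift : ∀ F : MvPolynomial ι k, ∃ G : MvPolynomial ι k, (∀ a ∈ carrier, eval a G = eval a F) ∧
    ∀ (m : M) (a : ι → k), IsRep a m → eval a G ≠ 0 → ∃ b ∈ carrier, IsRep b m ∧ eval b F ≠ 0

/-- Spaces that are covered by affine charts. -/
class Charted (k : Type*) [Field k] (M : Type*) {ι : Type} [HomogCoord k M ι]
    [FibreCoord k M] : Prop where
  exists_chart : ∀ m : M, ∃ c : Chart k M, ∃ a ∈ c.carrier, IsRep a m

/-! ### Dimension through affine charts. -/

section Chart

variable {k : Type*} [Field k] [IsAlgClosed k] {M : Type*} {ι : Type} [HomogCoord k M ι] [Fintype ι]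
  [FibreCoord k M]

/-- The part in a chart of the cone over `Z`. -/
def chartPart (c : Chart k M) (Z : Set M) : Set (ι → k) := cone k Z ∩ c.carrier

theorem mem_vanishingIdeal_eval {V : Set (ι → k)} {F : MvPolynomial ι k} :
    F ∈ vanishingIdeal k V ↔ ∀ a ∈ V, eval a F = 0 := by
  simp [mem_vanishingIdeal_iff, aeval_eq_eval]

/-- Polynomials on the chart are replaced by their lifts to the cone, where primality is known. Two
lifts that are nonzero at the same coordinates give nonvanishing at the same point of the chart, by
uniqueness of chart coordinates. -/
theorem isPrime_vanishingIdeal_chartPart (c : Chart k M) {Z : Set M}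
    (hZ : @IsIrreducible M (zariski k M) Z) (hne : (chartPart c Z).Nonempty) :
    (vanishingIdeal k (chartPart c Z)).IsPrime := by
  have : Infinite k := IsAlgClosed.instInfinite
  have hprime := isPrime_coneIdeal hZ
  refine ⟨?_, fun {F G} hFG => ?_⟩
  · rw [Ne, Ideal.eq_top_iff_one]
    obtain ⟨a, ha⟩ := hne
    intro h
    simpa using mem_vanishingIdeal_eval.1 h a ha
  · by_contra! hcon
    obtain ⟨F', hF1, hF2⟩ := c.exists_lift F
    obtain ⟨G', hG1, hG2⟩ := c.exists_lift G
    have key : ∀ {F F' : MvPolynomial ι k}, (∀ a ∈ c.carrier, eval a F' = eval a F) →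
        F ∉ vanishingIdeal k (chartPart c Z) → F' ∉ coneIdeal k Z := by
      intro F F' h1 hF hF'
      refine hF (mem_vanishingIdeal_eval.2 ?_)
      rintro a ⟨⟨m, hm, ha⟩, hac⟩
      rw [← h1 a hac]
      exact mem_coneIdeal.1 hF' m hm a ha
    have hne : F' * G' ∉ coneIdeal k Z := fun h =>
      (hprime.mem_or_mem h).elim (key hF1 hcon.1) (key hG1 hcon.2)
    obtain ⟨m, hm, a, ha, hFG'⟩ := notMem_coneIdeal.1 hne
    rw [map_mul, mul_ne_zero_iff] at hFG'
    obtain ⟨b, hb, hbm, hbF⟩ := hF2 m a ha hFG'.1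
    obtain ⟨b', hb', hbm', hbG⟩ := hG2 m a ha hFG'.2
    obtain rfl := c.unique hb hb' hbm hbm'
    have := mem_vanishingIdeal_eval.1 hFG b ⟨⟨m, hm, hbm⟩, hb⟩
    rw [map_mul] at this
    exact mul_ne_zero hbF hbG this

theorem mem_chartPart_of_forall (c : Chart k M) {Z : Set M} (hZ : IsClosed[zariski k M] Z)
    {a : ι → k} (h : ∀ F ∈ vanishingIdeal k (chartPart c Z), eval a F = 0) : a ∈ chartPart c Z := by
  obtain ⟨S, hS⟩ := c.exists_eqs
  have hac : a ∈ c.carrier := (hS a).2 fun F hF =>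
    h F (mem_vanishingIdeal_eval.2 fun b hb => (hS b).1 hb.2 F hF)
  obtain ⟨m, hm⟩ := c.exists_isRep a hac
  refine ⟨⟨m, mem_of_coneIdeal hZ hm fun F hF => h F (mem_vanishingIdeal_eval.2 ?_), hm⟩, hac⟩
  rintro b ⟨⟨z, hz, hb⟩, -⟩
  exact mem_coneIdeal.1 hF z hz b hb

/-- The direction of the chart is complementary enough to the fibre that intersecting the tangent
space of the cone with it loses at most `fdim` dimensions; the intersection is tangent to the chart
part. The estimate is made at a point where that tangent dimension is the Krull dimension. -/
theorem coneDim_le_ringKrullDim_chartPart (c : Chart k M) {Z : Set M}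
    (hZ : @IsIrreducible M (zariski k M) Z) (hne : (chartPart c Z).Nonempty) :
    ((coneDim k Z - FibreCoord.fdim k M ι : ℕ) : WithBot ℕ∞) ≤
      ringKrullDim (MvPolynomial ι k ⧸ vanishingIdeal k (chartPart c Z)) := by
  have : Infinite k := IsAlgClosed.instInfinite
  have := isPrime_vanishingIdeal_chartPart c hZ hne
  obtain ⟨s, hs, -, D, hD, h⟩ := exists_finrank_kerAt_gradEqs (vanishingIdeal k (chartPart c Z))
  rw [hs]
  rw [mem_vanishingIdeal_eval] at hD
  push Not at hD
  obtain ⟨a, ha, hDa⟩ := hD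
  have hfin := h a (fun F hF => mem_vanishingIdeal_eval.1 hF a ha) hDa
  obtain ⟨⟨m, hm, ham⟩, hac⟩ := ha
  have hle : coneTangent Z a ⊓ c.direction ≤
      kerAt (eval a) (gradEqs (vanishingIdeal k (chartPart c Z))) := by
    rintro v ⟨hv, hvd⟩ _ ⟨F, hF, rfl⟩
    rw [← polyDiff_apply]
    obtain ⟨G, hG1, hG2⟩ := c.exists_lift F
    have h1 : polyDiff (G - F) a v = 0 := polyDiff_eq_zero_of_line fun t => by
      rw [map_sub, hG1 _ (c.add_mem hac (Submodule.smul_mem _ t hvd)), sub_self]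
    have h2 : polyDiff G a v = 0 := mem_coneTangent.1 hv G (mem_coneIdeal.2 fun z hz b hb => by
      by_contra hcon
      obtain ⟨b', hb', hbz, hbF⟩ := hG2 z b hb hcon
      exact hbF (mem_vanishingIdeal_eval.1 hF b' ⟨⟨z, hz, hbz⟩, hb'⟩))
    rw [polyDiff_sub, h2, zero_sub, neg_eq_zero] at h1
    exact h1
  have h1 := Submodule.finrank_sup_add_finrank_inf_eq (coneTangent Z a) c.direction
  have h2 := Submodule.finrank_add_le_finrank_add_finrank c.direction (FibreCoord.fibre (k := k) m)
  rw [c.sup_eq_top hac ham, FibreCoord.finrank_fibre, finrank_top] at h2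
  have h3 := Submodule.finrank_le (coneTangent Z a ⊔ c.direction)
  have h4 := Submodule.finrank_mono hle
  rw [hfin] at h4
  have h5 := coneDim_le hm ham
  exact_mod_cast (by omega : coneDim k Z - FibreCoord.fdim k M ι ≤ s)

/-- The set of the points of a chart at which the elements of `P` vanish. -/
def chartLocus (c : Chart k M) (P : Ideal (MvPolynomial ι k)) : Set M :=
  {m | ∃ a ∈ c.carrier, IsRep a m ∧ ∀ F ∈ P, eval a F = 0}

variable (c : Chart k M) {Z : Set M} (hZ : IsClosed[zariski k M] Z)

include hZ in
theorem chartLocus_subset {P : Ideal (MvPolynomial ι k)}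
    (hP : vanishingIdeal k (chartPart c Z) ≤ P) : chartLocus c P ⊆ Z := by
  rintro m ⟨a, ha, ham, haP⟩
  obtain ⟨⟨z, hz, haz⟩, -⟩ := mem_chartPart_of_forall c hZ fun F hF => haP F (hP hF)
  rwa [FibreCoord.isRep_unique ham haz]

include hZ in
-- By the Nullstellensatz `P` is the ideal of its zeros, and these lie in the chart part because `P`
-- contains its ideal.
theorem exists_mem_chartLocus {P : Ideal (MvPolynomial ι k)} [P.IsPrime]
    (hP : vanishingIdeal k (chartPart c Z) ≤ P) {D : MvPolynomial ι k} (hD : D ∉ P) :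
    ∃ m : M, ∃ a ∈ c.carrier, IsRep a m ∧ (∀ F ∈ P, eval a F = 0) ∧ eval a D ≠ 0 := by
  have hn := IsPrime.vanishingIdeal_zeroLocus (K := k) P
  rw [← hn, mem_vanishingIdeal_eval] at hD
  push Not at hD
  obtain ⟨a, ha, hDa⟩ := hD
  have ha' : ∀ F ∈ P, eval a F = 0 := by
    intro F hF
    have := mem_zeroLocus_iff.1 ha F hF
    rwa [aeval_eq_eval] at this
  obtain ⟨⟨z, hz, haz⟩, hac⟩ := mem_chartPart_of_forall c hZ fun F hF => ha' F (hP hF)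
  exact ⟨z, a, hac, haz, ha', hDa⟩

include hZ in
theorem isIrreducible_chartLocus {P : Ideal (MvPolynomial ι k)} [hPp : P.IsPrime]
    (hP : vanishingIdeal k (chartPart c Z) ≤ P) :
    @IsIrreducible M (zariski k M) (chartLocus c P) := by
  refine ⟨?_, ?_⟩
  · obtain ⟨m, a, hac, ham, haP, -⟩ := exists_mem_chartLocus c hZ hP (D := 1)
      ((Ideal.ne_top_iff_one P).1 hPp.ne_top)
    exact ⟨m, a, hac, ham, haP⟩
  · rintro U V hU hV ⟨x, ⟨a, ha, hax, haP⟩, hxU⟩ ⟨y, ⟨b, hb, hby, hbP⟩, hyV⟩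
    obtain ⟨F, hF, hF'⟩ := exists_of_isOpen hU hxU hax
    obtain ⟨G, hG, hG'⟩ := exists_of_isOpen hV hyV hby
    have : F * G ∉ P := fun h => (hPp.mem_or_mem h).elim (fun h => hF (haP F h))
      (fun h => hG (hbP G h))
    obtain ⟨z, e, hec, hez, heP, hFG⟩ := exists_mem_chartLocus c hZ hP this
    rw [map_mul, mul_ne_zero_iff] at hFG
    exact ⟨z, ⟨e, hec, hez, heP⟩, hF' z e hez hFG.1, hG' z e hez hFG.2⟩

include hZ in
-- The lift of an element of `Q` outside `P` vanishes on the cone over the locus of `Q`, but not at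
-- some point of the locus of `P`.
theorem zclosure_chartLocus_ssubset {P Q : Ideal (MvPolynomial ι k)} [P.IsPrime]
    (hP : vanishingIdeal k (chartPart c Z) ≤ P) (hPQ : P < Q) :
    zclosure k (chartLocus c Q) ⊂ zclosure k (chartLocus c P) := by
  obtain ⟨hle, F, hFQ, hFP⟩ := SetLike.lt_iff_le_and_exists.1 hPQ
  refine ⟨zclosure_mono ?_, fun hsub => ?_⟩
  · rintro m ⟨a, ha, ham, haQ⟩
    exact ⟨a, ha, ham, fun F hF => haQ F (hle hF)⟩
  · obtain ⟨m, a, hac, ham, haP, hFa⟩ := exists_mem_chartLocus c hZ hP hFP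
    have hm := hsub (subset_zclosure _ ⟨a, hac, ham, haP⟩)
    obtain ⟨G, hG1, hG2⟩ := c.exists_lift F
    have := (mem_zclosure_iff ham).1 hm G (mem_coneIdeal.2 ?_)
    · rw [hG1 a hac] at this
      exact hFa this
    · rintro z ⟨b, hbc, hbz, hbQ⟩ e hez
      by_contra hcon
      obtain ⟨b', hb', hbz', hbF⟩ := hG2 z e hez hcon
      rw [c.unique hb' hbc hbz' hbz] at hbF
      exact hbF (hbQ F hFQ)

include hZ in
-- Closures of loci turn chains of primes into chains of irreducible closed subsets of `Z`, with the
-- order reversed.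
theorem ringKrullDim_chartPart_le_zdim :
    ringKrullDim (MvPolynomial ι k ⧸ vanishingIdeal k (chartPart c Z)) ≤ zdim k Z := by
  set J := vanishingIdeal k (chartPart c Z) with hJ
  let _ := zariski k M
  let pr : PrimeSpectrum (MvPolynomial ι k ⧸ J) → PrimeSpectrum (MvPolynomial ι k) :=
    PrimeSpectrum.comap (Ideal.Quotient.mk J)
  have hpr : ∀ p, J ≤ (pr p).asIdeal := fun p F hF => by
    change Ideal.Quotient.mk J F ∈ p.asIdeal
    rw [Ideal.Quotient.eq_zero_iff_mem.2 hF]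
    exact zero_mem _
  have hsubZ : ∀ p, zclosure k (chartLocus c (pr p).asIdeal) ⊆ Z := fun p =>
    zclosure_subset (chartLocus_subset c hZ (hpr p)) hZ
  let W : PrimeSpectrum (MvPolynomial ι k ⧸ J) → TopologicalSpace.IrreducibleCloseds Z := fun p =>
    ⟨(↑) ⁻¹' zclosure k (chartLocus c (pr p).asIdeal),
      isIrreducible_preimage_val (hsubZ p)
        (isIrreducible_zclosure (isIrreducible_chartLocus c hZ (hpr p))),
      (isClosed_zclosure _).preimage continuous_subtype_val⟩
  have hW : StrictMono fun p => OrderDual.toDual (W p) := by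
    intro p q hpq
    have hlt : (pr p).asIdeal < (pr q).asIdeal := by
      refine lt_of_le_of_ne (Ideal.comap_mono hpq.le) fun h => hpq.ne ?_
      ext1
      exact Ideal.comap_injective_of_surjective _ Ideal.Quotient.mk_surjective h
    obtain ⟨h1, h2⟩ := zclosure_chartLocus_ssubset c hZ (hpr p) hlt
    refine OrderDual.toDual_lt_toDual.2 ⟨fun x hx => h1 hx, fun h => h2 fun x hx => ?_⟩
    exact h (show (⟨x, hsubZ p hx⟩ : Z) ∈ W p from hx)
  refine (Order.krullDim_le_of_strictMono _ hW).trans ?_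
  rw [Order.krullDim_orderDual]
  rfl

end Chart

/-- The upper bound is strict monotonicity of `coneDim` on irreducible closed sets; the lower bound
comes from a chart through one point. -/
theorem zdim_eq_coneDim_sub {k : Type*} [Field k] [IsAlgClosed k] {M : Type*} {ι : Type}
    [HomogCoord k M ι] [Fintype ι] [FibreCoord k M] [Charted k M] {Z : Set M}
    (hZ : IsProjVariety k Z) :
    zdim k Z = ((coneDim k Z - FibreCoord.fdim k M ι : ℕ) : WithBot ℕ∞) := by
  have : Infinite k := IsAlgClosed.instInfinite
  apply le_antisymm
  · let _ := zariski k M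
    refine topologicalKrullDim_le_of_nat hZ.closed (coneDim k) _ _
      (fun W _ hW => fdim_le_coneDim hW.1) (fun W hWZ hW hWc => ?_)
      (fun W W' _ hW hW' hWc h => coneDim_lt hW hW' hWc h)
    rcases eq_or_ssubset_of_subset hWZ with rfl | h
    · exact le_rfl
    · exact (coneDim_lt hW hZ.irreducible hWc h).le
  · obtain ⟨m, hm⟩ := hZ.irreducible.1
    obtain ⟨c, a, hac, ham⟩ : ∃ c : Chart k M, ∃ a ∈ c.carrier, IsRep a m := Charted.exists_chart m
    exact (coneDim_le_ringKrullDim_chartPart c hZ.irreducible ⟨a, ⟨m, hm, ham⟩, hac⟩).trans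
      (ringKrullDim_chartPart_le_zdim c hZ.closed)

universe u

/-! ### Coordinates on projective spaces -/

section PSpace

variable {k : Type*} [Field k] {N : ℕ}

theorem isRep_pspace_iff {v : Fin (N + 1) → k} {p : PSpace k N} :
    IsRep v p ↔ v ≠ 0 ∧ v ∈ p.submodule := by
  constructor
  · rintro ⟨hv, rfl⟩
    exact ⟨hv, by rw [Projectivization.submodule_mk]; exact Submodule.mem_span_singleton_self v⟩
  · rintro ⟨hv, hvp⟩
    refine ⟨hv, ?_⟩
    rw [Projectivization.submodule_eq, Submodule.mem_span_singleton] at hvp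
    obtain ⟨t, rfl⟩ := hvp
    refine Eq.trans ?_ (Projectivization.mk_rep p)
    rw [Projectivization.mk_eq_mk_iff']
    exact ⟨t, rfl⟩

theorem isRep_rep (p : PSpace k N) : IsRep p.rep p := ⟨p.rep_nonzero, p.mk_rep⟩

theorem submodule_eq_span_of_isRep {v : Fin (N + 1) → k} {p : PSpace k N} (hv : IsRep v p) :
    p.submodule = Submodule.span k {v} := by
  obtain ⟨hv, rfl⟩ := hv
  exact Projectivization.submodule_mk v hv

theorem submodule_le_iff {v : Fin (N + 1) → k} {p : PSpace k N} (hv : IsRep v p)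
    (E : Submodule k (Fin (N + 1) → k)) : p.submodule ≤ E ↔ v ∈ E := by
  rw [submodule_eq_span_of_isRep hv, Submodule.span_singleton_le_iff_mem]

theorem exists_rep_ne_zero (p : PSpace k N) : ∃ j, p.rep j ≠ 0 :=
  Function.ne_iff.1 p.rep_nonzero

theorem isRep_smul {v : Fin (N + 1) → k} {p : PSpace k N} (hv : IsRep v p) {t : k} (ht : t ≠ 0) :
    IsRep (t • v) p := by
  rw [isRep_pspace_iff] at hv ⊢
  exact ⟨smul_ne_zero ht hv.1, Submodule.smul_mem _ t hv.2⟩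

theorem exists_eq_smul_of_isRep {v w : Fin (N + 1) → k} {p : PSpace k N} (hv : IsRep v p)
    (hw : IsRep w p) : ∃ t : k, t ≠ 0 ∧ t • v = w := by
  have h := (isRep_pspace_iff.1 hw).2
  rw [submodule_eq_span_of_isRep hv, Submodule.mem_span_singleton] at h
  obtain ⟨t, rfl⟩ := h
  exact ⟨t, fun h0 => (isRep_pspace_iff.1 hw).1 (by simp [h0]), rfl⟩

instance : FibreCoord k (PSpace k N) where
  fibre p := p.submodule
  fdim := 1
  disc p := X (exists_rep_ne_zero p).choose
  finrank_fibre p := Projectivization.finrank_submodule p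
  isRep_iff v p := by
    have hj := (exists_rep_ne_zero p).choose_spec
    rw [eval_X]
    constructor
    · intro hv
      refine ⟨(isRep_pspace_iff.1 hv).2, ?_⟩
      obtain ⟨t, ht, rfl⟩ := exists_eq_smul_of_isRep (isRep_rep p) hv
      simp [ht, hj]
    · rintro ⟨hv, h⟩
      exact isRep_pspace_iff.2 ⟨fun h0 => h (by simp [h0]), hv⟩
  exists_isRep p := ⟨_, isRep_rep p⟩
  isRep_unique := by
    rintro a _ _ ⟨ha, rfl⟩ ⟨ha', rfl⟩
    rfl
  exists_trans := by
    intro a b p ha hb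
    obtain ⟨t, ht, rfl⟩ := exists_eq_smul_of_isRep ha hb
    exact ⟨LinearEquiv.smulOfNeZero k _ t ht, rfl, fun _ _ hc => isRep_smul hc ht⟩

end PSpace

/-! ### Coordinates on Grassmannians -/

section Grass

variable {k : Type*} [Field k] {d N : ℕ}

/-- The `i`-th vector of a tuple, as a linear map. -/
def rowₗ (k : Type*) [Field k] {d N : ℕ} (i : Fin d) :
    (Fin d × Fin (N + 1) → k) →ₗ[k] (Fin (N + 1) → k) where
  toFun a := row a i
  map_add' _ _ := rfl
  map_smul' _ _ := rfl

@[simp] theorem rowₗ_apply (i : Fin d) (a : Fin d × Fin (N + 1) → k) : rowₗ k i a = row a i := rfl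

theorem row_add (a b : Fin d × Fin (N + 1) → k) (i : Fin d) : row (a + b) i = row a i + row b i :=
  rfl

theorem row_sub (a b : Fin d × Fin (N + 1) → k) (i : Fin d) : row (a - b) i = row a i - row b i :=
  rfl

theorem row_smul (t : k) (a : Fin d × Fin (N + 1) → k) (i : Fin d) :
    row (t • a) i = t • row a i := rfl

/-- The tuple with given vectors. -/
def ofRows (v : Fin d → Fin (N + 1) → k) : Fin d × Fin (N + 1) → k := fun p => v p.1 p.2

@[simp] theorem row_ofRows (v : Fin d → Fin (N + 1) → k) (i : Fin d) : row (ofRows v) i = v i := rfl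

theorem ext_row {a b : Fin d × Fin (N + 1) → k} (h : ∀ i, row a i = row b i) : a = b := by
  ext ⟨i, j⟩
  exact congrFun (h i) j

theorem isRep_grass_iff {a : Fin d × Fin (N + 1) → k} {L : Grass k d N} :
    IsRep a L ↔ Submodule.span k (Set.range (row a)) = L.1 := Iff.rfl

theorem row_mem {a : Fin d × Fin (N + 1) → k} {L : Grass k d N} (ha : IsRep a L) (i : Fin d) :
    row a i ∈ L.1 := by
  rw [← isRep_grass_iff.1 ha]
  exact Submodule.subset_span ⟨i, rfl⟩

theorem linearIndependent_row {a : Fin d × Fin (N + 1) → k} {L : Grass k d N} (ha : IsRep a L) :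
    LinearIndependent k (row a) := by
  rw [linearIndependent_iff_card_eq_finrank_span, Set.finrank, isRep_grass_iff.1 ha, L.2,
    Fintype.card_fin]

theorem isRep_of_linearIndependent {a : Fin d × Fin (N + 1) → k} {L : Grass k d N}
    (ha : LinearIndependent k (row a)) (h : ∀ i, row a i ∈ L.1) : IsRep a L := by
  refine isRep_grass_iff.2 (Submodule.eq_of_le_of_finrank_eq (Submodule.span_le.2 ?_) ?_)
  · rintro _ ⟨i, rfl⟩
    exact h i
  · rw [finrank_span_eq_card ha, L.2, Fintype.card_fin]

/-- The plane spanned by independent vectors. -/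
def spanGrass (a : Fin d × Fin (N + 1) → k) (ha : LinearIndependent k (row a)) : Grass k d N :=
  ⟨Submodule.span k (Set.range (row a)), by rw [finrank_span_eq_card ha, Fintype.card_fin]⟩

theorem isRep_spanGrass (a : Fin d × Fin (N + 1) → k) (ha : LinearIndependent k (row a)) :
    IsRep a (spanGrass a ha) := isRep_grass_iff.2 rfl

/-- The action of matrices on tuples of vectors. -/
def rowAct (g : Matrix (Fin d) (Fin d) k) :
    (Fin d × Fin (N + 1) → k) →ₗ[k] (Fin d × Fin (N + 1) → k) where
  toFun a := ofRows fun i => ∑ l, g i l • row a l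
  map_add' a b := ext_row fun i => by
    simp [row_add, Finset.sum_add_distrib]
  map_smul' t a := ext_row fun i => by
    simp [row_smul, Finset.smul_sum, smul_comm t]

theorem row_rowAct (g : Matrix (Fin d) (Fin d) k) (a : Fin d × Fin (N + 1) → k) (i : Fin d) :
    row (rowAct g a) i = ∑ l, g i l • row a l := rfl

theorem rowAct_mul (g h : Matrix (Fin d) (Fin d) k) (a : Fin d × Fin (N + 1) → k) :
    rowAct (g * h) a = rowAct g (rowAct h a) := ext_row fun i => by
  simp only [row_rowAct, Matrix.mul_apply, Finset.sum_smul, Finset.smul_sum, smul_smul]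
  rw [Finset.sum_comm]

theorem rowAct_one (a : Fin d × Fin (N + 1) → k) : rowAct 1 a = a := ext_row fun i => by
  simp [row_rowAct, Matrix.one_apply]

theorem span_rowAct_le (g : Matrix (Fin d) (Fin d) k) (a : Fin d × Fin (N + 1) → k) :
    Submodule.span k (Set.range (row (rowAct g a))) ≤ Submodule.span k (Set.range (row a)) := by
  refine Submodule.span_le.2 ?_
  rintro _ ⟨i, rfl⟩
  rw [row_rowAct]
  exact Submodule.sum_mem _ fun l _ => Submodule.smul_mem _ _ (Submodule.subset_span ⟨l, rfl⟩)

theorem isRep_rowAct {g h : Matrix (Fin d) (Fin d) k} (hg : h * g = 1)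
    {a : Fin d × Fin (N + 1) → k} {L : Grass k d N} (ha : IsRep a L) : IsRep (rowAct g a) L := by
  rw [isRep_grass_iff] at ha ⊢
  rw [← ha]
  refine (span_rowAct_le g a).antisymm ?_
  conv_lhs => rw [← rowAct_one a, ← hg, rowAct_mul]
  exact span_rowAct_le h _

theorem exists_rowAct_eq {a b : Fin d × Fin (N + 1) → k} {L : Grass k d N} (ha : IsRep a L)
    (hb : ∀ i, row b i ∈ L.1) : ∃ g : Matrix (Fin d) (Fin d) k, rowAct g a = b := by
  have : ∀ i, ∃ c : Fin d → k, ∑ l, c l • row a l = row b i := fun i => by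
    have := hb i
    rwa [← isRep_grass_iff.1 ha, Submodule.mem_span_range_iff_exists_fun] at this
  choose g hg using this
  exact ⟨Matrix.of g, ext_row fun i => by rw [row_rowAct]; exact hg i⟩

theorem rowAct_injective {a : Fin d × Fin (N + 1) → k} (ha : LinearIndependent k (row a))
    {g h : Matrix (Fin d) (Fin d) k} (hgh : rowAct g a = rowAct h a) : g = h := by
  ext i l
  have : ∑ l, g i l • row a l = ∑ l, h i l • row a l := by
    rw [← row_rowAct, ← row_rowAct, hgh]
  have h2 := Fintype.linearIndependent_iff.1 ha (fun l => g i l - h i l) (by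
    simp [sub_smul, Finset.sum_sub_distrib, this])
  exact sub_eq_zero.1 (h2 l)

theorem exists_rowAct_of_isRep {a b : Fin d × Fin (N + 1) → k} {L : Grass k d N} (ha : IsRep a L)
    (hb : IsRep b L) :
    ∃ g h : Matrix (Fin d) (Fin d) k, h * g = 1 ∧ g * h = 1 ∧ rowAct g a = b := by
  obtain ⟨g, hg⟩ := exists_rowAct_eq ha (row_mem hb)
  obtain ⟨h, hh⟩ := exists_rowAct_eq hb (row_mem ha)
  have : h * g = 1 := rowAct_injective (linearIndependent_row ha) (by
    rw [rowAct_mul, hg, hh, rowAct_one])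
  exact ⟨g, h, this, mul_eq_one_comm.1 this, hg⟩

/-- The tuples of vectors of `L`. -/
def rowsIn (L : Submodule k (Fin (N + 1) → k)) (d : ℕ) : Submodule k (Fin d × Fin (N + 1) → k) where
  carrier := {a | ∀ i, row a i ∈ L}
  zero_mem' _ := zero_mem L
  add_mem' ha hb i := add_mem (ha i) (hb i)
  smul_mem' t _ ha i := L.smul_mem t (ha i)

theorem mem_rowsIn {L : Submodule k (Fin (N + 1) → k)} {a : Fin d × Fin (N + 1) → k} :
    a ∈ rowsIn L d ↔ ∀ i, row a i ∈ L := Iff.rfl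

theorem finrank_rowsIn (L : Submodule k (Fin (N + 1) → k)) :
    Module.finrank k (rowsIn L d) = d * Module.finrank k L := by
  let e : rowsIn L d ≃ₗ[k] (Fin d → L) :=
    { toFun := fun a i => ⟨row a.1 i, a.2 i⟩
      map_add' := fun _ _ => rfl
      map_smul' := fun _ _ => rfl
      invFun := fun v => ⟨ofRows fun i => v i, fun i => (v i).2⟩
      left_inv := fun a => Subtype.ext rfl
      right_inv := fun v => rfl }
  rw [e.finrank_eq, Module.finrank_pi_fintype]
  simp

/-- The matrix of the values of a linear map at the vectors of a tuple. -/
def valueMatrix (f : (Fin (N + 1) → k) →ₗ[k] (Fin d → k)) :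
    Matrix (Fin d) (Fin d) (MvPolynomial (Fin d × Fin (N + 1)) k) :=
  Matrix.of fun i => linPoly (f ∘ₗ rowₗ k i)

theorem eval_det_valueMatrix (f : (Fin (N + 1) → k) →ₗ[k] (Fin d → k))
    (a : Fin d × Fin (N + 1) → k) :
    eval a (valueMatrix f).det = (Matrix.of fun i => f (row a i)).det := by
  rw [RingHom.map_det]
  congr 1
  ext i j
  simp [valueMatrix]

theorem linearIndependent_of_eval_det_ne_zero {f : (Fin (N + 1) → k) →ₗ[k] (Fin d → k)}
    {a : Fin d × Fin (N + 1) → k} (h : eval a (valueMatrix f).det ≠ 0) :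
    LinearIndependent k (row a) := by
  rw [eval_det_valueMatrix] at h
  have h1 : LinearIndependent k (Matrix.of fun i => f (row a i)).row :=
    Matrix.linearIndependent_rows_iff_isUnit.2
      ((Matrix.isUnit_iff_isUnit_det _).2 (isUnit_iff_ne_zero.2 h))
  exact LinearIndependent.of_comp f h1

theorem exists_linearMap_bijOn (L : Grass k d N) :
    ∃ f : (Fin (N + 1) → k) →ₗ[k] (Fin d → k), Function.Bijective (f ∘ₗ L.1.subtype) := by
  let e : L.1 ≃ₗ[k] (Fin d → k) := (Module.finBasisOfFinrankEq k L.1 L.2).equivFun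
  obtain ⟨f, hf⟩ := LinearMap.exists_extend e.toLinearMap
  exact ⟨f, by rw [hf]; exact e.bijective⟩

/-- As `f` is an isomorphism on `L`, a tuple of vectors of `L` is a frame exactly when the matrix of
its `f`-values is invertible. The determinant serves as the discriminant. -/
theorem isRep_iff_eval_det_ne_zero {L : Grass k d N} {f : (Fin (N + 1) → k) →ₗ[k] (Fin d → k)}
    (hf : Function.Bijective (f ∘ₗ L.1.subtype)) (a : Fin d × Fin (N + 1) → k) :
    IsRep a L ↔ a ∈ rowsIn L.1 d ∧ eval a (valueMatrix f).det ≠ 0 := by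
  constructor
  · intro ha
    refine ⟨row_mem ha, ?_⟩
    rw [eval_det_valueMatrix, ← isUnit_iff_ne_zero, ← Matrix.isUnit_iff_isUnit_det,
      ← Matrix.linearIndependent_rows_iff_isUnit]
    have h1 : LinearIndependent k fun i => (⟨row a i, row_mem ha i⟩ : L.1) :=
      LinearIndependent.of_comp L.1.subtype (linearIndependent_row ha)
    exact h1.map' (f ∘ₗ L.1.subtype) (LinearMap.ker_eq_bot.2 hf.1)
  · rintro ⟨h1, h2⟩
    exact isRep_of_linearIndependent (linearIndependent_of_eval_det_ne_zero h2) h1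

instance : FibreCoord k (Grass k d N) where
  fibre L := rowsIn L.1 d
  fdim := d * d
  disc L := (valueMatrix (exists_linearMap_bijOn L).choose).det
  finrank_fibre L := by rw [finrank_rowsIn, L.2]
  isRep_iff a L := isRep_iff_eval_det_ne_zero (exists_linearMap_bijOn L).choose_spec a
  exists_isRep L := by
    let B := Module.finBasisOfFinrankEq k L.1 L.2
    refine ⟨ofRows fun i => B i, isRep_of_linearIndependent ?_ fun i => (B i).2⟩
    exact B.linearIndependent.map' L.1.subtype (Submodule.ker_subtype _)
  isRep_unique h h' := Subtype.ext (h.symm.trans h')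
  exists_trans := by
    intro a b L ha hb
    obtain ⟨g, h, h1, h2, rfl⟩ := exists_rowAct_of_isRep ha hb
    exact ⟨{ rowAct g with
      invFun := rowAct h
      left_inv := fun c => by
        change rowAct h (rowAct g c) = c
        rw [← rowAct_mul, h1, rowAct_one]
      right_inv := fun c => by
        change rowAct g (rowAct h c) = c
        rw [← rowAct_mul, h2, rowAct_one] }, rfl, fun m c hc => isRep_rowAct h1 hc⟩

theorem fdim_grass : FibreCoord.fdim k (Grass k d N) (Fin d × Fin (N + 1)) = d * d := rfl

end Grass

/-! ### Coordinates on products -/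

section Prod

variable {k : Type*} [Field k] {M M' : Type*} {ι κ : Type} [HomogCoord k M ι] [HomogCoord k M' κ]

/-- The two components of a system of coordinates of a point of a product. -/
def inlₗ (k : Type*) [Field k] (ι κ : Type) : (ι ⊕ κ → k) →ₗ[k] (ι → k) :=
  LinearMap.funLeft k k Sum.inl

/-- The second component of a system of coordinates of a point of a product. -/
def inrₗ (k : Type*) [Field k] (ι κ : Type) : (ι ⊕ κ → k) →ₗ[k] (κ → k) :=
  LinearMap.funLeft k k Sum.inr

@[simp] theorem inlₗ_apply (a : ι ⊕ κ → k) : inlₗ k ι κ a = fun i => a (Sum.inl i) := rfl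

@[simp] theorem inrₗ_apply (a : ι ⊕ κ → k) : inrₗ k ι κ a = fun i => a (Sum.inr i) := rfl

theorem isRep_prod_iff {a : ι ⊕ κ → k} {m : M × M'} :
    IsRep a m ↔ IsRep (fun i => a (Sum.inl i)) m.1 ∧ IsRep (fun i => a (Sum.inr i)) m.2 := Iff.rfl

theorem isRep_sumElim {a : ι → k} {b : κ → k} {m : M} {m' : M'} (ha : IsRep a m) (hb : IsRep b m') :
    IsRep (Sum.elim a b) (m, m') := ⟨ha, hb⟩

instance [Fintype ι] [Fintype κ] [FibreCoord k M] [FibreCoord k M'] : FibreCoord k (M × M') where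
  fibre m := (FibreCoord.fibre m.1).comap (inlₗ k ι κ) ⊓ (FibreCoord.fibre m.2).comap (inrₗ k ι κ)
  fdim := FibreCoord.fdim k M ι + FibreCoord.fdim k M' κ
  disc m := rename Sum.inl (FibreCoord.disc m.1) * rename Sum.inr (FibreCoord.disc m.2)
  finrank_fibre m := by
    let e : ((FibreCoord.fibre m.1).comap (inlₗ k ι κ) ⊓ (FibreCoord.fibre m.2).comap (inrₗ k ι κ) :
        Submodule k (ι ⊕ κ → k)) ≃ₗ[k] FibreCoord.fibre (k := k) m.1 × FibreCoord.fibre (k := k) m.2 :=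
      { toFun := fun a => (⟨_, a.2.1⟩, ⟨_, a.2.2⟩)
        map_add' := fun _ _ => rfl
        map_smul' := fun _ _ => rfl
        invFun := fun b => ⟨Sum.elim b.1 b.2, b.1.2, b.2.2⟩
        left_inv := fun a => Subtype.ext (Sum.elim_comp_inl_inr _)
        right_inv := fun b => rfl }
    rw [e.finrank_eq, Module.finrank_prod, FibreCoord.finrank_fibre, FibreCoord.finrank_fibre]
  isRep_iff a m := by
    rw [isRep_prod_iff, FibreCoord.isRep_iff, FibreCoord.isRep_iff, map_mul, eval_rename,
      eval_rename, mul_ne_zero_iff]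
    exact and_and_and_comm
  exists_isRep m := by
    obtain ⟨a, ha⟩ := exists_rep k m.1
    obtain ⟨b, hb⟩ := exists_rep k m.2
    exact ⟨_, isRep_sumElim ha hb⟩
  isRep_unique h h' :=
    Prod.ext (FibreCoord.isRep_unique h.1 h'.1) (FibreCoord.isRep_unique h.2 h'.2)
  exists_trans := by
    intro a b m ha hb
    obtain ⟨g, hg, hg'⟩ := FibreCoord.exists_trans ha.1 hb.1
    obtain ⟨h, hh, hh'⟩ := FibreCoord.exists_trans ha.2 hb.2
    let e := LinearEquiv.sumArrowLequivProdArrow ι κ k k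
    refine ⟨e.trans ((g.prodCongr h).trans e.symm), ?_, fun m' c hc => ⟨hg' _ _ hc.1, hh' _ _ hc.2⟩⟩
    ext x
    rcases x with x | x
    · exact congrFun hg x
    · exact congrFun hh x

end Prod

/-! ### Charts -/

section Charts

variable {k : Type*} [Field k]

/-- The exponent and `G` depend only on `F`, not on the field `K`: the completeness argument uses
the same `G` at points over `k` and at a generic point. -/
theorem exists_homogenize_aeval {k : Type u} [Field k] {ι κ : Type} (D : MvPolynomial ι k)
    (P : κ → MvPolynomial ι k) (F : MvPolynomial κ k) :
    ∃ (n : ℕ) (G : MvPolynomial ι k), ∀ (K : Type u) [Field K] [Algebra k K] (a : ι → K),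
      aeval a D ≠ 0 →
        aeval a G = aeval a D ^ n * aeval (fun j => (aeval a D)⁻¹ * aeval a (P j)) F := by
  induction F using MvPolynomial.induction_on with
  | C c => exact ⟨0, C c, fun K _ _ a _ => by simp⟩
  | add F F' hF hF' =>
    obtain ⟨n, G, h⟩ := hF
    obtain ⟨n', G', h'⟩ := hF'
    refine ⟨n + n', G * D ^ n' + G' * D ^ n, fun K _ _ a ha => ?_⟩
    rw [map_add, map_mul, map_mul, h K a ha, h' K a ha, map_add, map_pow, map_pow]
    ring
  | mul_X F j hF =>
    obtain ⟨n, G, h⟩ := hF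
    refine ⟨n + 1, G * P j, fun K _ _ a ha => ?_⟩
    rw [map_mul, h K a ha, map_mul, aeval_X]
    generalize aeval (fun j => (aeval a D)⁻¹ * aeval a (P j)) F = z
    field_simp
    ring

theorem exists_homogenize {ι κ : Type} (D : MvPolynomial ι k) (P : κ → MvPolynomial ι k)
    (F : MvPolynomial κ k) : ∃ (n : ℕ) (G : MvPolynomial ι k), ∀ a : ι → k, eval a D ≠ 0 →
      eval a G = eval a D ^ n * eval (fun j => (eval a D)⁻¹ * eval a (P j)) F := by
  obtain ⟨n, G, h⟩ := exists_homogenize_aeval D P F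
  refine ⟨n, G, fun a ha => ?_⟩
  have := h k a
  simp only [aeval_eq_eval] at this
  exact this ha

/-- Normalizing divides by `D`, so `G` is the cleared numerator. The additional factor `D` makes it
vanish off the domain of the normalization. -/
theorem exists_lift_of_normalization {ι : Type} (S : Set (ι → k)) (D : MvPolynomial ι k)
    (P : ι → MvPolynomial ι k) (hD : ∀ a ∈ S, eval a D = 1) (hP : ∀ a ∈ S, ∀ j, eval a (P j) = a j)
    (F : MvPolynomial ι k) : ∃ G : MvPolynomial ι k, (∀ a ∈ S, eval a G = eval a F) ∧
      ∀ a : ι → k, eval a G ≠ 0 → eval a D ≠ 0 ∧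
        eval (fun j => (eval a D)⁻¹ * eval a (P j)) F ≠ 0 := by
  obtain ⟨n, G, h⟩ := exists_homogenize D P F
  refine ⟨D * G, fun a ha => ?_, fun a ha => ?_⟩
  · have h1 := hD a ha
    rw [map_mul, h a (by simp [h1]), h1]
    simp [hP a ha]
  · rw [map_mul, mul_ne_zero_iff] at ha
    refine ⟨ha.1, fun h0 => ha.2 ?_⟩
    rw [h a ha.1, h0, mul_zero]

variable {d N : ℕ}

/-- The affine chart of the projective space on which a coordinate does not vanish. -/
def pspaceChart (k : Type*) [Field k] {N : ℕ} (j : Fin (N + 1)) : Chart k (PSpace k N) where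
  carrier := {a | a j = 1}
  direction := LinearMap.ker (LinearMap.proj j)
  exists_isRep a ha := ⟨Projectivization.mk k a (fun h => by simp [h] at ha), _, rfl⟩
  unique := by
    intro m a b ha hb ham hbm
    obtain ⟨t, ht, rfl⟩ := exists_eq_smul_of_isRep ham hbm
    have : t = 1 := by simpa [show a j = 1 from ha] using hb
    rw [this, one_smul]
  exists_eqs := ⟨{X j - 1}, fun a => by simp [sub_eq_zero]⟩
  add_mem := by
    intro a v ha hv
    have : v j = 0 := hv
    simpa [this] using ha
  sup_eq_top := by
    intro a m ha ham
    refine eq_top_iff.2 fun v _ => ?_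
    have h : v = (v - v j • a) + v j • a := by simp
    rw [h]
    refine Submodule.add_mem_sup ?_ (Submodule.smul_mem _ _ (isRep_mem_fibre ham))
    simp [show a j = 1 from ha]
  exists_lift F := by
    obtain ⟨G, h1, h2⟩ := exists_lift_of_normalization {a : Fin (N + 1) → k | a j = 1} (X j) X
      (fun a ha => by simpa using ha) (fun a _ i => eval_X i) F
    refine ⟨G, h1, fun m a ham ha => ?_⟩
    obtain ⟨h3, h4⟩ := h2 a ha
    rw [eval_X] at h3
    refine ⟨(a j)⁻¹ • a, by simp [h3], isRep_smul ham (inv_ne_zero h3), ?_⟩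
    simp only [eval_X] at h4
    exact h4

instance : Charted k (PSpace k N) where
  exists_chart m := by
    obtain ⟨j, hj⟩ := exists_rep_ne_zero m
    exact ⟨pspaceChart k j, (m.rep j)⁻¹ • m.rep, by simp [pspaceChart, hj],
      isRep_smul (isRep_rep m) (inv_ne_zero hj)⟩

theorem eq_one_of_values {f : (Fin (N + 1) → k) →ₗ[k] (Fin d → k)}
    {a b : Fin d × Fin (N + 1) → k} (ha : ∀ i, f (row a i) = Pi.single i 1)
    (hb : ∀ i, f (row b i) = Pi.single i 1) {L : Grass k d N} (haL : IsRep a L) (hbL : IsRep b L) :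
    a = b := by
  obtain ⟨g, rfl⟩ := exists_rowAct_eq haL (row_mem hbL)
  have : g = 1 := by
    ext i j
    have := congrFun (hb i) j
    rw [row_rowAct, map_sum] at this
    simp only [map_smul, ha, Finset.sum_apply, Pi.smul_apply, Pi.single_apply, smul_eq_mul,
      mul_ite, mul_one, mul_zero, Finset.sum_ite_eq, Finset.mem_univ, if_true] at this
    rw [this, Matrix.one_apply]
    simp [eq_comm]
  rw [this, rowAct_one]

theorem det_values_eq_one {f : (Fin (N + 1) → k) →ₗ[k] (Fin d → k)}
    {a : Fin d × Fin (N + 1) → k} (ha : ∀ i, f (row a i) = Pi.single i 1) :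
    (Matrix.of fun i => f (row a i)) = 1 := by
  ext i j
  simp [ha, Matrix.one_apply, Pi.single_apply, eq_comm]

/-- The coordinates of the normalization of a tuple with respect to a chart, up to a common
factor. -/
def normalizePoly (f : (Fin (N + 1) → k) →ₗ[k] (Fin d → k)) (p : Fin d × Fin (N + 1)) :
    MvPolynomial (Fin d × Fin (N + 1)) k :=
  ∑ l, (valueMatrix f).adjugate p.1 l * X (l, p.2)

theorem eval_valueMatrix (f : (Fin (N + 1) → k) →ₗ[k] (Fin d → k)) (a : Fin d × Fin (N + 1) → k) :
    (eval a).mapMatrix (valueMatrix f) = Matrix.of fun i => f (row a i) := by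
  ext i j
  simp [valueMatrix]

theorem eval_normalizePoly (f : (Fin (N + 1) → k) →ₗ[k] (Fin d → k))
    (a : Fin d × Fin (N + 1) → k) :
    (fun p => eval a (normalizePoly f p)) =
      rowAct (Matrix.of fun i => f (row a i)).adjugate a := by
  refine ext_row fun i => ?_
  ext j
  rw [row_rowAct, ← eval_valueMatrix, ← RingHom.map_adjugate]
  simp [row, normalizePoly]

/-- The affine chart of the Grassmannian of the planes that are complementary to the kernel of
`f`. -/
def grassChart (f : (Fin (N + 1) → k) →ₗ[k] (Fin d → k)) : Chart k (Grass k d N) where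
  carrier := {a | ∀ i, f (row a i) = Pi.single i 1}
  direction := ⨅ i, LinearMap.ker (f ∘ₗ rowₗ k i)
  exists_isRep a ha := by
    have h : eval a (valueMatrix f).det ≠ 0 := by
      rw [eval_det_valueMatrix, det_values_eq_one ha]
      simp
    exact ⟨spanGrass a (linearIndependent_of_eval_det_ne_zero h), isRep_spanGrass a _⟩
  unique ha hb ham hbm := eq_one_of_values ha hb ham hbm
  exists_eqs := by
    refine ⟨Set.range fun p : Fin d × Fin d =>
      linPoly (f ∘ₗ rowₗ k p.1) p.2 - C ((Pi.single p.1 1 : Fin d → k) p.2), fun a => ?_⟩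
    simp only [Set.forall_mem_range, map_sub, eval_linPoly, eval_C, sub_eq_zero, Prod.forall]
    exact forall_congr' fun i => funext_iff
  add_mem := by
    intro a v ha hv i
    rw [row_add, map_add, ha]
    have : f (row v i) = 0 := (Submodule.mem_iInf _).1 hv i
    rw [this, add_zero]
  sup_eq_top := by
    intro a m ha ham
    refine eq_top_iff.2 fun v _ => ?_
    -- The tuple in the fibre with the same `f`-values as `v`.
    let w := rowAct (Matrix.of fun i => f (row v i)) a
    have h : v = (v - w) + w := by simp
    rw [h]
    refine Submodule.add_mem_sup ((Submodule.mem_iInf _).2 fun i => ?_) fun i => ?_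
    · rw [LinearMap.mem_ker, LinearMap.comp_apply, rowₗ_apply, row_sub, map_sub, row_rowAct, map_sum,
        sub_eq_zero]
      have ha' : ∀ i, f (row a i) = Pi.single i 1 := ha
      simp only [map_smul, ha']
      ext j
      simp [Pi.single_apply]
    · rw [row_rowAct]
      exact Submodule.sum_mem _ fun l _ => Submodule.smul_mem _ _ (row_mem ham l)
  exists_lift F := by
    obtain ⟨G, h1, h2⟩ := exists_lift_of_normalization
      {a : Fin d × Fin (N + 1) → k | ∀ i, f (row a i) = Pi.single i 1} (valueMatrix f).det
      (normalizePoly f)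
      (fun a ha => by rw [eval_det_valueMatrix, det_values_eq_one ha, Matrix.det_one])
      (fun a ha j => by
        have := congrFun (eval_normalizePoly f a) j
        rw [det_values_eq_one ha, Matrix.adjugate_one, rowAct_one] at this
        exact this) F
    refine ⟨G, h1, fun m a ham ha => ?_⟩
    obtain ⟨h3, h4⟩ := h2 a ha
    rw [eval_det_valueMatrix] at h3 h4
    set V := Matrix.of fun i => f (row a i) with hV
    have h5 : (fun j => V.det⁻¹ * eval a (normalizePoly f j)) = rowAct (V.det⁻¹ • V.adjugate) a := by
      refine ext_row fun i => ?_
      ext j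
      have := congrFun (congrArg (fun b => row b i) (eval_normalizePoly f a)) j
      change _ * row (fun p => eval a (normalizePoly f p)) i j = _
      rw [this, row_rowAct, row_rowAct]
      simp [Finset.mul_sum, mul_assoc, hV]
    have h6 : V.det⁻¹ • V.adjugate * V = 1 := by
      rw [Matrix.smul_mul, Matrix.adjugate_mul, smul_smul, inv_mul_cancel₀ h3, one_smul]
    rw [h5] at h4
    refine ⟨_, fun i => ?_, isRep_rowAct (h := V) (mul_eq_one_comm.1 h6) ham, h4⟩
    rw [row_rowAct, map_sum]
    simp only [map_smul]
    ext j
    have := congrFun (congrFun h6 i) j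
    rw [Matrix.mul_apply] at this
    rw [Finset.sum_apply]
    simpa [hV, Matrix.one_apply, Pi.single_apply, eq_comm] using this

instance : Charted k (Grass k d N) where
  exists_chart L := by
    obtain ⟨f, hf⟩ := exists_linearMap_bijOn L
    choose v hv using fun i : Fin d => hf.2 (Pi.single i 1)
    have hv' : ∀ i, f (row (ofRows fun i => (v i : Fin (N + 1) → k)) i) = Pi.single i 1 := hv
    refine ⟨grassChart f, ofRows fun i => v i, hv', ?_⟩
    rw [isRep_iff_eval_det_ne_zero hf, eval_det_valueMatrix, det_values_eq_one hv']
    exact ⟨fun i => (v i).2, by simp⟩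

end Charts

/-! ### Orthogonal frames -/

section Duality

variable {k : Type*} [Field k]

theorem finrank_map_add {V W : Type*} [AddCommGroup V] [Module k V] [AddCommGroup W] [Module k W]
    [FiniteDimensional k V] (f : V →ₗ[k] W) (S : Submodule k V) :
    Module.finrank k (S.map f) + Module.finrank k (S ⊓ LinearMap.ker f : Submodule k V) =
      Module.finrank k S := by
  rw [← LinearMap.finrank_range_add_finrank_ker (f.domRestrict S), LinearMap.range_domRestrict,
    LinearMap.ker_domRestrict, ← Submodule.finrank_map_subtype_eq S, Submodule.map_comap_subtype]

theorem card_le_finrank_kerAt_add {R L q : Type*} [CommRing R] [Field L] [Fintype q] {s : ℕ}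
    (e : R →+* L) (Q : Fin s → q → R) :
    Fintype.card q ≤ Module.finrank L (kerAt e (Set.range Q)) + s ∧
      (LinearIndependent L (fun j i => e (Q j i)) →
        Fintype.card q = Module.finrank L (kerAt e (Set.range Q)) + s) := by
  classical
  let A : Matrix (Fin s) q L := Matrix.of fun j i => e (Q j i)
  have hker : kerAt e (Set.range Q) = LinearMap.ker A.mulVecLin := by
    ext v
    rw [mem_kerAt, LinearMap.mem_ker, funext_iff]
    simp [A, Matrix.mulVec, dotProduct]
  have h := LinearMap.finrank_range_add_finrank_ker A.mulVecLin
  rw [Module.finrank_fintype_fun_eq_card, ← hker] at h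
  have h1 : Module.finrank L (LinearMap.range A.mulVecLin) = A.rank := rfl
  refine ⟨?_, fun hi => ?_⟩
  · have := A.rank_le_card_height
    rw [Fintype.card_fin] at this
    omega
  · have := LinearIndependent.rank_matrix (M := A) hi
    rw [Fintype.card_fin] at this
    omega

/-- The double orthogonal of a subspace is the subspace. -/
theorem mem_span_iff_forall_kerAt {R L q : Type*} [CommRing R] [Field L] [Fintype q] {s : ℕ}
    (e : R →+* L) (Q : Fin s → q → R) (v : q → L) :
    v ∈ Submodule.span L (Set.range fun j i => e (Q j i)) ↔
      ∀ u ∈ kerAt e (Set.range Q), ∑ i, u i * v i = 0 := by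
  classical
  constructor
  · intro hv u hu
    induction hv using Submodule.span_induction with
    | mem x hx =>
      obtain ⟨j, rfl⟩ := hx
      rw [← hu (Q j) ⟨j, rfl⟩]
      exact Finset.sum_congr rfl fun i _ => mul_comm _ _
    | zero => simp
    | add x y _ _ hx hy => simp [mul_add, Finset.sum_add_distrib, hx, hy]
    | smul t x _ hx =>
      have : ∑ i, u i * (t • x) i = t * ∑ i, u i * x i := by
        simp only [Finset.mul_sum, Pi.smul_apply, smul_eq_mul]
        exact Finset.sum_congr rfl fun i _ => mul_left_comm _ _ _
      rw [this, hx, mul_zero]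
  · intro h
    by_contra hcon
    obtain ⟨f, hf, hf'⟩ := Submodule.exists_le_ker_of_notMem hcon
    have hfv : ∀ w : q → L, f w = ∑ i, f (Pi.single i 1) * w i := fun w => by
      conv_lhs => rw [pi_eq_sum_univ' w, map_sum]
      simp [mul_comm]
    refine hf ?_
    rw [hfv]
    refine h _ ?_
    rintro _ ⟨j, rfl⟩
    have := hf' (Submodule.subset_span ⟨j, rfl⟩)
    rw [LinearMap.mem_ker, hfv] at this
    rw [← this]
    exact Finset.sum_congr rfl fun i _ => mul_comm _ _

/-- `H` is a local frame of the orthogonal complement of `Q`. The complement has constant dimension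
near `a₀`: it never falls below `card q - s`, its value at `a₀`, and semicontinuity forbids it to
jump. -/
theorem exists_orthogonal_frame {ι q : Type} [Fintype q] {s : ℕ}
    (Q : Fin s → q → MvPolynomial ι k) {a₀ : ι → k}
    (h₀ : LinearIndependent k fun j i => eval a₀ (Q j i)) :
    ∃ (r : ℕ) (H : Fin r → q → MvPolynomial ι k) (D : MvPolynomial ι k), eval a₀ D ≠ 0 ∧
      ∀ a : ι → k, eval a D ≠ 0 → ∀ v : q → k,
        v ∈ Submodule.span k (Set.range fun j i => eval a (Q j i)) ↔
          ∀ l, ∑ i, eval a (H l i) * v i = 0 := by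
  obtain ⟨H, D, hD, hH⟩ := exists_frame_eval (Set.range Q) a₀ rfl
  obtain ⟨D', hD', hle⟩ := exists_finrank_kerAt_le (Set.range Q) a₀
  refine ⟨_, H, D * D', by simp [hD, hD'], fun a ha v => ?_⟩
  rw [map_mul, mul_ne_zero_iff] at ha
  obtain ⟨-, -, h⟩ := hH a ha.1
  have h1 := (card_le_finrank_kerAt_add (eval a) Q).1
  have h2 := (card_le_finrank_kerAt_add (eval a₀) Q).2 h₀
  have h3 := h (le_antisymm (hle a ha.2) (by omega))
  rw [mem_span_iff_forall_kerAt, ← h3]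
  constructor
  · exact fun hv l => hv _ (Submodule.subset_span ⟨l, rfl⟩)
  · intro hv u hu
    induction hu using Submodule.span_induction with
    | mem x hx =>
      obtain ⟨l, rfl⟩ := hx
      exact hv l
    | zero => simp
    | add x y _ _ hx hy => simp [add_mul, Finset.sum_add_distrib, hx, hy]
    | smul t x _ hx => simp [mul_assoc, ← Finset.mul_sum, hx]

end Duality

/-! ### Tangent spaces of subvarieties of a Grassmannian in coordinates -/

section GrassTangent

variable {k : Type*} [Field k] {d N : ℕ}

/-- The basis given by a frame. -/
def frameBasis {a : Fin d × Fin (N + 1) → k} {L : Grass k d N} (ha : IsRep a L) :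
    Module.Basis (Fin d) k L.1 :=
  have h : LinearIndependent k fun i => (⟨row a i, row_mem ha i⟩ : L.1) :=
    LinearIndependent.of_comp L.1.subtype (linearIndependent_row ha)
  Module.Basis.mk h (h.span_eq_top_of_card_eq_finrank' (by rw [Fintype.card_fin, L.2])).ge

theorem frameBasis_apply {a : Fin d × Fin (N + 1) → k} {L : Grass k d N} (ha : IsRep a L)
    (i : Fin d) : frameBasis ha i = ⟨row a i, row_mem ha i⟩ := by
  simp [frameBasis]

/-- The homomorphism that corresponds to a tangent vector at a frame. -/
def tangentHom {a : Fin d × Fin (N + 1) → k} {L : Grass k d N} (ha : IsRep a L) :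
    (Fin d × Fin (N + 1) → k) →ₗ[k] (L.1 →ₗ[k] ((Fin (N + 1) → k) ⧸ L.1)) :=
  ((frameBasis ha).constr k).toLinearMap ∘ₗ LinearMap.pi fun i => L.1.mkQ ∘ₗ rowₗ k i

theorem tangentHom_row {a : Fin d × Fin (N + 1) → k} {L : Grass k d N} (ha : IsRep a L)
    (b : Fin d × Fin (N + 1) → k) (i : Fin d) (h : row a i ∈ L.1) :
    tangentHom ha b ⟨row a i, h⟩ = L.1.mkQ (row b i) := by
  have := (frameBasis ha).constr_basis k (fun i => L.1.mkQ (row b i)) i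
  rw [frameBasis_apply] at this
  exact this

theorem sum_row_mem {a : Fin d × Fin (N + 1) → k} {L : Grass k d N} (ha : IsRep a L)
    (t : Fin d → k) : ∑ i, t i • row a i ∈ L.1 :=
  Submodule.sum_mem _ fun i _ => Submodule.smul_mem _ _ (row_mem ha i)

theorem exists_sum_row_eq {a : Fin d × Fin (N + 1) → k} {L : Grass k d N} (ha : IsRep a L)
    {v : Fin (N + 1) → k} (hv : v ∈ L.1) : ∃ t : Fin d → k, ∑ i, t i • row a i = v := by
  rwa [← isRep_grass_iff.1 ha, Submodule.mem_span_range_iff_exists_fun] at hv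

theorem tangentHom_sum_row {a : Fin d × Fin (N + 1) → k} {L : Grass k d N} (ha : IsRep a L)
    (b : Fin d × Fin (N + 1) → k) (t : Fin d → k) :
    tangentHom ha b ⟨∑ i, t i • row a i, sum_row_mem ha t⟩ = L.1.mkQ (∑ i, t i • row b i) := by
  have : (⟨∑ i, t i • row a i, sum_row_mem ha t⟩ : L.1) =
      ∑ i, t i • (⟨row a i, row_mem ha i⟩ : L.1) := by
    ext1
    simp
  rw [this, map_sum, map_sum]
  refine Finset.sum_congr rfl fun i _ => ?_
  rw [map_smul, map_smul, tangentHom_row]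

theorem ker_tangentHom {a : Fin d × Fin (N + 1) → k} {L : Grass k d N} (ha : IsRep a L) :
    LinearMap.ker (tangentHom ha) = rowsIn L.1 d := by
  ext b
  rw [LinearMap.mem_ker, mem_rowsIn]
  constructor
  · intro h i
    have := tangentHom_row ha b i (row_mem ha i)
    rw [h, LinearMap.zero_apply] at this
    exact (Submodule.Quotient.mk_eq_zero _).1 this.symm
  · intro h
    refine (frameBasis ha).ext fun i => ?_
    rw [frameBasis_apply, tangentHom_row, LinearMap.zero_apply]
    exact (Submodule.Quotient.mk_eq_zero _).2 (h i)

/-- The definition quantifies over all frames of `L`, but these differ by invertible matrices, which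
preserve the tangent spaces of the cone; hence one frame suffices. -/
theorem grassTangent_eq (Y : Set (Grass k d N)) {a : Fin d × Fin (N + 1) → k} {L : Grass k d N}
    (ha : IsRep a L) : grassTangent Y L = (coneTangent Y a).map (tangentHom ha) := by
  ext φ
  rw [Submodule.mem_map]
  constructor
  · intro h
    obtain ⟨b, hb, hφ⟩ := h a ha
    refine ⟨b, hb, (frameBasis ha).ext fun i => ?_⟩
    rw [frameBasis_apply, tangentHom_row, hφ]
  · rintro ⟨b, hb, rfl⟩ a' ha'
    obtain ⟨g, g', hg, -, rfl⟩ := exists_rowAct_of_isRep ha ha'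
    refine ⟨rowAct g b, map_mem_coneTangent Y (fun m c hc => isRep_rowAct hg hc) hb, fun i h => ?_⟩
    simp only [row_rowAct]
    exact tangentHom_sum_row ha b _

variable [IsAlgClosed k]

theorem finrank_grassTangent_add {Y : Set (Grass k d N)} {a : Fin d × Fin (N + 1) → k}
    {L : Grass k d N} (hL : L ∈ Y) (ha : IsRep a L) :
    Module.finrank k (grassTangent Y L) + d * d = Module.finrank k (coneTangent Y a) := by
  have : Infinite k := IsAlgClosed.instInfinite
  have h : coneTangent Y a ⊓ rowsIn L.1 d = rowsIn L.1 d :=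
    inf_eq_right.2 (fibre_le_coneTangent hL ha)
  rw [grassTangent_eq Y ha, ← finrank_map_add (tangentHom ha) (coneTangent Y a), ker_tangentHom, h,
    finrank_rowsIn, L.2]

theorem coneDim_eq_of_zdim {Y : Set (Grass k d N)} (hY : IsProjVariety k Y) {r : ℕ} :
    zdim k Y = r ↔ coneDim k Y = r + d * d := by
  have : Infinite k := IsAlgClosed.instInfinite
  have h := fdim_le_coneDim (k := k) hY.irreducible.1
  rw [fdim_grass] at h
  rw [zdim_eq_coneDim_sub hY, fdim_grass]
  norm_cast
  omega

theorem isSmoothPt_iff {Y : Set (Grass k d N)} (hY : IsProjVariety k Y)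
    {a : Fin d × Fin (N + 1) → k} {L : Grass k d N} (ha : IsRep a L) :
    IsSmoothPt Y L ↔ L ∈ Y ∧ Module.finrank k (coneTangent Y a) = coneDim k Y := by
  refine and_congr_right fun hL => ?_
  rw [eq_comm, coneDim_eq_of_zdim hY, finrank_grassTangent_add hL ha, eq_comm]

theorem mem_kerPhi_iff {Y : Set (Grass k d N)} {L : Grass k d N} {v : Fin (N + 1) → k}
    (hv : v ∈ L.1) : v ∈ kerPhi Y L ↔ ∀ φ ∈ grassTangent Y L, φ ⟨v, hv⟩ = 0 := by
  rw [kerPhi, Submodule.mem_map]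
  constructor
  · rintro ⟨x, hx, rfl⟩ φ hφ
    exact LinearMap.congr_fun (LinearMap.mem_ker.1 hx) ⟨φ, hφ⟩
  · intro h
    exact ⟨⟨v, hv⟩, LinearMap.ext fun φ => h φ.1 φ.2, rfl⟩

theorem kerPhi_le (Y : Set (Grass k d N)) (L : Grass k d N) : kerPhi Y L ≤ L.1 :=
  Submodule.map_subtype_le _ _

/-- The coordinate form of `ker Φ`: the vector with fixed coefficients `t` stays in `L` to first
order as the frame moves along `Y`. -/
theorem sum_row_mem_kerPhi {Y : Set (Grass k d N)} {a : Fin d × Fin (N + 1) → k} {L : Grass k d N}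
    (ha : IsRep a L) (t : Fin d → k) : ∑ i, t i • row a i ∈ kerPhi Y L ↔
      ∀ b ∈ coneTangent Y a, ∑ i, t i • row b i ∈ L.1 := by
  rw [mem_kerPhi_iff (sum_row_mem ha t), grassTangent_eq Y ha]
  simp only [Submodule.mem_map, forall_exists_index, and_imp, forall_apply_eq_imp_iff₂,
    tangentHom_sum_row, Submodule.mkQ_apply, Submodule.Quotient.mk_eq_zero]

end GrassTangent

/-! ### Local frames of the kernel of `Φ` -/

section KerPhi

variable {k : Type*} [Field k] [IsAlgClosed k] {d N : ℕ}

/-- Local equations of a plane, depending on the frame. -/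
theorem exists_normal_frame {a₀ : Fin d × Fin (N + 1) → k} {L₀ : Grass k d N}
    (ha₀ : IsRep a₀ L₀) :
    ∃ (r : ℕ) (H : Fin r → Fin (N + 1) → MvPolynomial (Fin d × Fin (N + 1)) k)
      (D : MvPolynomial (Fin d × Fin (N + 1)) k), eval a₀ D ≠ 0 ∧
      ∀ (a : Fin d × Fin (N + 1) → k) (L : Grass k d N), IsRep a L → eval a D ≠ 0 →
        ∀ v, v ∈ L.1 ↔ ∀ l, ∑ p, eval a (H l p) * v p = 0 := by
  have h₀ : LinearIndependent k fun (j : Fin d) (p : Fin (N + 1)) =>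
      eval a₀ (X (j, p) : MvPolynomial (Fin d × Fin (N + 1)) k) := by
    simp only [eval_X]
    exact linearIndependent_row ha₀
  obtain ⟨r, H, D, hD, h⟩ := exists_orthogonal_frame _ h₀
  refine ⟨r, H, D, hD, fun a L ha haD v => ?_⟩
  rw [← h a haD v, ← isRep_grass_iff.1 ha]
  simp only [eval_X]
  rfl

/-- The conditions on the coefficients `t` pair the local equations of the plane with a local frame
of the tangent space of `Y`. That frame spans only where the tangent dimension is the one at `a₀`.
-/
theorem exists_kerPhi_eqs {Y : Set (Grass k d N)} {a₀ : Fin d × Fin (N + 1) → k} {L₀ : Grass k d N}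
    (ha₀ : IsRep a₀ L₀) :
    ∃ (D : MvPolynomial (Fin d × Fin (N + 1)) k)
      (𝓔 : Set (Fin d → MvPolynomial (Fin d × Fin (N + 1)) k)), eval a₀ D ≠ 0 ∧
      ∀ (a : Fin d × Fin (N + 1) → k) (L : Grass k d N), IsRep a L → eval a D ≠ 0 →
        Module.finrank k (coneTangent Y a) = Module.finrank k (coneTangent Y a₀) →
        ∀ t : Fin d → k, t ∈ kerAt (eval a) 𝓔 ↔ ∑ i, t i • row a i ∈ kerPhi Y L := by
  obtain ⟨r, H, D, hD, hH⟩ := exists_normal_frame ha₀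
  obtain ⟨B, D', hD', hB⟩ := exists_frame_eval (tangentEqs (k := k) Y) a₀ rfl
  refine ⟨D * D', Set.range fun (p : Fin r × _) i => ∑ j, H p.1 j * B p.2 (i, j), by simp [hD, hD'],
    fun a L ha h hs t => ?_⟩
  rw [map_mul, mul_ne_zero_iff] at h
  obtain ⟨-, -, hB⟩ := hB a h.2
  rw [coneTangent_eq_kerAt, coneTangent_eq_kerAt] at hs
  have key : ∀ (l : Fin r) (b : Fin d × Fin (N + 1) → k),
      ∑ p, eval a (H l p) * (∑ i, t i • row b i) p =
        ∑ i, (∑ j, eval a (H l j) * b (i, j)) * t i := fun l b => by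
    simp only [Finset.sum_apply, Pi.smul_apply, smul_eq_mul, Finset.mul_sum, Finset.sum_mul]
    rw [Finset.sum_comm]
    refine Finset.sum_congr rfl fun i _ => Finset.sum_congr rfl fun j _ => ?_
    rw [row]
    ring
  rw [sum_row_mem_kerPhi ha, coneTangent_eq_kerAt, ← hB hs, mem_kerAt]
  constructor
  · intro ht b hb
    refine (hH a L ha h.1 _).2 fun l => ?_
    rw [key]
    induction hb using Submodule.span_induction with
    | mem x hx =>
      obtain ⟨m, rfl⟩ := hx
      have := ht _ ⟨(l, m), rfl⟩
      simpa using this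
    | zero => simp
    | add x y _ _ hx hy =>
      simp only [Pi.add_apply, mul_add, add_mul, Finset.sum_add_distrib, hx, hy, add_zero]
    | smul s x _ hx =>
      have : ∑ i, (∑ j, eval a (H l j) * (s • x) (i, j)) * t i =
          s * ∑ i, (∑ j, eval a (H l j) * x (i, j)) * t i := by
        simp only [Finset.mul_sum, Finset.sum_mul, Pi.smul_apply, smul_eq_mul]
        refine Finset.sum_congr rfl fun i _ => Finset.sum_congr rfl fun j _ => by ring
      rw [this, hx, mul_zero]
  · rintro ht _ ⟨⟨l, m⟩, rfl⟩
    have := (hH a L ha h.1 _).1 (ht _ (Submodule.subset_span ⟨m, rfl⟩)) l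
    rw [key] at this
    simpa using this

theorem finrank_eq_of_mem_iff {a : Fin d × Fin (N + 1) → k} {L : Grass k d N} (ha : IsRep a L)
    {S : Submodule k (Fin d → k)} {E : Submodule k (Fin (N + 1) → k)} (hE : E ≤ L.1)
    (h : ∀ t : Fin d → k, t ∈ S ↔ ∑ i, t i • row a i ∈ E) :
    S.map (Fintype.linearCombination k (row a)) = E ∧
      Module.finrank k S = Module.finrank k E := by
  have h1 : S.map (Fintype.linearCombination k (row a)) = E := by
    ext v
    rw [Submodule.mem_map]
    constructor
    · rintro ⟨t, ht, rfl⟩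
      exact (h t).1 ht
    · intro hv
      obtain ⟨t, rfl⟩ := exists_sum_row_eq ha (hE hv)
      exact ⟨t, (h t).2 hv, rfl⟩
  refine ⟨h1, ?_⟩
  rw [← h1]
  exact (LinearEquiv.finrank_eq (Submodule.equivMapOfInjective _
    (linearIndependent_iff_injective_fintypeLinearCombination.1 (linearIndependent_row ha)) S))

/-- The infimum in `shrinkRank` is attained once its set is nonempty. Among the points of minimal
tangent dimension one takes `L₀` with smallest `ker Φ`; semicontinuity keeps this dimension on a
neighbourhood. -/
theorem exists_hasKerDimOn {Y : Set (Grass k d N)} (hY : IsProjVariety k Y) :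
    ∃ U : Set (Grass k d N), IsOpen[zariski k (Grass k d N)] U ∧ (U ∩ Y).Nonempty ∧
      HasKerDimOn Y U (shrinkRank Y) := by
  refine Nat.sInf_mem (s := {r | ∃ U : Set (Grass k d N), IsOpen[zariski k (Grass k d N)] U ∧
    (U ∩ Y).Nonempty ∧ HasKerDimOn Y U r}) ?_
  obtain ⟨hU, ⟨L₁, hL₁⟩, hU'⟩ := exists_isOpen_finrank_eq_coneDim (k := k) hY.irreducible.1
  set U := {m : Grass k d N | ∀ a : Fin d × Fin (N + 1) → k, IsRep a m → Module.finrank k (coneTangent Y a) ≤ coneDim k Y}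
  obtain ⟨L₀, hL₀, hmin⟩ : ∃ L₀ ∈ U ∩ Y, ∀ L ∈ U ∩ Y,
      Module.finrank k (kerPhi Y L₀) ≤ Module.finrank k (kerPhi Y L) := by
    obtain ⟨L₀, hL₀, h⟩ := Nat.sInf_mem (s := {r | ∃ L ∈ U ∩ Y, Module.finrank k (kerPhi Y L) = r})
      ⟨_, L₁, hL₁, rfl⟩
    exact ⟨L₀, hL₀, fun L hL => h ▸ Nat.sInf_le ⟨L, hL, rfl⟩⟩
  obtain ⟨a₀, ha₀⟩ := exists_rep k L₀
  obtain ⟨D, 𝓔, hD, h𝓔⟩ := exists_kerPhi_eqs (Y := Y) ha₀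
  obtain ⟨D', hD', hle⟩ := exists_finrank_kerAt_le 𝓔 a₀
  have hfin : ∀ (a) (L : Grass k d N), L ∈ U ∩ Y → IsRep a L → eval a D ≠ 0 →
      Module.finrank k (kerAt (eval a) 𝓔) = Module.finrank k (kerPhi Y L) := fun a L hL ha h =>
    (finrank_eq_of_mem_iff ha (kerPhi_le Y L)
      (h𝓔 a L ha h ((hU' L hL a ha).trans (hU' L₀ hL₀ a₀ ha₀).symm))).2
  have hinf : Infinite k := IsAlgClosed.instInfinite
  refine ⟨Module.finrank k (kerPhi Y L₀), U ∩ basicOpen _ (D * D'),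
    isOpen_inter hU (isOpen_basicOpen _), ⟨L₀, ⟨hL₀.1, a₀, ha₀, by simp [hD, hD']⟩, hL₀.2⟩, ?_⟩
  rintro L ⟨⟨hLU, a, ha, h⟩, hLY⟩
  rw [map_mul, mul_ne_zero_iff] at h
  refine ⟨(isSmoothPt_iff hY ha).2 ⟨hLY, hU' L ⟨hLU, hLY⟩ a ha⟩, le_antisymm ?_ (hmin L ⟨hLU, hLY⟩)⟩
  rw [← hfin a L ⟨hLU, hLY⟩ ha h.1, ← hfin a₀ L₀ hL₀ ha₀ hD]
  exact hle a h.2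

/-- The domain of definition of the shrinking map. -/
def shrinkDom (Y : Set (Grass k d N)) : Set (Grass k d N) :=
  {L | L ∈ Y ∧ ∃ U : Set (Grass k d N), IsOpen[zariski k (Grass k d N)] U ∧ L ∈ U ∧
    HasKerDimOn Y U (shrinkRank Y)}

theorem exists_isOpen_shrinkDom {Y : Set (Grass k d N)} (hY : IsProjVariety k Y) :
    ∃ U : Set (Grass k d N), IsOpen[zariski k (Grass k d N)] U ∧ (U ∩ Y).Nonempty ∧
      U ∩ Y ⊆ shrinkDom Y := by
  obtain ⟨U, hU, hne, h⟩ := exists_hasKerDimOn hY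
  exact ⟨U, hU, hne, fun L hL => ⟨hL.2, U, hU, hL.1, h⟩⟩

theorem finrank_kerPhi {Y : Set (Grass k d N)} {L : Grass k d N} (hL : L ∈ shrinkDom Y) :
    Module.finrank k (kerPhi Y L) = shrinkRank Y := by
  obtain ⟨hLY, U, -, hLU, h⟩ := hL
  exact (h L ⟨hLU, hLY⟩).2

theorem finrank_coneTangent_of_mem_shrinkDom {Y : Set (Grass k d N)} (hY : IsProjVariety k Y)
    {L : Grass k d N} (hL : L ∈ shrinkDom Y) {a : Fin d × Fin (N + 1) → k} (ha : IsRep a L) :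
    Module.finrank k (coneTangent Y a) = coneDim k Y := by
  obtain ⟨hLY, U, -, hLU, h⟩ := hL
  exact ((isSmoothPt_iff hY ha).1 (h L ⟨hLU, hLY⟩).1).2

theorem exists_kerPhi_frame {Y : Set (Grass k d N)} (hY : IsProjVariety k Y) {L₀ : Grass k d N}
    (hL₀ : L₀ ∈ shrinkDom Y) {a₀ : Fin d × Fin (N + 1) → k} (ha₀ : IsRep a₀ L₀) :
    ∃ (Q : Fin (shrinkRank Y) → Fin (N + 1) → MvPolynomial (Fin d × Fin (N + 1)) k)
      (D : MvPolynomial (Fin d × Fin (N + 1)) k), eval a₀ D ≠ 0 ∧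
      ∀ (a : Fin d × Fin (N + 1) → k), ∀ L ∈ Y, IsRep a L → eval a D ≠ 0 → L ∈ shrinkDom Y ∧
        LinearIndependent k (fun j p => eval a (Q j p)) ∧
        Submodule.span k (Set.range fun j p => eval a (Q j p)) = kerPhi Y L := by
  obtain ⟨hLY, U, hU, hLU, h⟩ := id hL₀
  obtain ⟨D₁, hD₁, hD₁'⟩ := exists_of_isOpen hU hLU ha₀
  obtain ⟨D₂, 𝓔, hD₂, h𝓔⟩ := exists_kerPhi_eqs (Y := Y) ha₀
  have hfin : ∀ (a), ∀ L ∈ shrinkDom Y, IsRep a L → eval a D₂ ≠ 0 →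
      (kerAt (eval a) 𝓔).map (Fintype.linearCombination k (row a)) = kerPhi Y L ∧
      Module.finrank k (kerAt (eval a) 𝓔) = shrinkRank Y := fun a L hL ha h => by
    rw [← finrank_kerPhi hL]
    exact finrank_eq_of_mem_iff ha (kerPhi_le Y L) (h𝓔 a L ha h
      ((finrank_coneTangent_of_mem_shrinkDom hY hL ha).trans
        (finrank_coneTangent_of_mem_shrinkDom hY hL₀ ha₀).symm))
  obtain ⟨Λ, D₃, hD₃, hΛ⟩ := exists_frame_eval 𝓔 a₀ (hfin a₀ L₀ hL₀ ha₀ hD₂).2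
  -- The coefficient vectors `Λ j` applied to the tautological frame.
  refine ⟨fun j p => ∑ i, Λ j i * X (i, p), D₁ * D₂ * D₃, by simp [hD₁, hD₂, hD₃],
    fun a L hL ha hD => ?_⟩
  rw [map_mul, map_mul, mul_ne_zero_iff, mul_ne_zero_iff] at hD
  have hLd : L ∈ shrinkDom Y := ⟨hL, U, hU, hD₁' L a ha hD.1.1, h⟩
  obtain ⟨h1, h2⟩ := hfin a L hLd ha hD.1.2
  obtain ⟨h3, -, h4⟩ := hΛ a hD.2
  have h5 : (fun (j : Fin (shrinkRank Y)) (p : Fin (N + 1)) =>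
      eval a (∑ i, Λ j i * X (i, p))) =
      Fintype.linearCombination k (row a) ∘ fun j i => eval a (Λ j i) := by
    ext j p
    simp [Fintype.linearCombination_apply, row]
  refine ⟨hLd, ?_, ?_⟩
  · rw [h5]
    exact h3.map' _ (LinearMap.ker_eq_bot.2
      (linearIndependent_iff_injective_fintypeLinearCombination.1 (linearIndependent_row ha)))
  · rw [h5, Set.range_comp, ← Submodule.map_span, h4 h2, h1]

end KerPhi

/-! ### Subsets of products -/

section Prod

variable {k : Type*} [Field k] {M M' : Type*} {ι κ : Type} [HomogCoord k M ι] [HomogCoord k M' κ]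
  [Fintype ι] [Fintype κ]

/-- A polynomial in the coordinates of the first factor, as a polynomial on the product. -/
abbrev pullInl (κ : Type) [Fintype κ] (F : MvPolynomial ι k) : MvPolynomial (ι ⊕ κ) k :=
  bind₁ (linPoly (inlₗ k ι κ)) F

/-- A polynomial in the coordinates of the second factor, as a polynomial on the product. -/
abbrev pullInr (ι : Type) [Fintype ι] (F : MvPolynomial κ k) : MvPolynomial (ι ⊕ κ) k :=
  bind₁ (linPoly (inrₗ k ι κ)) F

theorem eval_pullInl (F : MvPolynomial ι k) (e : ι ⊕ κ → k) :
    eval e (pullInl κ F) = eval (fun i => e (Sum.inl i)) F := eval_bind₁_linPoly _ _ _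

theorem eval_pullInr (F : MvPolynomial κ k) (e : ι ⊕ κ → k) :
    eval e (pullInr ι F) = eval (fun i => e (Sum.inr i)) F := eval_bind₁_linPoly _ _ _

theorem polyDiff_pullInl (F : MvPolynomial ι k) (e v : ι ⊕ κ → k) :
    polyDiff (pullInl κ F) e v = polyDiff F (fun i => e (Sum.inl i)) fun i => v (Sum.inl i) :=
  polyDiff_bind₁_linPoly _ _ _ _

theorem polyDiff_pullInr (F : MvPolynomial κ k) (e v : ι ⊕ κ → k) :
    polyDiff (pullInr ι F) e v = polyDiff F (fun i => e (Sum.inr i)) fun i => v (Sum.inr i) :=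
  polyDiff_bind₁_linPoly _ _ _ _

theorem isRep_sumElim_comp {e : ι ⊕ κ → k} {z : M × M'} (he : IsRep e z) :
    ∃ (a : ι → k) (c : κ → k), IsRep a z.1 ∧ IsRep c z.2 ∧ e = Sum.elim a c :=
  ⟨_, _, he.1, he.2, (Sum.elim_comp_inl_inr e).symm⟩

theorem inl_mem_coneTangent {Z : Set (M × M')} {Y : Set M} (h : ∀ z ∈ Z, z.1 ∈ Y) {e v : ι ⊕ κ → k}
    (hv : v ∈ coneTangent Z e) :
    (fun i => v (Sum.inl i)) ∈ coneTangent Y fun i => e (Sum.inl i) :=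
  mem_coneTangent.2 fun F hF => by
    rw [← polyDiff_pullInl]
    exact mem_coneTangent.1 hv _ (mem_coneIdeal.2 fun z hz c hc => by
      rw [eval_pullInl]
      exact mem_coneIdeal.1 hF _ (h z hz) _ hc.1)

theorem inr_mem_coneTangent {Z : Set (M × M')} {X : Set M'} (h : ∀ z ∈ Z, z.2 ∈ X) {e v : ι ⊕ κ → k}
    (hv : v ∈ coneTangent Z e) :
    (fun i => v (Sum.inr i)) ∈ coneTangent X fun i => e (Sum.inr i) :=
  mem_coneTangent.2 fun F hF => by
    rw [← polyDiff_pullInr]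
    exact mem_coneTangent.1 hv _ (mem_coneIdeal.2 fun z hz c hc => by
      rw [eval_pullInr]
      exact mem_coneIdeal.1 hF _ (h z hz) _ hc.2)

theorem inl_mem_coneTangent_sumElim {Z : Set (M × M')} {Y : Set M} (h : ∀ z ∈ Z, z.1 ∈ Y)
    {a : ι → k} {c : κ → k} {v : ι ⊕ κ → k} (hv : v ∈ coneTangent Z (Sum.elim a c)) :
    (fun i => v (Sum.inl i)) ∈ coneTangent Y a := by
  have := inl_mem_coneTangent h hv
  exact this

theorem inr_mem_coneTangent_sumElim {Z : Set (M × M')} {X : Set M'} (h : ∀ z ∈ Z, z.2 ∈ X)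
    {a : ι → k} {c : κ → k} {v : ι ⊕ κ → k} (hv : v ∈ coneTangent Z (Sum.elim a c)) :
    (fun i => v (Sum.inr i)) ∈ coneTangent X c := by
  have := inr_mem_coneTangent h hv
  exact this

variable [FibreCoord k M] [FibreCoord k M']

theorem fst_mem_of_mem_zclosure {Z : Set (M × M')} {Y : Set M} (hY : IsClosed[zariski k M] Y)
    (h : ∀ z ∈ Z, z.1 ∈ Y) {z : M × M'} (hz : z ∈ zclosure k Z) : z.1 ∈ Y := by
  obtain ⟨e, he⟩ := exists_rep k z
  refine mem_of_coneIdeal hY he.1 fun F hF => ?_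
  have := (mem_zclosure_iff he).1 hz (pullInl κ F) (mem_coneIdeal.2 fun w hw c hc => by
    rw [eval_pullInl]
    exact mem_coneIdeal.1 hF _ (h w hw) _ hc.1)
  rwa [eval_pullInl] at this

theorem snd_mem_of_mem_zclosure {Z : Set (M × M')} {X : Set M'} (hX : IsClosed[zariski k M'] X)
    (h : ∀ z ∈ Z, z.2 ∈ X) {z : M × M'} (hz : z ∈ zclosure k Z) : z.2 ∈ X := by
  obtain ⟨e, he⟩ := exists_rep k z
  refine mem_of_coneIdeal hX he.2 fun F hF => ?_
  have := (mem_zclosure_iff he).1 hz (pullInr ι F) (mem_coneIdeal.2 fun w hw c hc => by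
    rw [eval_pullInr]
    exact mem_coneIdeal.1 hF _ (h w hw) _ hc.2)
  rwa [eval_pullInr] at this

theorem isOpen_preimage_fst {U : Set M} (hU : IsOpen[zariski k M] U) :
    IsOpen[zariski k (M × M')] {z : M × M' | z.1 ∈ U} := by
  refine isOpen_of_forall k fun z hz => ?_
  obtain ⟨e, he⟩ := exists_rep k z
  obtain ⟨D, hD, h⟩ := exists_of_isOpen hU hz he.1
  refine ⟨e, he, pullInl κ D, by rwa [eval_pullInl], fun z' e' he' h' => ?_⟩
  rw [eval_pullInl] at h'
  exact h _ _ he'.1 h'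

theorem isOpen_preimage_snd {U : Set M'} (hU : IsOpen[zariski k M'] U) :
    IsOpen[zariski k (M × M')] {z : M × M' | z.2 ∈ U} := by
  refine isOpen_of_forall k fun z hz => ?_
  obtain ⟨e, he⟩ := exists_rep k z
  obtain ⟨D, hD, h⟩ := exists_of_isOpen hU hz he.2
  refine ⟨e, he, pullInr ι D, by rwa [eval_pullInr], fun z' e' he' h' => ?_⟩
  rw [eval_pullInr] at h'
  exact h _ _ he'.2 h'

/-- Rank and nullity of the first projection: `T` contains the vertical tangent vectors. -/
theorem finrank_coneTangent_prod_le (Z : Set (M × M')) (e : ι ⊕ κ → k) {S : Submodule k (ι → k)}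
    {T : Submodule k (κ → k)}
    (hS : ∀ v ∈ coneTangent Z e, (fun i => v (Sum.inl i)) ∈ S)
    (hT : ∀ v ∈ coneTangent Z e, (fun i => v (Sum.inl i)) = 0 → (fun j => v (Sum.inr j)) ∈ T) :
    Module.finrank k (coneTangent Z e) ≤ Module.finrank k S + Module.finrank k T := by
  rw [← finrank_map_add (inlₗ k ι κ)]
  refine add_le_add (Submodule.finrank_mono ?_) ?_
  · rintro _ ⟨v, hv, rfl⟩
    exact hS v hv
  · refine LinearMap.finrank_le_finrank_of_injective
      (f := ((inrₗ k ι κ).domRestrict _).codRestrict T fun v => hT v.1 v.2.1 v.2.2) ?_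
    intro v w hvw
    ext i
    rcases i with i | j
    · exact (congrFun v.2.2 i).trans (congrFun w.2.2 i).symm
    · exact congrFun (congrArg Subtype.val hvw) j

end Prod

/-! ### The pull-back of the universal family under the shrinking map -/

section Pullback

variable {k : Type*} [Field k] [IsAlgClosed k] {d N : ℕ} {Y : Set (Grass k d N)}

/-- The pairs of a plane at which the shrinking map is defined and a point of the shrunk plane. -/
def shrinkPairs (Y : Set (Grass k d N)) : Set (Grass k d N × PSpace k N) :=
  {z | z.1 ∈ shrinkDom Y ∧ z.2.submodule ≤ kerPhi Y z.1}

theorem shrinkPullback_eq (Y : Set (Grass k d N)) :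
    shrinkPullback Y = zclosure k (shrinkPairs Y) := by
  refine congrArg (zclosure k) (Set.ext fun z => ⟨?_, fun ⟨h, hz⟩ => ?_⟩)
  · rintro ⟨E, ⟨⟨h1, h2, h3⟩, rfl⟩, hE⟩
    exact ⟨⟨h1, h3⟩, hE⟩
  · exact ⟨_, ⟨⟨h.1, finrank_kerPhi h, h.2⟩, rfl⟩, hz⟩

theorem isClosed_shrinkPullback (Y : Set (Grass k d N)) :
    IsClosed[zariski k (Grass k d N × PSpace k N)] (shrinkPullback Y) := by
  rw [shrinkPullback_eq]
  exact isClosed_zclosure _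

theorem shrinkPairs_subset (Y : Set (Grass k d N)) : shrinkPairs Y ⊆ shrinkPullback Y := by
  rw [shrinkPullback_eq]
  exact subset_zclosure _

theorem fst_mem_of_mem_shrinkPullback (hY : IsProjVariety k Y) {z : Grass k d N × PSpace k N}
    (hz : z ∈ shrinkPullback Y) : z.1 ∈ Y := by
  rw [shrinkPullback_eq] at hz
  exact fst_mem_of_mem_zclosure hY.closed (fun _ hw => hw.1.1) hz

/-- Sections of the kernel of `Φ`. -/
theorem exists_section (hY : IsProjVariety k Y) {L₀ : Grass k d N} (hL₀ : L₀ ∈ shrinkDom Y)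
    {a₀ : Fin d × Fin (N + 1) → k} (ha₀ : IsRep a₀ L₀) {c₀ : Fin (N + 1) → k}
    (hc₀ : c₀ ∈ kerPhi Y L₀) :
    ∃ (σ : Fin (N + 1) → MvPolynomial (Fin d × Fin (N + 1)) k)
      (D : MvPolynomial (Fin d × Fin (N + 1)) k), eval a₀ D ≠ 0 ∧ (fun p => eval a₀ (σ p)) = c₀ ∧
      ∀ (a : Fin d × Fin (N + 1) → k), ∀ L ∈ Y, IsRep a L → eval a D ≠ 0 → L ∈ shrinkDom Y ∧
        (fun p => eval a (σ p)) ∈ kerPhi Y L := by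
  obtain ⟨Q, D, hD, h⟩ := exists_kerPhi_frame hY hL₀ ha₀
  rw [← (h a₀ L₀ hL₀.1 ha₀ hD).2.2, Submodule.mem_span_range_iff_exists_fun] at hc₀
  obtain ⟨t, ht⟩ := hc₀
  have hσ : ∀ a : Fin d × Fin (N + 1) → k, (fun p => eval a (∑ j, C (t j) * Q j p)) =
      ∑ j, t j • fun p => eval a (Q j p) := fun a => by
    ext p
    simp
  refine ⟨fun p => ∑ j, C (t j) * Q j p, D, hD, by rw [hσ, ht], fun a L hL ha hDa => ?_⟩
  obtain ⟨h1, -, h3⟩ := h a L hL ha hDa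
  refine ⟨h1, ?_⟩
  rw [hσ, ← h3]
  exact Submodule.sum_mem _ fun j _ => Submodule.smul_mem _ _ (Submodule.subset_span ⟨j, rfl⟩)

theorem exists_kerPhi_normal (hY : IsProjVariety k Y) {L₀ : Grass k d N} (hL₀ : L₀ ∈ shrinkDom Y)
    {a₀ : Fin d × Fin (N + 1) → k} (ha₀ : IsRep a₀ L₀) :
    ∃ (r : ℕ) (H : Fin r → Fin (N + 1) → MvPolynomial (Fin d × Fin (N + 1)) k)
      (D : MvPolynomial (Fin d × Fin (N + 1)) k), eval a₀ D ≠ 0 ∧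
      ∀ (a : Fin d × Fin (N + 1) → k), ∀ L ∈ Y, IsRep a L → eval a D ≠ 0 → L ∈ shrinkDom Y ∧
        ∀ v, v ∈ kerPhi Y L ↔ ∀ l, ∑ p, eval a (H l p) * v p = 0 := by
  obtain ⟨Q, D, hD, h⟩ := exists_kerPhi_frame hY hL₀ ha₀
  obtain ⟨r, H, D', hD', h'⟩ := exists_orthogonal_frame Q (h a₀ L₀ hL₀.1 ha₀ hD).2.1
  refine ⟨r, H, D * D', by simp [hD, hD'], fun a L hL ha hDa => ?_⟩
  rw [map_mul, mul_ne_zero_iff] at hDa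
  obtain ⟨h1, -, h3⟩ := h a L hL ha hDa.1
  exact ⟨h1, fun v => by rw [← h3, h' a hDa.2]⟩

/-- The pairing of a covector depending on the plane with the point. -/
def pairing (H : Fin (N + 1) → MvPolynomial (Fin d × Fin (N + 1)) k) :
    MvPolynomial ((Fin d × Fin (N + 1)) ⊕ Fin (N + 1)) k :=
  ∑ p, pullInl (Fin (N + 1)) (H p) * X (Sum.inr p)

theorem eval_pairing (H : Fin (N + 1) → MvPolynomial (Fin d × Fin (N + 1)) k)
    (e : (Fin d × Fin (N + 1)) ⊕ Fin (N + 1) → k) :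
    eval e (pairing H) = ∑ p, eval (fun i => e (Sum.inl i)) (H p) * e (Sum.inr p) := by
  simp only [pairing, map_sum, map_mul, eval_pullInl, eval_X]

theorem polyDiff_pairing_eq (H : Fin (N + 1) → MvPolynomial (Fin d × Fin (N + 1)) k)
    (e v : (Fin d × Fin (N + 1)) ⊕ Fin (N + 1) → k) :
    polyDiff (pairing H) e v = ∑ p, (eval (fun i => e (Sum.inl i)) (H p) * v (Sum.inr p) +
      polyDiff (H p) (fun i => e (Sum.inl i)) (fun i => v (Sum.inl i)) * e (Sum.inr p)) := by
  rw [pairing, polyDiff_sum]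
  refine Finset.sum_congr rfl fun p _ => ?_
  rw [polyDiff_mul, polyDiff_X, eval_pullInl, eval_X, polyDiff_pullInl]
  ring

/-- Taking the closure adds nothing over the domain of the shrinking map: there `ker Φ` has local
equations, whose pairings with the point, multiplied by `D`, vanish on all the pairs. -/
theorem mem_shrinkPullback_iff (hY : IsProjVariety k Y) {z : Grass k d N × PSpace k N}
    (hL : z.1 ∈ shrinkDom Y) : z ∈ shrinkPullback Y ↔ z.2.submodule ≤ kerPhi Y z.1 := by
  refine ⟨fun hz => ?_, fun h => shrinkPairs_subset Y ⟨hL, h⟩⟩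
  obtain ⟨e, he⟩ := exists_rep k z
  obtain ⟨r, H, D, hD, h⟩ := exists_kerPhi_normal hY hL he.1
  rw [submodule_le_iff he.2, (h _ _ hL.1 he.1 hD).2]
  intro l
  rw [shrinkPullback_eq] at hz
  have := (mem_zclosure_iff he).1 hz (pullInl _ D * pairing (H l))
    (mem_coneIdeal.2 fun w hw c hc => by
      rw [map_mul, eval_pullInl, eval_pairing]
      by_cases h0 : eval (fun i => c (Sum.inl i)) D = 0
      · rw [h0, zero_mul]
      · rw [((h _ _ hw.1.1 hc.1 h0).2 _).1 ((submodule_le_iff hc.2 _).1 hw.2) l, mul_zero])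
  rw [map_mul, eval_pullInl, eval_pairing] at this
  exact (mul_eq_zero.1 this).resolve_left hD

theorem eval_bind₁_section (σ : Fin (N + 1) → MvPolynomial (Fin d × Fin (N + 1)) k)
    (F : MvPolynomial ((Fin d × Fin (N + 1)) ⊕ Fin (N + 1)) k) (a : Fin d × Fin (N + 1) → k) :
    eval a (bind₁ (Sum.elim X σ) F) = eval (Sum.elim a fun p => eval a (σ p)) F := by
  rw [eval_bind₁]
  congr 2
  ext i
  rcases i with i | i <;> simp

/-- The set is a projective bundle over an open part of `Y`. A nonvanishing condition at one pair
spreads along a section of `ker Φ` to an open condition on `Y`; over a plane that satisfies two of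
these, the line between the two sections contains a point good for both. -/
theorem isIrreducible_shrinkPairs (hY : IsProjVariety k Y) (hne : (shrinkPairs Y).Nonempty) :
    @IsIrreducible _ (zariski k (Grass k d N × PSpace k N)) (shrinkPairs Y) := by
  have : Infinite k := IsAlgClosed.instInfinite
  have hprime := isPrime_coneIdeal (k := k) hY.irreducible
  refine isIrreducible_of_isPrime (k := k) hne ⟨?_, fun {F G} hFG => ?_⟩
  · obtain ⟨z, hz⟩ := hne
    obtain ⟨e, he⟩ := exists_rep k z
    intro h
    have := mem_coneIdeal.1 ((Ideal.eq_top_iff_one _).1 h) z hz e he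
    simp at this
  by_contra! hcon
  have key : ∀ F : MvPolynomial ((Fin d × Fin (N + 1)) ⊕ Fin (N + 1)) k,
      F ∉ coneIdeal k (shrinkPairs Y) →
      ∃ (σ : Fin (N + 1) → MvPolynomial (Fin d × Fin (N + 1)) k)
        (D : MvPolynomial (Fin d × Fin (N + 1)) k), D ∉ coneIdeal k Y ∧
        ∀ (a : Fin d × Fin (N + 1) → k), ∀ L ∈ Y, IsRep a L → eval a D ≠ 0 → L ∈ shrinkDom Y ∧
          (fun p => eval a (σ p)) ∈ kerPhi Y L ∧ (fun p => eval a (σ p)) ≠ 0 ∧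
          eval (Sum.elim a fun p => eval a (σ p)) F ≠ 0 := by
    intro F hF
    obtain ⟨z, hz, e, he, hFe⟩ := notMem_coneIdeal.1 hF
    obtain ⟨a₀, c₀, ha₀, hc₀, rfl⟩ := isRep_sumElim_comp he
    obtain ⟨σ, D, hD, hσ, h⟩ := exists_section hY hz.1 ha₀ ((submodule_le_iff hc₀ _).1 hz.2)
    obtain ⟨p, hp⟩ := Function.ne_iff.1 (isRep_pspace_iff.1 hc₀).1
    -- The factor `σ p` keeps the section nonzero, so that it represents a point.
    refine ⟨σ, D * σ p * bind₁ (Sum.elim X σ) F, fun hmem => ?_, fun a L hL ha hDa => ?_⟩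
    · have := mem_coneIdeal.1 hmem z.1 hz.1.1 a₀ ha₀
      rw [map_mul, map_mul, eval_bind₁_section, hσ, show eval a₀ (σ p) = c₀ p from congrFun hσ p]
        at this
      simp only [mul_eq_zero, hD, hFe, or_false, false_or] at this
      exact hp this
    · rw [map_mul, map_mul, mul_ne_zero_iff, mul_ne_zero_iff, eval_bind₁_section] at hDa
      obtain ⟨h1, h2⟩ := h a L hL ha hDa.1.1
      exact ⟨h1, h2, fun h0 => hDa.1.2 (congrFun h0 p), hDa.2⟩
  obtain ⟨σ, D, hD, h⟩ := key F hcon.1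
  obtain ⟨τ, D', hD', h'⟩ := key G hcon.2
  have hDD : D * D' ∉ coneIdeal k Y := fun hmem => (hprime.mem_or_mem hmem).elim hD hD'
  obtain ⟨L, hL, a, ha, hDa⟩ := notMem_coneIdeal.1 hDD
  rw [map_mul, mul_ne_zero_iff] at hDa
  obtain ⟨hLd, h1, h10, h2⟩ := h a L hL ha hDa.1
  obtain ⟨-, h3, -, h4⟩ := h' a L hL ha hDa.2
  obtain ⟨p, hp⟩ := Function.ne_iff.1 h10
  have hev : ∀ (F : MvPolynomial ((Fin d × Fin (N + 1)) ⊕ Fin (N + 1)) k) (c : Fin (N + 1) → k),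
      eval c (bind₁ (Sum.elim (fun i => C (a i)) X) F) = eval (Sum.elim a c) F := fun F c => by
    rw [eval_bind₁]
    congr 2
    ext i
    rcases i with i | i <;> simp
  obtain ⟨t, ht1, ht2⟩ := exists_line_eval_ne_zero
    (F := X p * bind₁ (Sum.elim (fun i => C (a i)) X) F)
    (G := bind₁ (Sum.elim (fun i => C (a i)) X) G)
    (a := fun p => eval a (σ p)) (b := fun p => eval a (τ p))
    (by rw [map_mul, hev, eval_X]; exact mul_ne_zero hp h2) (by rw [hev]; exact h4)
  rw [map_mul, hev, mul_ne_zero_iff, eval_X] at ht1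
  rw [hev] at ht2
  set c := (fun p => eval a (σ p)) + t • ((fun p => eval a (τ p)) - fun p => eval a (σ p)) with hc
  have hc0 : c ≠ 0 := fun h0 => ht1.1 (congrFun h0 p)
  have hcE : c ∈ kerPhi Y L := add_mem h1 (Submodule.smul_mem _ _ (sub_mem h3 h1))
  have hcx : IsRep c (Projectivization.mk k c hc0 : PSpace k N) := ⟨hc0, rfl⟩
  have := mem_coneIdeal.1 hFG (L, Projectivization.mk k c hc0)
    ⟨hLd, (submodule_le_iff hcx _).2 hcE⟩ _ (isRep_sumElim ha hcx)
  rw [map_mul] at this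
  exact (mul_ne_zero ht1.2 ht2) this

theorem shrinkPairs_nonempty (hne : (shrinkPullback Y).Nonempty) : (shrinkPairs Y).Nonempty := by
  by_contra h
  rw [Set.not_nonempty_iff_eq_empty] at h
  rw [shrinkPullback_eq, h, zclosure, @closure_empty _ (zariski k _)] at hne
  exact Set.not_nonempty_empty hne

theorem isProjVariety_shrinkPullback (hY : IsProjVariety k Y) (hne : (shrinkPullback Y).Nonempty) :
    IsProjVariety k (shrinkPullback Y) := by
  rw [shrinkPullback_eq]
  exact isProjVariety_zclosure (isIrreducible_shrinkPairs hY (shrinkPairs_nonempty hne))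

variable {L : Grass k d N} {x : PSpace k N} {a : Fin d × Fin (N + 1) → k} {c : Fin (N + 1) → k}
  {v : (Fin d × Fin (N + 1)) ⊕ Fin (N + 1) → k}

/-- Let `b` and `u` be the two components of `v`, and `c = Σ t_i a_i`. Differentiating `⟨H(a), c⟩ =
0` on the pull-back gives `⟨H, u⟩ + ⟨dH(b), c⟩ = 0`. Differentiating `⟨H(a), a_i⟩ = 0` along `Y`
turns the second term into `-⟨H, Σ t_i b_i⟩`, which is zero because `c` lies in `ker Φ`. -/
theorem inr_mem_of_mem_coneTangent_shrinkPullback (hY : IsProjVariety k Y) (hL : L ∈ shrinkDom Y)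
    (hz : (L, x) ∈ shrinkPullback Y) (ha : IsRep a L) (hc : IsRep c x)
    (hv : v ∈ coneTangent (shrinkPullback Y) (Sum.elim a c)) : (fun p => v (Sum.inr p)) ∈ L.1 := by
  have hinf : Infinite k := IsAlgClosed.instInfinite
  have hcE := (submodule_le_iff hc _).1 ((mem_shrinkPullback_iff hY hL).1 hz)
  obtain ⟨r, H, D, hD, hH⟩ := exists_normal_frame ha
  obtain ⟨_, _, D', hD', hY'⟩ := exists_kerPhi_normal hY hL ha
  have hDD : eval a (D * D') ≠ 0 := by simp [hD, hD']
  have hδa : (fun i => v (Sum.inl i)) ∈ coneTangent Y a :=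
    inl_mem_coneTangent_sumElim (fun z hz => fst_mem_of_mem_shrinkPullback hY hz) hv
  obtain ⟨t, rfl⟩ := exists_sum_row_eq ha (kerPhi_le Y L hcE)
  have hδ := (sum_row_mem_kerPhi ha t).1 hcE _ hδa
  rw [hH a L ha hD] at hδ ⊢
  intro l
  have h1 := polyDiff_eq_zero_of_local hz (isRep_sumElim ha hc) hv (F := pairing (H l))
    (D := pullInl _ (D * D')) (by rw [eval_pullInl]; exact hDD) fun z hz e he hDe => by
      rw [eval_pullInl, map_mul, mul_ne_zero_iff] at hDe
      have hz1 := fst_mem_of_mem_shrinkPullback hY hz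
      have hzd := (hY' _ _ hz1 he.1 hDe.2).1
      rw [eval_pairing]
      exact (hH _ _ he.1 hDe.1 _).1 (kerPhi_le Y _
        ((submodule_le_iff he.2 _).1 ((mem_shrinkPullback_iff hY hzd).1 hz))) l
  have h2 : ∀ i, polyDiff (∑ p, H l p * X (i, p)) a (fun i => v (Sum.inl i)) = 0 := fun i =>
    polyDiff_eq_zero_of_local hL.1 ha hδa hD fun L' hL' a' ha' hDa' => by
      have := (hH a' L' ha' hDa' _).1 (row_mem ha' i) l
      simpa [row] using this
  rw [polyDiff_pairing_eq, Finset.sum_add_distrib] at h1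
  simp only [polyDiff_sum, polyDiff_mul, polyDiff_X, eval_X] at h2
  have h3 := hδ l
  simp only [Finset.sum_apply, Pi.smul_apply, smul_eq_mul, Finset.mul_sum, Sum.elim_inl,
    Sum.elim_inr] at h1 h3 ⊢
  have h4 : ∑ p, ∑ i, polyDiff (H l p) a (fun i => v (Sum.inl i)) * (t i * row a i p) = 0 := by
    rw [Finset.sum_comm] at h3 ⊢
    have h5 : ∑ i, t i * ∑ p, (eval a (H l p) * v (Sum.inl (i, p)) +
        a (i, p) * polyDiff (H l p) a (fun i => v (Sum.inl i))) = 0 :=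
      Finset.sum_eq_zero fun i _ => by
        rw [← mul_zero (t i), ← h2 i]
    simp only [Finset.mul_sum, mul_add, Finset.sum_add_distrib] at h5
    rw [show ∑ i, ∑ p, t i * (eval a (H l p) * v (Sum.inl (i, p))) = 0 from by
      rw [← h3]
      exact Finset.sum_congr rfl fun i _ => Finset.sum_congr rfl fun p _ => by
        rw [row]; ring, zero_add] at h5
    rw [← h5]
    exact Finset.sum_congr rfl fun i _ => Finset.sum_congr rfl fun p _ => by rw [row]; ring
  rw [h4, add_zero] at h1
  exact h1

theorem inr_mem_kerPhi_of_mem_coneTangent_shrinkPullback (hY : IsProjVariety k Y)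
    (hL : L ∈ shrinkDom Y) (hz : (L, x) ∈ shrinkPullback Y) (ha : IsRep a L) (hc : IsRep c x)
    (hv : v ∈ coneTangent (shrinkPullback Y) (Sum.elim a c))
    (hv0 : (fun i => v (Sum.inl i)) = 0) : (fun p => v (Sum.inr p)) ∈ kerPhi Y L := by
  obtain ⟨r, H, D, hD, hH⟩ := exists_kerPhi_normal hY hL ha
  refine ((hH a L hL.1 ha hD).2 _).2 fun l => ?_
  have h1 := polyDiff_eq_zero_of_local hz (isRep_sumElim ha hc) hv (F := pairing (H l))
    (D := pullInl _ D) (by rw [eval_pullInl]; exact hD) fun z hz e he hDe => by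
      rw [eval_pullInl] at hDe
      obtain ⟨hzd, h⟩ := hH _ _ (fst_mem_of_mem_shrinkPullback hY hz) he.1 hDe
      rw [eval_pairing]
      exact (h _).1 ((submodule_le_iff he.2 _).1 ((mem_shrinkPullback_iff hY hzd).1 hz)) l
  rw [polyDiff_pairing_eq, hv0] at h1
  simpa using h1

theorem finrank_coneTangent_shrinkPullback_le (hY : IsProjVariety k Y) (hL : L ∈ shrinkDom Y)
    (hz : (L, x) ∈ shrinkPullback Y) (ha : IsRep a L) (hc : IsRep c x) :
    Module.finrank k (coneTangent (shrinkPullback Y) (Sum.elim a c)) ≤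
      coneDim k Y + shrinkRank Y := by
  rw [← finrank_coneTangent_of_mem_shrinkDom hY hL ha, ← finrank_kerPhi hL]
  exact finrank_coneTangent_prod_le _ _
    (fun v hv => inl_mem_coneTangent_sumElim (fun z hz => fst_mem_of_mem_shrinkPullback hY hz) hv)
    fun v hv => inr_mem_kerPhi_of_mem_coneTangent_shrinkPullback hY hL hz ha hc hv

/-- The lift is the derivative along `b` of a section of `ker Φ` through the given point. -/
theorem exists_sumElim_mem_coneTangent_shrinkPullback (hY : IsProjVariety k Y)
    (hL : L ∈ shrinkDom Y) (hz : (L, x) ∈ shrinkPullback Y) (ha : IsRep a L) (hc : IsRep c x)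
    {b : Fin d × Fin (N + 1) → k} (hb : b ∈ coneTangent Y a) :
    ∃ w, Sum.elim b w ∈ coneTangent (shrinkPullback Y) (Sum.elim a c) := by
  have hcE := (submodule_le_iff hc _).1 ((mem_shrinkPullback_iff hY hL).1 hz)
  obtain ⟨σ, D, hD, hσ, h⟩ := exists_section hY hL ha hcE
  obtain ⟨p, hp⟩ := Function.ne_iff.1 (isRep_pspace_iff.1 hc).1
  refine ⟨fun p => polyDiff (σ p) a b, mem_coneTangent.2 fun F hF => ?_⟩
  have h1 := polyDiff_eq_zero_of_local hL.1 ha hb (F := bind₁ (Sum.elim X σ) F) (D := D * σ p)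
    (by rw [map_mul, show eval a (σ p) = c p from congrFun hσ p]; exact mul_ne_zero hD hp)
    fun L' hL' a' ha' hDa => by
      rw [map_mul, mul_ne_zero_iff] at hDa
      obtain ⟨h1, h2⟩ := h a' L' hL' ha' hDa.1
      have h0 : (fun p => eval a' (σ p)) ≠ 0 := fun h0 => hDa.2 (congrFun h0 p)
      have hx' : IsRep (fun p => eval a' (σ p)) (Projectivization.mk k _ h0 : PSpace k N) :=
        ⟨h0, rfl⟩
      rw [eval_bind₁_section]
      exact mem_coneIdeal.1 hF (L', Projectivization.mk k _ h0)
        ((mem_shrinkPullback_iff hY h1).2 ((submodule_le_iff hx' _).2 h2)) _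
        (isRep_sumElim ha' hx')
  have e1 : (fun j => eval a ((Sum.elim X σ : _ → MvPolynomial (Fin d × Fin (N + 1)) k) j)) =
      Sum.elim a c := by
    ext i
    rcases i with i | i
    · simp
    · exact congrFun hσ i
  have e2 : (fun j => polyDiff ((Sum.elim X σ : _ → MvPolynomial (Fin d × Fin (N + 1)) k) j) a b) =
      Sum.elim b fun p => polyDiff (σ p) a b := by
    ext i
    rcases i with i | i <;> simp
  rw [polyDiff_bind₁, e1, e2] at h1
  exact h1

end Pullback

theorem inter_nonempty_of_zclosure {k : Type*} [Field k] {M : Type*} {ι : Type} [HomogCoord k M ι]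
    {U Z : Set M} (hU : IsOpen[zariski k M] U) (h : (U ∩ zclosure k Z).Nonempty) :
    (U ∩ Z).Nonempty := by
  let _ := zariski k M
  obtain ⟨x, hxU, hx⟩ := h
  exact mem_closure_iff.1 hx U hU hxU

theorem inter_inter_nonempty {k : Type*} [Field k] {M : Type*} {ι : Type} [HomogCoord k M ι]
    {U V Z : Set M} (hZ : @IsIrreducible M (zariski k M) Z) (hU : IsOpen[zariski k M] U)
    (hV : IsOpen[zariski k M] V) (h : (U ∩ Z).Nonempty) (h' : (V ∩ Z).Nonempty) :
    (U ∩ V ∩ Z).Nonempty := by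
  rw [Set.inter_comm] at h h' ⊢
  exact hZ.2 U V hU hV h h'

theorem finrank_map_mkQ_add {k V : Type*} [Field k] [AddCommGroup V] [Module k V]
    [FiniteDimensional k V] (S W : Submodule k V) :
    Module.finrank k (S.map W.mkQ) + Module.finrank k W =
      Module.finrank k (S ⊔ W : Submodule k V) := by
  rw [← finrank_map_add W.mkQ (S ⊔ W), Submodule.ker_mkQ, inf_eq_right.2 le_sup_right,
    Submodule.map_sup, Submodule.mkQ_map_self, sup_bot_eq]

/-! ### The Gauss map, its graph and the second fundamental form. -/

section Gauss

variable {k : Type*} [Field k] {N n : ℕ} {X : Set (PSpace k N)}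

theorem isRep_smul_grass {d : ℕ} {a : Fin d × Fin (N + 1) → k} {L : Grass k d N} (ha : IsRep a L)
    {t : k} (ht : t ≠ 0) : IsRep (t • a) L := by
  have h : rowAct (t • 1) a = t • a := ext_row fun i => by
    simp [row_rowAct, row_smul, Matrix.smul_apply, Matrix.one_apply]
  rw [← h]
  exact isRep_rowAct (h := t⁻¹ • 1) (by simp [ht]) ha

theorem coneTangent_smul_le (X : Set (PSpace k N)) (c : Fin (N + 1) → k) {t : k} (ht : t ≠ 0) :
    coneTangent X c ≤ coneTangent X (t • c) := fun v hv => by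
  have := map_mem_coneTangent X (g := t • LinearMap.id) (fun m c hc => isRep_smul hc ht) hv
  exact (Submodule.smul_mem_iff _ ht).1 this

theorem coneTangent_eq_embTangent (X : Set (PSpace k N)) {x : PSpace k N} {c : Fin (N + 1) → k}
    (hc : IsRep c x) : coneTangent X c = embTangent X x := by
  obtain ⟨t, ht, rfl⟩ := exists_eq_smul_of_isRep (isRep_rep x) hc
  refine le_antisymm ?_ (coneTangent_smul_le X _ ht)
  have := coneTangent_smul_le X (t • x.rep) (inv_ne_zero ht)
  rwa [inv_smul_smul₀ ht] at this

theorem mem_gaussMap_iff {x : PSpace k N} {L : Grass k (n + 1) N} {c : Fin (N + 1) → k}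
    (hc : IsRep c x) : L ∈ gaussMap n X x ↔ x ∈ X ∧ L.1 = coneTangent X c := by
  rw [coneTangent_eq_embTangent X hc]
  constructor
  · rintro ⟨h, rfl⟩
    exact ⟨h.1, rfl⟩
  · rintro ⟨h, h'⟩
    exact ⟨⟨h, h' ▸ L.2⟩, Subtype.ext h'.symm⟩

theorem exists_mem_gaussMap {x : PSpace k N} {c : Fin (N + 1) → k} (hx : x ∈ X)
    (hc : IsRep c x) (h : Module.finrank k (coneTangent X c) = n + 1) : ∃ L, L ∈ gaussMap n X x :=
  ⟨⟨coneTangent X c, h⟩, (mem_gaussMap_iff hc).2 ⟨hx, rfl⟩⟩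

/-- The graph of the Gauss map over the smooth locus. -/
def gaussPairs (n : ℕ) (X : Set (PSpace k N)) : Set (Grass k (n + 1) N × PSpace k N) :=
  {z | z.1 ∈ gaussMap n X z.2}

theorem gaussGraph_eq (n : ℕ) (X : Set (PSpace k N)) :
    gaussGraph n X = zclosure k (gaussPairs n X) := rfl

theorem mem_of_mem_gaussMap {x : PSpace k N} {L : Grass k (n + 1) N} (h : L ∈ gaussMap n X x) :
    x ∈ X := h.1.1

/-- `P` computes the Gauss map wherever `D` does not vanish. -/
def IsGaussFrame (n : ℕ) (X : Set (PSpace k N))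
    (P : Fin (n + 1) × Fin (N + 1) → MvPolynomial (Fin (N + 1)) k)
    (D : MvPolynomial (Fin (N + 1)) k) : Prop :=
  ∀ x ∈ X, ∀ c : Fin (N + 1) → k, IsRep c x → eval c D ≠ 0 →
    ∃ L ∈ gaussMap n X x, IsRep (fun j => eval c (P j)) L

theorem exists_isGaussFrame_of_isLocalExpr {x : PSpace k N} {c : Fin (N + 1) → k}
    (hc : IsRep c x) {P : Fin (n + 1) × Fin (N + 1) → MvPolynomial (Fin (N + 1)) k}
    (hP : IsLocalExpr X (gaussMap n X) x P) :
    ∃ D : MvPolynomial (Fin (N + 1)) k, eval c D ≠ 0 ∧ IsGaussFrame n X P D := by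
  obtain ⟨U, hU, hxU, h⟩ := hP
  obtain ⟨D, hD, hDU⟩ := exists_of_isOpen hU hxU hc
  refine ⟨D, hD, fun x' hx' c' hc' hD' => ?_⟩
  obtain ⟨L, hL, hL'⟩ := h x' ⟨hDU x' c' hc' hD', hx'⟩
  exact ⟨L, hL, hL' c' hc'⟩

variable [IsAlgClosed k]

theorem coneDim_eq_of_zdim_pspace (hX : IsProjVariety k X) :
    zdim k X = n ↔ coneDim k X = n + 1 := by
  have : Infinite k := IsAlgClosed.instInfinite
  have h : 1 ≤ coneDim k X := fdim_le_coneDim (k := k) hX.irreducible.1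
  have h1 : FibreCoord.fdim k (PSpace k N) (Fin (N + 1)) = 1 := rfl
  rw [zdim_eq_coneDim_sub hX, h1]
  norm_cast
  omega

theorem isOpen_smooth (n : ℕ) (X : Set (PSpace k N)) : IsOpen[zariski k (PSpace k N)]
    {x : PSpace k N | ∀ c : Fin (N + 1) → k, IsRep c x →
      Module.finrank k (coneTangent X c) ≤ n + 1} := isOpen_finrank_coneTangent_le X (n + 1)

theorem exists_mem_gaussMap_of_le (hX : coneDim k X = n + 1) {x : PSpace k N}
    (h : ∀ c : Fin (N + 1) → k, IsRep c x → Module.finrank k (coneTangent X c) ≤ n + 1)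
    (hx : x ∈ X) : ∃ L, L ∈ gaussMap n X x := by
  obtain ⟨c, hc⟩ := exists_rep k x
  exact exists_mem_gaussMap hx hc (le_antisymm (h c hc) (hX ▸ coneDim_le hx hc))

theorem finrank_of_mem_gaussMap {x : PSpace k N} {L : Grass k (n + 1) N} {c : Fin (N + 1) → k}
    (hc : IsRep c x) (hL : L ∈ gaussMap n X x) :
    Module.finrank k (coneTangent X c) = n + 1 := by
  rw [← ((mem_gaussMap_iff hc).1 hL).2]
  exact L.2

theorem smooth_nonempty (hX : IsProjVariety k X) (hd : coneDim k X = n + 1) :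
    ({x : PSpace k N | ∀ c : Fin (N + 1) → k, IsRep c x →
      Module.finrank k (coneTangent X c) ≤ n + 1} ∩ X).Nonempty := by
  have := (exists_isOpen_finrank_eq_coneDim (k := k) hX.irreducible.1).2.1
  rwa [hd] at this

theorem gaussPairs_nonempty (hX : IsProjVariety k X) (hd : coneDim k X = n + 1) :
    (gaussPairs n X).Nonempty := by
  obtain ⟨x, hx, hxX⟩ := smooth_nonempty hX hd
  obtain ⟨L, hL⟩ := exists_mem_gaussMap_of_le hd hx hxX
  exact ⟨(L, x), hL⟩

/-- The frame bounds the tangent dimension by `n + 1` near the point and `coneDim` bounds it from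
below, so nearby points of `X` are smooth and the frame spans. A constant matrix moves its value at
`c₀` to the prescribed frame. -/
theorem exists_isGaussFrame (hd : coneDim k X = n + 1) {x₀ : PSpace k N} {L₀ : Grass k (n + 1) N}
    (hL₀ : L₀ ∈ gaussMap n X x₀) {a₀ : Fin (n + 1) × Fin (N + 1) → k} (ha₀ : IsRep a₀ L₀)
    {c₀ : Fin (N + 1) → k} (hc₀ : IsRep c₀ x₀) :
    ∃ (P : Fin (n + 1) × Fin (N + 1) → MvPolynomial (Fin (N + 1)) k)
      (D : MvPolynomial (Fin (N + 1)) k), eval c₀ D ≠ 0 ∧ (fun j => eval c₀ (P j)) = a₀ ∧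
      IsGaussFrame n X P D := by
  have hs : Module.finrank k (kerAt (eval c₀) (tangentEqs (k := k) X)) = n + 1 := by
    rw [← coneTangent_eq_kerAt]
    exact finrank_of_mem_gaussMap hc₀ hL₀
  obtain ⟨Q, D, hD, h⟩ := exists_frame_eval (tangentEqs (k := k) X) c₀ hs
  have hQ : ∀ x ∈ X, ∀ c : Fin (N + 1) → k, IsRep c x → eval c D ≠ 0 →
      ∃ L ∈ gaussMap n X x, IsRep (ofRows fun i p => eval c (Q i p)) L := by
    intro x hx c hc hDc
    obtain ⟨h1, h2, h3⟩ := h c hDc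
    have h4 := Submodule.finrank_mono h2
    rw [finrank_span_eq_card h1, Fintype.card_fin, ← coneTangent_eq_kerAt] at h4
    have h5 : Module.finrank k (coneTangent X c) = n + 1 :=
      le_antisymm h4 (hd ▸ coneDim_le hx hc)
    rw [← coneTangent_eq_kerAt] at h3
    exact ⟨⟨_, h5⟩, (mem_gaussMap_iff hc).2 ⟨hx, rfl⟩, h3 h5⟩
  obtain ⟨L, hL, hLQ⟩ := hQ x₀ (mem_of_mem_gaussMap hL₀) c₀ hc₀ hD
  obtain rfl : L = L₀ := Part.mem_unique hL hL₀
  obtain ⟨g, g', hg, -, hga⟩ := exists_rowAct_of_isRep hLQ ha₀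
  have hev : ∀ c : Fin (N + 1) → k, (fun j : Fin (n + 1) × Fin (N + 1) =>
      eval c (∑ l, C (g j.1 l) * Q l j.2)) = rowAct g (ofRows fun i p => eval c (Q i p)) := by
    intro c
    ext ⟨i, p⟩
    change _ = row (rowAct g _) i p
    simp [row_rowAct]
  refine ⟨fun j => ∑ l, C (g j.1 l) * Q l j.2, D, hD, by rw [hev, hga], fun x hx c hc hDc => ?_⟩
  obtain ⟨L, hL, hLQ⟩ := hQ x hx c hc hDc
  refine ⟨L, hL, ?_⟩
  rw [hev]
  exact isRep_rowAct hg hLQ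

/-- A local expression must work for all homogeneous coordinates of nearby points, whereas a frame
works only where `D` is nonzero. So the frame is evaluated at the coordinates normalized by `c j =
1` and denominators are cleared. -/
theorem exists_isLocalExpr_gaussMap (hd : coneDim k X = n + 1) {x₀ : PSpace k N}
    {L₀ : Grass k (n + 1) N} (hL₀ : L₀ ∈ gaussMap n X x₀) :
    ∃ P : Fin (n + 1) × Fin (N + 1) → MvPolynomial (Fin (N + 1)) k,
      IsLocalExpr X (gaussMap n X) x₀ P := by
  obtain ⟨a₀, ha₀⟩ := exists_rep k L₀
  obtain ⟨j, hj⟩ := exists_rep_ne_zero x₀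
  have hc₀ : IsRep ((x₀.rep j)⁻¹ • x₀.rep) x₀ := isRep_smul (isRep_rep x₀) (inv_ne_zero hj)
  obtain ⟨P, D, hD, -, hP⟩ := exists_isGaussFrame hd hL₀ ha₀ hc₀
  have hom := fun F : MvPolynomial (Fin (N + 1)) k => exists_homogenize (MvPolynomial.X j) MvPolynomial.X F
  simp only [eval_X] at hom
  choose e G hG using hom
  have hsm : ∀ c : Fin (N + 1) → k, (fun p => (c j)⁻¹ * c p) = (c j)⁻¹ • c := fun c => rfl
  simp only [hsm] at hG
  have hnorm : ∀ {x : PSpace k N} {c c' : Fin (N + 1) → k}, IsRep c x → IsRep c' x → c j ≠ 0 →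
      c' j ≠ 0 ∧ (c' j)⁻¹ • c' = (c j)⁻¹ • c := by
    intro x c c' hc hc' h
    obtain ⟨t, ht, rfl⟩ := exists_eq_smul_of_isRep hc hc'
    refine ⟨mul_ne_zero ht h, ?_⟩
    rw [Pi.smul_apply, smul_smul, smul_eq_mul, mul_inv, mul_assoc, mul_comm, mul_assoc,
      mul_inv_cancel₀ ht, mul_one]
  -- A common exponent: the entries of a frame have to be rescaled by one and the same factor.
  let E := ∑ q, e (P q)
  have hE : ∀ q, e (P q) ≤ E := fun q => Finset.single_le_sum (f := fun q => e (P q))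
    (fun _ _ => Nat.zero_le _) (Finset.mem_univ q)
  refine ⟨fun q => G (P q) * MvPolynomial.X j ^ (E - e (P q)), basicOpen _ (MvPolynomial.X j * G D), isOpen_basicOpen _,
    ⟨x₀.rep, isRep_rep x₀, ?_⟩, ?_⟩
  · rw [map_mul, eval_X, hG D _ hj]
    exact mul_ne_zero hj (mul_ne_zero (pow_ne_zero _ hj) hD)
  · rintro x ⟨⟨c, hc, hcD⟩, hx⟩
    rw [map_mul, eval_X, mul_ne_zero_iff] at hcD
    have hcD2 := hcD.2
    rw [hG D c hcD.1] at hcD2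
    obtain ⟨L, hL, hLP⟩ := hP x hx _ (isRep_smul hc (inv_ne_zero hcD.1)) (right_ne_zero_of_mul hcD2)
    refine ⟨L, hL, fun c' hc' => ?_⟩
    obtain ⟨h1, h2⟩ := hnorm hc hc' hcD.1
    rw [← h2] at hLP
    have : (fun q => eval c' (G (P q) * MvPolynomial.X j ^ (E - e (P q)))) =
        (c' j) ^ E • fun q => eval ((c' j)⁻¹ • c') (P q) := by
      ext q
      rw [map_mul, hG _ _ h1, map_pow, eval_X, Pi.smul_apply, smul_eq_mul, mul_right_comm,
        ← pow_add, Nat.add_sub_cancel' (hE q)]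
    rw [this]
    exact isRep_smul_grass hLP (pow_ne_zero _ h1)

/-- Preimages of open sets under the Gauss map are open. -/
theorem exists_isOpen_gauss_preimage (hd : coneDim k X = n + 1) {x₀ : PSpace k N}
    {L₀ : Grass k (n + 1) N} (hL₀ : L₀ ∈ gaussMap n X x₀) {U : Set (Grass k (n + 1) N)}
    (hU : IsOpen[zariski k _] U) (hLU : L₀ ∈ U) : ∃ V : Set (PSpace k N),
      IsOpen[zariski k _] V ∧ x₀ ∈ V ∧ ∀ x ∈ V ∩ X, ∃ L ∈ gaussMap n X x, L ∈ U := by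
  obtain ⟨a₀, ha₀⟩ := exists_rep k L₀
  obtain ⟨c₀, hc₀⟩ := exists_rep k x₀
  obtain ⟨P, D, hD, hPa, hP⟩ := exists_isGaussFrame hd hL₀ ha₀ hc₀
  obtain ⟨D', hD', h⟩ := exists_of_isOpen hU hLU ha₀
  refine ⟨basicOpen _ (D * bind₁ P D'), isOpen_basicOpen _, ⟨c₀, hc₀, ?_⟩, ?_⟩
  · rw [map_mul, eval_bind₁, hPa]
    exact mul_ne_zero hD hD'
  · rintro x ⟨⟨c, hc, hcD⟩, hx⟩
    rw [map_mul, eval_bind₁, mul_ne_zero_iff] at hcD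
    obtain ⟨L, hL, hLP⟩ := hP x hx c hc hcD.1
    exact ⟨L, hL, h L _ hLP hcD.2⟩

theorem eval_bind₁_graph (P : Fin (n + 1) × Fin (N + 1) → MvPolynomial (Fin (N + 1)) k)
    (F : MvPolynomial ((Fin (n + 1) × Fin (N + 1)) ⊕ Fin (N + 1)) k) (c : Fin (N + 1) → k) :
    eval c (bind₁ (Sum.elim P MvPolynomial.X) F) = eval (Sum.elim (fun j => eval c (P j)) c) F := by
  rw [eval_bind₁]
  congr 2
  ext i
  rcases i with i | i <;> simp

/-- A set of points of the graph that is dense in `X` is dense in the graph. -/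
theorem gaussPairs_subset_zclosure (hd : coneDim k X = n + 1)
    {W : Set (Grass k (n + 1) N × PSpace k N)} (hW : W ⊆ gaussPairs n X)
    (hWX : X ⊆ zclosure k (Prod.snd '' W)) : gaussPairs n X ⊆ zclosure k W := by
  rintro ⟨L, x⟩ hz
  obtain ⟨e, he⟩ := exists_rep k (L, x)
  refine (mem_zclosure_iff he).2 fun F hF => ?_
  by_contra hne
  obtain ⟨a₀, c₀, ha₀, hc₀, rfl⟩ := isRep_sumElim_comp he
  obtain ⟨P, D, hD, hPa, hP⟩ := exists_isGaussFrame hd hz ha₀ hc₀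
  have h1 : x ∈ basicOpen (PSpace k N) (D * bind₁ (Sum.elim P MvPolynomial.X) F) :=
    ⟨c₀, hc₀, by
      rw [map_mul, eval_bind₁_graph, hPa]
      exact mul_ne_zero hD hne⟩
  obtain ⟨_, ⟨c, hc, hcD⟩, ⟨L', x'⟩, hw, rfl⟩ := inter_nonempty_of_zclosure (isOpen_basicOpen _)
    ⟨x, h1, hWX (mem_of_mem_gaussMap hz)⟩
  rw [map_mul, eval_bind₁_graph, mul_ne_zero_iff] at hcD
  obtain ⟨L₁, hL₁, hLP⟩ := hP x' (mem_of_mem_gaussMap (hW hw)) c hc hcD.1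
  obtain rfl : L₁ = L' := Part.mem_unique hL₁ (hW hw)
  exact hcD.2 (mem_coneIdeal.1 hF _ hw _ (isRep_sumElim hLP hc))

/-- Nonvanishing conditions on the graph pull back to open conditions on the irreducible `X` along
the local section `c ↦ (P(c), c)`. -/
theorem isIrreducible_gaussPairs (hX : IsProjVariety k X) (hd : coneDim k X = n + 1) :
    @IsIrreducible _ (zariski k (Grass k (n + 1) N × PSpace k N)) (gaussPairs n X) := by
  have : Infinite k := IsAlgClosed.instInfinite
  have hprime := isPrime_coneIdeal (k := k) hX.irreducible
  have hne := gaussPairs_nonempty hX hd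
  refine isIrreducible_of_isPrime (k := k) hne ⟨?_, fun {F G} hFG => ?_⟩
  · obtain ⟨z, hz⟩ := hne
    obtain ⟨e, he⟩ := exists_rep k z
    intro h
    have := mem_coneIdeal.1 ((Ideal.eq_top_iff_one _).1 h) z hz e he
    simp at this
  by_contra! hcon
  have key : ∀ F : MvPolynomial ((Fin (n + 1) × Fin (N + 1)) ⊕ Fin (N + 1)) k,
      F ∉ coneIdeal k (gaussPairs n X) →
      ∃ D : MvPolynomial (Fin (N + 1)) k, D ∉ coneIdeal k X ∧
        ∀ x ∈ X, ∀ c : Fin (N + 1) → k, IsRep c x → eval c D ≠ 0 →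
          ∃ L ∈ gaussMap n X x, (L, x) ∈ basicOpen (Grass k (n + 1) N × PSpace k N) F := by
    intro F hF
    obtain ⟨⟨L, x⟩, hz, e, he, hFe⟩ := notMem_coneIdeal.1 hF
    obtain ⟨a₀, c₀, ha₀, hc₀, rfl⟩ := isRep_sumElim_comp he
    obtain ⟨P, D, hD, hPa, hP⟩ := exists_isGaussFrame hd hz ha₀ hc₀
    refine ⟨D * bind₁ (Sum.elim P MvPolynomial.X) F, fun hmem => ?_, fun x' hx' c hc hcD => ?_⟩
    · have := mem_coneIdeal.1 hmem x (mem_of_mem_gaussMap hz) c₀ hc₀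
      rw [map_mul, eval_bind₁_graph, hPa] at this
      exact mul_ne_zero hD hFe this
    · rw [map_mul, eval_bind₁_graph, mul_ne_zero_iff] at hcD
      obtain ⟨L', hL', hLP⟩ := hP x' hx' c hc hcD.1
      exact ⟨L', hL', _, isRep_sumElim hLP hc, hcD.2⟩
  obtain ⟨D, hD, h⟩ := key F hcon.1
  obtain ⟨D', hD', h'⟩ := key G hcon.2
  have hDD : D * D' ∉ coneIdeal k X := fun hmem => (hprime.mem_or_mem hmem).elim hD hD'
  obtain ⟨x, hx, c, hc, hDc⟩ := notMem_coneIdeal.1 hDD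
  rw [map_mul, mul_ne_zero_iff] at hDc
  obtain ⟨L, hL, hF⟩ := h x hx c hc hDc.1
  obtain ⟨L', hL', hG⟩ := h' x hx c hc hDc.2
  obtain rfl : L = L' := Part.mem_unique hL hL'
  obtain ⟨e, he, h1, h2⟩ := exists_isRep_eval_ne_zero hF hG
  have := mem_coneIdeal.1 hFG (L, x) hL e he
  rw [map_mul] at this
  exact mul_ne_zero h1 h2 this

theorem isProjVariety_gaussGraph (hX : IsProjVariety k X) (hd : coneDim k X = n + 1) :
    IsProjVariety k (gaussGraph n X) := isProjVariety_zclosure (isIrreducible_gaussPairs hX hd)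

/-! ### Differentials -/

/-- The condition that the `i`-th vector of the frame is a zero of the differential of `F` at the
point. -/
def tangencyEq (i : Fin (n + 1)) (F : MvPolynomial (Fin (N + 1)) k) :
    MvPolynomial ((Fin (n + 1) × Fin (N + 1)) ⊕ Fin (N + 1)) k :=
  ∑ p, pullInr (Fin (n + 1) × Fin (N + 1)) (pderiv p F) * MvPolynomial.X (Sum.inl (i, p))

theorem eval_tangencyEq (i : Fin (n + 1)) (F : MvPolynomial (Fin (N + 1)) k)
    (a : Fin (n + 1) × Fin (N + 1) → k) (c : Fin (N + 1) → k) :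
    eval (Sum.elim a c) (tangencyEq i F) = polyDiff F c (row a i) := by
  rw [tangencyEq, polyDiff_apply]
  simp only [map_sum, map_mul, eval_pullInr, eval_X, Sum.elim_inl, Sum.elim_inr, row]

theorem polyDiff_tangencyEq (i : Fin (n + 1)) (F : MvPolynomial (Fin (N + 1)) k)
    (a : Fin (n + 1) × Fin (N + 1) → k) (c : Fin (N + 1) → k)
    (v : (Fin (n + 1) × Fin (N + 1)) ⊕ Fin (N + 1) → k) :
    polyDiff (tangencyEq i F) (Sum.elim a c) v =
      hess F c (fun p => v (Sum.inr p)) (row a i) +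
        polyDiff F c (row (fun j => v (Sum.inl j)) i) := by
  rw [tangencyEq, polyDiff_sum, hess_eq, polyDiff_apply F, ← Finset.sum_add_distrib]
  refine Finset.sum_congr rfl fun p _ => ?_
  rw [polyDiff_mul, polyDiff_X, eval_pullInr, eval_X, polyDiff_pullInr]
  simp only [Sum.elim_inl, Sum.elim_inr, row]
  ring

theorem tangencyEq_mem_coneIdeal (i : Fin (n + 1)) {F : MvPolynomial (Fin (N + 1)) k}
    (hF : F ∈ coneIdeal k X) : tangencyEq i F ∈ coneIdeal k (gaussGraph n X) := by
  rw [gaussGraph_eq, coneIdeal_zclosure]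
  refine mem_coneIdeal.2 fun z hz e he => ?_
  obtain ⟨a, c, ha, hc, rfl⟩ := isRep_sumElim_comp he
  rw [eval_tangencyEq]
  have := row_mem ha i
  rw [((mem_gaussMap_iff hc).1 hz).2] at this
  exact mem_coneTangent.1 this F hF

theorem snd_mem_of_mem_gaussGraph (hX : IsProjVariety k X) {z : Grass k (n + 1) N × PSpace k N}
    (hz : z ∈ gaussGraph n X) : z.2 ∈ X :=
  snd_mem_of_mem_zclosure hX.closed (fun _ hw => mem_of_mem_gaussMap hw) hz

/-- Tangency is a closed condition, so every `(L, x)` in the closure of the graph has `L` inside the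
tangent space at `x`; at a smooth point the dimensions agree. -/
theorem mem_gaussMap_of_mem_gaussGraph (hX : IsProjVariety k X) {L : Grass k (n + 1) N}
    {x : PSpace k N} (hz : (L, x) ∈ gaussGraph n X) {c : Fin (N + 1) → k} (hc : IsRep c x)
    (h : Module.finrank k (coneTangent X c) ≤ n + 1) : L ∈ gaussMap n X x := by
  obtain ⟨a, ha⟩ := exists_rep k L
  refine (mem_gaussMap_iff hc).2 ⟨snd_mem_of_mem_gaussGraph hX hz, ?_⟩
  refine Submodule.eq_of_le_of_finrank_le ?_ (h.trans L.2.ge)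
  rw [← isRep_grass_iff.1 ha, Submodule.span_le]
  rintro _ ⟨i, rfl⟩
  refine mem_coneTangent.2 fun F hF => ?_
  rw [← eval_tangencyEq]
  exact (mem_zclosure_iff (isRep_sumElim ha hc)).1 hz _
    (by rw [← coneIdeal_zclosure]; exact tangencyEq_mem_coneIdeal i hF)

theorem hess_add_of_mem_coneTangent_gaussGraph {a : Fin (n + 1) × Fin (N + 1) → k}
    {c : Fin (N + 1) → k} {v : (Fin (n + 1) × Fin (N + 1)) ⊕ Fin (N + 1) → k}
    (hv : v ∈ coneTangent (gaussGraph n X) (Sum.elim a c)) {F : MvPolynomial (Fin (N + 1)) k}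
    (hF : F ∈ coneIdeal k X) (i : Fin (n + 1)) :
    hess F c (fun p => v (Sum.inr p)) (row a i) +
      polyDiff F c (row (fun j => v (Sum.inl j)) i) = 0 := by
  rw [← polyDiff_tangencyEq]
  exact mem_coneTangent.1 hv _ (tangencyEq_mem_coneIdeal i hF)

/-- The differential of the map given by `P`. -/
abbrev frameDiff (P : Fin (n + 1) × Fin (N + 1) → MvPolynomial (Fin (N + 1)) k)
    (c : Fin (N + 1) → k) : (Fin (N + 1) → k) →ₗ[k] (Fin (n + 1) × Fin (N + 1) → k) :=
  LinearMap.pi fun j => polyDiff (P j) c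

variable {P : Fin (n + 1) × Fin (N + 1) → MvPolynomial (Fin (N + 1)) k}
  {D : MvPolynomial (Fin (N + 1)) k} {x : PSpace k N} {c : Fin (N + 1) → k}

/-- Differentiate the local section `c ↦ (P(c), c)` of the graph. -/
theorem sumElim_mem_coneTangent_gaussGraph (hP : IsGaussFrame n X P D) (hx : x ∈ X)
    (hc : IsRep c x) (hD : eval c D ≠ 0) {v : Fin (N + 1) → k} (hv : v ∈ coneTangent X c) :
    Sum.elim (frameDiff P c v) v ∈
      coneTangent (gaussGraph n X) (Sum.elim (fun j => eval c (P j)) c) := by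
  refine mem_coneTangent.2 fun F hF => ?_
  rw [gaussGraph_eq, coneIdeal_zclosure] at hF
  have h1 := polyDiff_eq_zero_of_local hx hc hv (F := bind₁ (Sum.elim P MvPolynomial.X) F) hD
    fun x' hx' c' hc' hD' => by
      obtain ⟨L, hL, hLP⟩ := hP x' hx' c' hc' hD'
      rw [eval_bind₁_graph]
      exact mem_coneIdeal.1 hF (L, x') hL _ (isRep_sumElim hLP hc')
  have e1 : (fun j => eval c ((Sum.elim P MvPolynomial.X : _ → MvPolynomial (Fin (N + 1)) k) j)) =
      Sum.elim (fun j => eval c (P j)) c := by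
    ext i
    rcases i with i | i <;> simp
  have e2 : (fun j => polyDiff ((Sum.elim P MvPolynomial.X : _ →
      MvPolynomial (Fin (N + 1)) k) j) c v) = Sum.elim (frameDiff P c v) v := by
    ext i
    rcases i with i | i <;> simp
  rw [polyDiff_bind₁, e1, e2] at h1
  exact h1

theorem frameDiff_mem_coneTangent {Y : Set (Grass k (n + 1) N)}
    (hY : ∀ x, ∀ L ∈ gaussMap n X x, L ∈ Y) (hYc : IsClosed[zariski k _] Y)
    (hP : IsGaussFrame n X P D) (hx : x ∈ X)
    (hc : IsRep c x) (hD : eval c D ≠ 0) {v : Fin (N + 1) → k} (hv : v ∈ coneTangent X c) :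
    frameDiff P c v ∈ coneTangent Y (fun j => eval c (P j)) := by
  have := inl_mem_coneTangent_sumElim (Y := Y) (fun z hz =>
    fst_mem_of_mem_zclosure hYc (fun w hw => hY _ _ hw) hz)
    (sumElim_mem_coneTangent_gaussGraph hP hx hc hD hv)
  exact this

/-- This is the derivative along `v` of the relation `dF_c(P_i(c)) = 0`, the basic identity of the
second fundamental form. -/
theorem hess_add_polyDiff_frameDiff (hP : IsGaussFrame n X P D) (hx : x ∈ X)
    (hc : IsRep c x) (hD : eval c D ≠ 0) {v : Fin (N + 1) → k} (hv : v ∈ coneTangent X c)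
    {F : MvPolynomial (Fin (N + 1)) k} (hF : F ∈ coneIdeal k X) (i : Fin (n + 1)) :
    hess F c v (row (fun j => eval c (P j)) i) + polyDiff F c (row (frameDiff P c v) i) = 0 :=
  hess_add_of_mem_coneTangent_gaussGraph (sumElim_mem_coneTangent_gaussGraph hP hx hc hD hv) hF i

/-- A substitute for Euler's formula that needs neither homogeneity nor a degree: `dF_c(c) = 0` on
the cone, and the derivative of this along `v` is `Hess F(v, c) + dF_c(v)`, whose last term
vanishes. -/
theorem hess_self_eq_zero {v : Fin (N + 1) → k} (hv : v ∈ coneTangent X c)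
    {F : MvPolynomial (Fin (N + 1)) k} (hF : F ∈ coneIdeal k X) : hess F c v c = 0 := by
  have : Infinite k := IsAlgClosed.instInfinite
  have h : ∑ p, pderiv p F * MvPolynomial.X p ∈ coneIdeal k X :=
    mem_coneIdeal.2 fun x' hx' c' hc' => by
      have := mem_coneTangent.1 (mem_coneTangent_self (k := k) hx' hc') F hF
      rw [polyDiff_apply] at this
      simpa using this
  have h1 := mem_coneTangent.1 hv _ h
  rw [polyDiff_pairing] at h1
  simpa [mem_coneTangent.1 hv F hF] using h1

/-- The kernel of the differential of the Gauss map is the kernel of the second fundamental form. -/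
theorem frameDiff_mem_rowsIn_iff (hP : IsGaussFrame n X P D) (hx : x ∈ X)
    (hc : IsRep c x) (hD : eval c D ≠ 0) {L : Grass k (n + 1) N} (hL : L ∈ gaussMap n X x)
    (hLP : IsRep (fun j => eval c (P j)) L) {v : Fin (N + 1) → k} (hv : v ∈ coneTangent X c) :
    frameDiff P c v ∈ rowsIn L.1 (n + 1) ↔
      ∀ F ∈ coneIdeal k X, ∀ w ∈ coneTangent X c, hess F c v w = 0 := by
  have hLT := ((mem_gaussMap_iff hc).1 hL).2
  rw [mem_rowsIn]
  constructor
  · intro h F hF w hw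
    rw [← hLT] at hw
    obtain ⟨t, rfl⟩ := exists_sum_row_eq hLP hw
    rw [hess_sum_right]
    refine Finset.sum_eq_zero fun i _ => ?_
    have h1 := hess_add_polyDiff_frameDiff hP hx hc hD hv hF i
    have h2 := h i
    rw [hLT] at h2
    rw [mem_coneTangent.1 h2 F hF, add_zero] at h1
    rw [h1, mul_zero]
  · intro h i
    rw [hLT]
    refine mem_coneTangent.2 fun F hF => ?_
    have h1 := hess_add_polyDiff_frameDiff hP hx hc hD hv hF i
    have h2 := row_mem hLP i
    rw [hLT] at h2
    rwa [h F hF _ h2, zero_add] at h1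

/-- If the tangent space of `Y` is the image of the differential of the Gauss map, then the kernel
of `Φ` is the kernel of the second fundamental form. -/
theorem mem_kerPhi_iff_hess {Y : Set (Grass k (n + 1) N)} (hP : IsGaussFrame n X P D) (hx : x ∈ X)
    (hc : IsRep c x) (hD : eval c D ≠ 0) {L : Grass k (n + 1) N} (hL : L ∈ gaussMap n X x)
    (hLP : IsRep (fun j => eval c (P j)) L)
    (hT : coneTangent Y (fun j => eval c (P j)) =
      (coneTangent X c).map (frameDiff P c) ⊔ rowsIn L.1 (n + 1)) {v : Fin (N + 1) → k}
    (hv : v ∈ coneTangent X c) :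
    v ∈ kerPhi Y L ↔ ∀ F ∈ coneIdeal k X, ∀ w ∈ coneTangent X c, hess F c v w = 0 := by
  have hLT := ((mem_gaussMap_iff hc).1 hL).2
  have hv' := hv
  rw [← hLT] at hv'
  obtain ⟨t, rfl⟩ := exists_sum_row_eq hLP hv'
  rw [sum_row_mem_kerPhi hLP, hT]
  -- By symmetry the tangent vector `w` is moved to the slot in which the frame is differentiated.
  have key : ∀ F ∈ coneIdeal k X, ∀ w ∈ coneTangent X c,
      hess F c (∑ i, t i • row (fun j => eval c (P j)) i) w =
        - polyDiff F c (∑ i, t i • row (frameDiff P c w) i) := by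
    intro F hF w hw
    rw [hess_comm, hess_sum_right, map_sum, ← Finset.sum_neg_distrib]
    refine Finset.sum_congr rfl fun i _ => ?_
    rw [map_smul, smul_eq_mul, ← mul_neg]
    exact congrArg _ (eq_neg_of_add_eq_zero_left (hess_add_polyDiff_frameDiff hP hx hc hD hw hF i))
  constructor
  · intro h F hF w hw
    have := h _ (Submodule.mem_sup_left ⟨w, hw, rfl⟩)
    rw [hLT] at this
    rw [key F hF w hw, mem_coneTangent.1 this F hF, neg_zero]
  · intro h b hb
    obtain ⟨_, ⟨w, hw, rfl⟩, u, hu, rfl⟩ := Submodule.mem_sup.1 hb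
    simp only [row_add, smul_add, Finset.sum_add_distrib]
    refine add_mem ?_ (Submodule.sum_mem _ fun i _ => Submodule.smul_mem _ _ (hu i))
    rw [hLT]
    refine mem_coneTangent.2 fun F hF => ?_
    have := key F hF w hw
    rw [h F hF w hw] at this
    exact neg_eq_zero.1 this.symm

end Gauss

/-! ### Images under the second projection -/

section Image

variable {k : Type*} [Field k] {M M' : Type*} {ι κ : Type} [HomogCoord k M ι] [HomogCoord k M' κ]
  [Fintype ι] [Fintype κ] [FibreCoord k M] [FibreCoord k M']

theorem pullInr_eq_rename {k : Type*} [Field k] [Infinite k] {ι κ : Type} [Fintype ι] [Fintype κ]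
    (F : MvPolynomial κ k) : pullInr ι F = rename Sum.inr F :=
  MvPolynomial.funext fun e => by
    rw [eval_pullInr, eval_rename]
    rfl

theorem mem_coneIdeal_image_snd {Z : Set (M × M')} {F : MvPolynomial κ k} :
    F ∈ coneIdeal k (Prod.snd '' Z) ↔ pullInr ι F ∈ coneIdeal k Z := by
  rw [mem_coneIdeal, mem_coneIdeal]
  constructor
  · intro h z hz e he
    rw [eval_pullInr]
    exact h z.2 ⟨z, hz, rfl⟩ _ he.2
  · rintro h _ ⟨z, hz, rfl⟩ c hc
    obtain ⟨a, ha⟩ := exists_rep k z.1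
    have := h z hz _ (isRep_sumElim (m := z.1) (m' := z.2) ha hc)
    rwa [eval_pullInr] at this

theorem isIrreducible_image_snd [Infinite k] {Z : Set (M × M')}
    (hZ : @IsIrreducible _ (zariski k (M × M')) Z) :
    @IsIrreducible _ (zariski k M') (Prod.snd '' Z) := by
  have := isPrime_coneIdeal hZ
  refine isIrreducible_of_isPrime (k := k) (hZ.1.image _) ?_
  have h : coneIdeal k (Prod.snd '' Z) = (coneIdeal k Z).comap (bind₁ (linPoly (inrₗ k ι κ))) := by
    ext F
    exact mem_coneIdeal_image_snd
  rw [h]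
  exact Ideal.comap_isPrime _ _

end Image

/-! ### Completeness of the Grassmannian -/

section Complete

/-- The minor of a tuple of vectors with columns `J`, on the product with a projective space. -/
def minor (k : Type*) [Field k] {d N : ℕ} (J : Fin d → Fin (N + 1)) :
    MvPolynomial ((Fin d × Fin (N + 1)) ⊕ Fin (N + 1)) k :=
  (Matrix.of fun i l => X (Sum.inl (i, J l))).det

theorem aeval_minor {k K : Type*} [Field k] [Field K] [Algebra k K] {d N : ℕ}
    (J : Fin d → Fin (N + 1)) (e : (Fin d × Fin (N + 1)) ⊕ Fin (N + 1) → K) :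
    aeval e (minor k J) = (Matrix.of fun i l => e (Sum.inl (i, J l))).det := by
  rw [minor, AlgHom.map_det]
  congr 1
  ext i l
  simp

theorem aeval_minor_update {k K : Type*} [Field k] [Field K] [Algebra k K] {d N : ℕ}
    (J : Fin d → Fin (N + 1)) (e : (Fin d × Fin (N + 1)) ⊕ Fin (N + 1) → K) (i l : Fin d) :
    aeval e (minor k (Function.update J i (J l))) = if i = l then aeval e (minor k J) else 0 := by
  split_ifs with h
  · rw [h, Function.update_eq_self]
  · rw [aeval_minor]
    refine Matrix.det_zero_of_column_eq h fun m => ?_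
    simp [Function.update_of_ne (Ne.symm h)]

/-- A left inverse writes the identity matrix with rows that are combinations of the columns of `a`;
by multilinearity `1 = det 1` is then a combination of minors. -/
theorem exists_minor_ne_zero {k : Type*} [Field k] {d N : ℕ} {a : Fin d × Fin (N + 1) → k}
    (ha : LinearIndependent k (row a)) :
    ∃ J : Fin d → Fin (N + 1), (Matrix.of fun i l => a (i, J l)).det ≠ 0 := by
  obtain ⟨f, hf⟩ : ∃ f : (Fin (N + 1) → k) →ₗ[k] (Fin d → k),
      ∀ i, f (row a i) = Pi.single i 1 := by
    obtain ⟨g, hg⟩ := (Fintype.linearCombination k (row a)).exists_leftInverse_of_injective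
      (LinearMap.ker_eq_bot.2 (linearIndependent_iff_injective_fintypeLinearCombination.1 ha))
    refine ⟨g, fun i => ?_⟩
    have := LinearMap.congr_fun hg (Pi.single i 1)
    simpa [Fintype.linearCombination_apply_single] using this
  by_contra! hcon
  have h1 : Matrix.detRowAlternating (R := k) (fun l : Fin d => ∑ p : Fin (N + 1),
      f (Pi.single p 1) l • fun i : Fin d => a (i, p)) = 0 := by
    change Matrix.detRowAlternating.toMultilinearMap _ = 0
    rw [MultilinearMap.map_sum]
    refine Finset.sum_eq_zero fun J _ => ?_
    rw [MultilinearMap.map_smul_univ]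
    have := hcon J
    rw [← Matrix.det_transpose] at this
    exact (congrArg _ this).trans (smul_zero _)
  have h2 : (fun l : Fin d => ∑ p : Fin (N + 1), f (Pi.single p 1) l • fun i : Fin d => a (i, p)) =
      (1 : Matrix (Fin d) (Fin d) k) := by
    ext l i
    have := congrFun (hf i) l
    rw [linear_apply_eq_sum] at this
    rw [Finset.sum_apply]
    simpa [row, Matrix.one_apply, Pi.single_apply] using this
  rw [h2] at h1
  exact one_ne_zero (Matrix.det_one.symm.trans h1)

/-- The frame with the identity matrix in the columns `J`. -/
theorem isRep_normalized {k : Type*} [Field k] {d N : ℕ} {a : Fin d × Fin (N + 1) → k}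
    {L : Grass k d N} (ha : IsRep a L) {J : Fin d → Fin (N + 1)}
    (hJ : (Matrix.of fun i l => a (i, J l)).det ≠ 0) :
    IsRep (fun q : Fin d × Fin (N + 1) => ((Matrix.of fun i l => a (i, J l)).det)⁻¹ *
      (Matrix.of fun i l => a (i, Function.update J q.1 q.2 l)).det) L := by
  set A : Matrix (Fin d) (Fin d) k := Matrix.of fun i l => a (i, J l) with hA
  set b : Fin d × Fin (N + 1) → k := fun q => A.det⁻¹ *
    (Matrix.of fun i l => a (i, Function.update J q.1 q.2 l)).det with hb
  -- The entries of the normalized frame are the quotients of Cramer's rule.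
  have hcr : ∀ l p, (Matrix.of fun i m => a (i, Function.update J l p m)).det =
      A.cramer (fun i => a (i, p)) l := by
    intro l p
    rw [Matrix.cramer_apply]
    congr 1
    ext i m
    by_cases h : m = l
    · subst h
      simp
    · simp [h, hA]
  have hab : rowAct A b = a := ext_row fun i => by
    ext p
    have := congrFun (Matrix.mulVec_cramer A (fun i => a (i, p))) i
    rw [Matrix.mulVec, dotProduct] at this
    rw [row_rowAct, Finset.sum_apply]
    simp only [Pi.smul_apply, row, hb, hcr, smul_eq_mul]
    rw [← mul_right_inj' hJ, Finset.mul_sum]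
    simp only [Pi.smul_apply, smul_eq_mul] at this
    rw [← this]
    refine Finset.sum_congr rfl fun l _ => ?_
    field_simp
  have hu : IsUnit A.det := isUnit_iff_ne_zero.2 hJ
  have h3 : b = rowAct A⁻¹ a := by
    rw [← hab, ← rowAct_mul, Matrix.nonsing_inv_mul A hu, rowAct_one]
  rw [h3]
  exact isRep_rowAct (Matrix.mul_nonsing_inv A hu) ha

variable {k : Type u} [Field k] [IsAlgClosed k] {d N : ℕ}

/-- Specialization of a generic point to the valuation ring, and then to its residue field. -/
theorem exists_specialization {K : Type u} [Field K] [Algebra k K] {τ : Type} [Finite τ]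
    (V : ValuationSubring K) (hkV : ∀ t : k, algebraMap k K t ∈ V) (ξ : τ → K) (hξ : ∀ i, ξ i ∈ V)
    (b : τ → k) (S : Set τ) (hS : ∀ i ∈ S, ξ i - algebraMap k K (b i) ∈ V.nonunits) :
    ∃ e : τ → k, (∀ i ∈ S, e i = b i) ∧ ∀ F : MvPolynomial τ k, aeval ξ F = 0 → eval e F = 0 := by
  let ψ : k →+* V := (algebraMap k K).codRestrict V.toSubring hkV
  let θ : MvPolynomial τ k →+* V := eval₂Hom ψ fun i => ⟨ξ i, hξ i⟩
  have hθ : ∀ F, (θ F : K) = aeval ξ F := by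
    intro F
    have : V.subtype.comp θ = (aeval ξ : MvPolynomial τ k →ₐ[k] K).toRingHom := by
      refine ringHom_ext (fun t => ?_) fun i => ?_
      · simp [θ, ψ]
      · simp [θ]
    exact RingHom.congr_fun this F
  let Φ := (IsLocalRing.residue V).comp θ
  -- The residue field of `V` may be larger than `k`. A maximal ideal above `ker Φ` nevertheless
  -- gives a `k`-point, by the Nullstellensatz, and that point satisfies every relation in `ker Φ`.
  obtain ⟨m, hm, hle⟩ := Ideal.exists_le_maximal (RingHom.ker Φ) (RingHom.ker_ne_top Φ)
  obtain ⟨e, rfl⟩ := isMaximal_iff_eq_vanishingIdeal_singleton.1 hm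
  have he : ∀ F, Φ F = 0 → eval e F = 0 := fun F hF => by
    have := (mem_vanishingIdeal_singleton_iff e F).1 (hle hF)
    rwa [aeval_eq_eval] at this
  refine ⟨e, fun i hi => ?_, fun F hF => he F ?_⟩
  · have h1 : Φ (X i - C (b i)) = 0 := by
      change IsLocalRing.residue V (θ (X i - C (b i))) = 0
      rw [IsLocalRing.residue_eq_zero_iff]
      refine ValuationSubring.coe_mem_nonunits_iff.1 ?_
      rw [hθ]
      simpa using hS i hi
    have := he _ h1
    rwa [map_sub, eval_X, eval_C, sub_eq_zero] at this
  · have : θ F = 0 := Subtype.ext ((hθ F).trans hF)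
    change IsLocalRing.residue V (θ F) = 0
    rw [this, map_zero]

/-- A valuative argument. A generic point of `Z` whose second component specializes to `x₀` is
dominated by a valuation ring; the frame normalized at a minor of largest valuation has entries in
this ring and contains an identity matrix, so it specializes to a frame. -/
theorem isClosed_image_snd {Z : Set (Grass k d N × PSpace k N)} (hZ : IsProjVariety k Z) :
    IsClosed[zariski k (PSpace k N)] (Prod.snd '' Z) := by
  classical
  have hinf : Infinite k := IsAlgClosed.instInfinite
  have hprime := isPrime_coneIdeal (k := k) hZ.irreducible
  refine isClosed_of_forall (k := k) fun x₀ hx₀ => ?_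
  obtain ⟨j, hj⟩ := exists_rep_ne_zero x₀
  set c₀ : Fin (N + 1) → k := (x₀.rep j)⁻¹ • x₀.rep with hc₀def
  have hc₀ : IsRep c₀ x₀ := isRep_smul (isRep_rep x₀) (inv_ne_zero hj)
  have hc₀j : c₀ j = 1 := by simp [hc₀def, hj]
  have hcl : ∀ F : MvPolynomial (Fin (N + 1)) k,
      pullInr (Fin d × Fin (N + 1)) F ∈ coneIdeal k Z → eval c₀ F = 0 := fun F hF =>
    hx₀ c₀ hc₀ F (mem_coneIdeal_image_snd.2 hF)
  let A := MvPolynomial ((Fin d × Fin (N + 1)) ⊕ Fin (N + 1)) k ⧸ coneIdeal k Z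
  let K := FractionRing A
  let ξ : (Fin d × Fin (N + 1)) ⊕ Fin (N + 1) → K := fun i =>
    algebraMap A K (Ideal.Quotient.mk _ (X i))
  have hξ : ∀ F, aeval ξ F = algebraMap A K (Ideal.Quotient.mk _ F) := by
    intro F
    have : (aeval ξ : _ →ₐ[k] K) = (IsScalarTower.toAlgHom k A K).comp
        (Ideal.Quotient.mkₐ k (coneIdeal k Z)) := by
      ext i
      simp only [aeval_X]
      rfl
    exact AlgHom.congr_fun this F
  have hξ0 : ∀ F, aeval ξ F = 0 ↔ F ∈ coneIdeal k Z := fun F => by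
    rw [hξ, FaithfulSMul.algebraMap_eq_zero_iff, Ideal.Quotient.eq_zero_iff_mem]
  have hξr : ∀ F : MvPolynomial (Fin (N + 1)) k, aeval (fun p => ξ (Sum.inr p)) F =
      aeval ξ (pullInr (Fin d × Fin (N + 1)) F) := fun F => by
    rw [pullInr_eq_rename, aeval_rename]
    rfl
  have hξj : ξ (Sum.inr j) ≠ 0 := by
    intro h
    have h1 : aeval ξ (pullInr (Fin d × Fin (N + 1)) (X j : MvPolynomial (Fin (N + 1)) k)) = 0 := by
      rw [← hξr, aeval_X, h]
    have h2 := hcl _ ((hξ0 _).1 h1)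
    rw [eval_X, hc₀j] at h2
    exact one_ne_zero h2
  -- The generic point of the image in the chart of `x₀`. The division is legitimate since the
  -- `j`-th coordinate does not vanish at `x₀`, hence is not an equation of the image.
  let γ : Fin (N + 1) → K := fun p => (ξ (Sum.inr j))⁻¹ * ξ (Sum.inr p)
  have hγ : ∀ F : MvPolynomial (Fin (N + 1)) k, aeval γ F = 0 → eval c₀ F = 0 := by
    intro F hF
    obtain ⟨m, G, hG⟩ := exists_homogenize_aeval (X j) X F
    have h1 := hG K (fun p => ξ (Sum.inr p)) (by simpa using hξj)
    have h2 := hG k c₀ (by simp [hc₀j])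
    simp only [aeval_X] at h1 h2
    rw [show aeval (fun p => (ξ (Sum.inr j))⁻¹ * ξ (Sum.inr p)) F = 0 from hF, mul_zero, hξr] at h1
    simp only [hc₀j, inv_one, one_pow, one_mul, aeval_eq_eval] at h2
    exact h2.symm.trans (hcl G ((hξ0 _).1 h1))
  have hev : ∀ (J : Fin d → Fin (N + 1)) (e : (Fin d × Fin (N + 1)) ⊕ Fin (N + 1) → k),
      eval e (minor k J) = (Matrix.of fun i l => e (Sum.inl (i, J l))).det := fun J e => by
    have := aeval_minor (k := k) J e
    rwa [aeval_eq_eval] at this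
  obtain ⟨z, hz, e, he, J₀, hJ₀⟩ : ∃ z ∈ Z, ∃ e : (Fin d × Fin (N + 1)) ⊕ Fin (N + 1) → k,
      IsRep e z ∧ ∃ J₀ : Fin d → Fin (N + 1), eval e (minor k J₀) ≠ 0 := by
    obtain ⟨z, hz⟩ := hZ.irreducible.1
    obtain ⟨e, he⟩ := exists_rep k z
    obtain ⟨J₀, hJ₀⟩ := exists_minor_ne_zero (linearIndependent_row he.1)
    refine ⟨z, hz, e, he, J₀, ?_⟩
    rw [hev]
    exact hJ₀
  have hJ₀' : aeval ξ (minor k J₀) ≠ 0 := fun h => hJ₀ (mem_coneIdeal.1 ((hξ0 _).1 h) z hz e he)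
  let R : Subring K := (aeval γ : MvPolynomial (Fin (N + 1)) k →ₐ[k] K).toRingHom.range
  obtain ⟨V, hV, hV'⟩ : ∃ V : ValuationSubring K, R ≤ V.toSubring ∧
      ∀ p, γ p - algebraMap k K (c₀ p) ∈ V.nonunits := by
    let ρ : MvPolynomial (Fin (N + 1)) k →+* R := RingHom.rangeRestrict _
    have hρ : Function.Surjective ρ := RingHom.rangeRestrict_surjective _
    -- Relations of `γ` hold at `c₀`, so the maximal ideal of `c₀` stays proper in the ring
    -- generated by `γ`; a valuation ring with this ideal among its nonunits therefore exists.
    have hI : (RingHom.ker (eval c₀)).map ρ ≠ ⊤ := by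
      rw [Ne, Ideal.eq_top_iff_one, Ideal.mem_map_iff_of_surjective ρ hρ]
      rintro ⟨F, hF, hF1⟩
      have h1 : aeval γ F = 1 := congrArg Subtype.val hF1
      have h2 := hγ (F - 1) (by rw [map_sub, h1, map_one, sub_self])
      rw [map_sub, (RingHom.mem_ker).1 hF, map_one, zero_sub, neg_eq_zero] at h2
      exact one_ne_zero h2
    obtain ⟨V, hV, hV'⟩ := Ideal.image_subset_nonunits_valuationSubring _ hI
    refine ⟨V, hV, fun p => hV' ⟨ρ (X p - C (c₀ p)), Ideal.mem_map_of_mem _ ?_, ?_⟩⟩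
    · simp [RingHom.mem_ker]
    · change aeval γ (X p - C (c₀ p)) = _
      simp
  -- Dividing by a minor of largest valuation puts all entries of the frame `β` in `V`.
  obtain ⟨J, -, hJ⟩ := Finset.exists_max_image Finset.univ
    (fun J : Fin d → Fin (N + 1) => V.valuation (aeval ξ (minor k J))) ⟨J₀, Finset.mem_univ _⟩
  have hJ0 : aeval ξ (minor k J) ≠ 0 := by
    intro h
    have := hJ J₀ (Finset.mem_univ _)
    rw [h, map_zero, le_zero_iff, map_eq_zero] at this
    exact hJ₀' this
  let β : Fin d × Fin (N + 1) → K := fun q =>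
    (aeval ξ (minor k J))⁻¹ * aeval ξ (minor k (Function.update J q.1 q.2))
  have hJinj : Function.Injective J := by
    intro i l hil
    by_contra hne
    refine hJ0 ?_
    rw [aeval_minor]
    exact Matrix.det_zero_of_column_eq hne fun m => by simp [hil]
  have hβJ : ∀ i l, β (i, J l) = if i = l then 1 else 0 := fun i l => by
    change _ * aeval ξ (minor k (Function.update J i (J l))) = _
    rw [aeval_minor_update]
    split_ifs with h
    · exact inv_mul_cancel₀ hJ0
    · exact mul_zero _
  -- Normalizing does not change the represented point, so `F` vanishes at the normalized
  -- coordinates over `k`; clearing denominators turns this into an element of the cone ideal, which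
  -- vanishes at the generic point.
  have hβγ : ∀ F ∈ coneIdeal k Z, aeval (Sum.elim β γ) F = 0 := by
    intro F hF
    obtain ⟨m, G, hG⟩ := exists_homogenize_aeval (minor k J * X (Sum.inr j))
      (Sum.elim (fun q : Fin d × Fin (N + 1) => minor k (Function.update J q.1 q.2) * X (Sum.inr j))
        fun p => X (Sum.inr p) * minor k J) F
    have hfun : ∀ (K : Type u) [Field K] [Algebra k K]
        (e : (Fin d × Fin (N + 1)) ⊕ Fin (N + 1) → K), aeval e (minor k J * X (Sum.inr j)) ≠ 0 →
        (fun i => (aeval e (minor k J * X (Sum.inr j)))⁻¹ * aeval e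
          ((Sum.elim (fun q : Fin d × Fin (N + 1) => minor k (Function.update J q.1 q.2) * X (Sum.inr j))
            fun p => X (Sum.inr p) * minor k J :
              _ → MvPolynomial ((Fin d × Fin (N + 1)) ⊕ Fin (N + 1)) k) i)) =
        Sum.elim (fun q : Fin d × Fin (N + 1) => (aeval e (minor k J))⁻¹ *
            aeval e (minor k (Function.update J q.1 q.2)))
          (fun p => (e (Sum.inr j))⁻¹ * e (Sum.inr p)) := by
      intro K _ _ e he
      rw [map_mul, mul_ne_zero_iff, aeval_X] at he
      obtain ⟨h1, h2⟩ := he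
      ext i
      rcases i with q | p
      · simp only [Sum.elim_inl, map_mul, aeval_X]
        field_simp
      · simp only [Sum.elim_inr, map_mul, aeval_X]
        field_simp
    have hGD : G * (minor k J * X (Sum.inr j)) ∈ coneIdeal k Z := by
      refine mem_coneIdeal.2 fun z hz e he => ?_
      by_cases h0 : eval e (minor k J * X (Sum.inr j)) = 0
      · rw [map_mul, h0, mul_zero]
      · have h0' : aeval e (minor k J * X (Sum.inr j)) ≠ 0 := by rwa [aeval_eq_eval]
        have h1 := hG k e h0'
        rw [hfun k e h0'] at h1
        simp only [aeval_eq_eval] at h1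
        rw [map_mul, mul_eq_zero, not_or, eval_X] at h0
        have h2 : IsRep (Sum.elim (fun q : Fin d × Fin (N + 1) => (eval e (minor k J))⁻¹ *
            eval e (minor k (Function.update J q.1 q.2)))
            fun p => (e (Sum.inr j))⁻¹ * e (Sum.inr p)) z := by
          refine ⟨?_, isRep_smul he.2 (inv_ne_zero h0.2)⟩
          simp only [Sum.elim_inl, hev] at h0 ⊢
          exact isRep_normalized he.1 h0.1
        rw [map_mul, h1, mem_coneIdeal.1 hF z hz _ h2, mul_zero, zero_mul]
    have h1 := (hξ0 _).2 hGD
    have hD0 : aeval ξ (minor k J * X (Sum.inr j)) ≠ 0 := by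
      rw [map_mul, aeval_X]
      exact mul_ne_zero hJ0 hξj
    rw [map_mul] at h1
    have h2 := (mul_eq_zero.1 h1).resolve_right hD0
    rw [hG K ξ hD0, hfun K ξ hD0] at h2
    exact (mul_eq_zero.1 h2).resolve_left (pow_ne_zero _ hD0)
  -- The prescribed residues are `c₀` on the projective space and the identity matrix in the columns
  -- `J`; the remaining entries need only lie in `V`.
  obtain ⟨e', he', hF⟩ := exists_specialization V (fun t => hV ⟨C t, by simp⟩) (Sum.elim β γ)
    (by
      rintro (q | p)
      · rw [Sum.elim_inl, ← ValuationSubring.valuation_le_one_iff, map_mul, map_inv₀]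
        refine inv_mul_le_one_of_le₀ (hJ _ (Finset.mem_univ _)) zero_le
      · exact hV ⟨X p, by simp [γ]⟩)
    (Sum.elim (fun q => if q.2 = J q.1 then 1 else 0) c₀)
    (Set.range Sum.inr ∪ Set.range fun q : Fin d × Fin d => Sum.inl (q.1, J q.2))
    (by
      rintro _ (⟨p, rfl⟩ | ⟨⟨i, l⟩, rfl⟩)
      · exact hV' p
      · simp only [Sum.elim_inl, hβJ, hJinj.eq_iff, eq_comm (a := l)]
        split_ifs <;> simp)
  have hb : ∀ i l, e' (Sum.inl (i, J l)) = if i = l then 1 else 0 := fun i l => by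
    rw [he' _ (Or.inr ⟨(i, l), rfl⟩), Sum.elim_inl]
    simp only [hJinj.eq_iff, eq_comm (a := l)]
  have hc : (fun p => e' (Sum.inr p)) = c₀ := funext fun p => he' _ (Or.inl ⟨p, rfl⟩)
  have hli : LinearIndependent k (row fun q => e' (Sum.inl q)) := by
    refine LinearIndependent.of_comp (LinearMap.funLeft k k J) ?_
    have : (LinearMap.funLeft k k J ∘ row fun q => e' (Sum.inl q)) =
        Pi.basisFun k (Fin d) := by
      ext i l
      simp [LinearMap.funLeft, row, hb, Pi.single_apply, eq_comm]
    rw [this]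
    exact (Pi.basisFun k (Fin d)).linearIndependent
  refine ⟨(spanGrass _ hli, x₀), mem_of_coneIdeal hZ.closed (a := e') ⟨isRep_spanGrass _ hli, ?_⟩
    fun F hFZ => hF F (hβγ F hFZ), rfl⟩
  rw [hc]
  exact hc₀

end Complete

/-! ### The second projection -/

section Proj

variable {k : Type*} [Field k] {d N : ℕ}

theorem mem_proj₂ {z : Grass k d N × PSpace k N} {y : PSpace k N} :
    y ∈ proj₂ k d N z ↔ y = z.2 := Part.mem_some_iff

theorem image_proj₂ (Z : Set (Grass k d N × PSpace k N)) :
    (proj₂ k d N).image Z = Prod.snd '' Z := by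
  ext y
  rw [PFun.mem_image, Set.mem_image]
  simp only [mem_proj₂, eq_comm]

theorem finrank_map_mkQ_comp_add {V V' : Type*} [AddCommGroup V] [Module k V] [AddCommGroup V']
    [Module k V'] [FiniteDimensional k V'] (T : Submodule k V) (f : V →ₗ[k] V')
    (W : Submodule k V') :
    Module.finrank k (T.map (W.mkQ ∘ₗ f)) + Module.finrank k W =
      Module.finrank k (T.map f ⊔ W : Submodule k V') := by
  rw [Submodule.map_comp, finrank_map_mkQ_add]

theorem coneTangent_singleton_pspace [Infinite k] {x : PSpace k N} {c : Fin (N + 1) → k}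
    (hc : IsRep c x) : coneTangent {x} c = x.submodule := coneTangent_singleton hc

theorem coneTangent_singleton_grass [Infinite k] {L : Grass k d N} {a : Fin d × Fin (N + 1) → k}
    (ha : IsRep a L) : coneTangent {L} a = rowsIn L.1 d := coneTangent_singleton ha

/-- The differential of a local expression of the second projection. -/
theorem diff_proj₂_eq {Z : Set (Grass k d N × PSpace k N)} {z : Grass k d N × PSpace k N}
    (hz : z ∈ Z) {P : Fin (N + 1) → MvPolynomial ((Fin d × Fin (N + 1)) ⊕ Fin (N + 1)) k}
    (hP : IsLocalExpr Z (proj₂ k d N) z P) {e v : (Fin d × Fin (N + 1)) ⊕ Fin (N + 1) → k}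
    (he : IsRep e z) (hv : v ∈ coneTangent Z e) :
    ∃ t s : k, (fun p => polyDiff (P p) e v) =
      t • (fun p => v (Sum.inr p)) + s • fun p => e (Sum.inr p) := by
  obtain ⟨U, hU, hzU, h⟩ := hP
  have hrep : ∀ w ∈ U ∩ Z, ∀ e', IsRep e' w → IsRep (fun p => eval e' (P p)) w.2 := by
    intro w hw e' he'
    obtain ⟨y, hy, hy'⟩ := h w hw
    rw [← mem_proj₂.1 hy]
    exact hy' e' he'
  obtain ⟨D, hD, hDU⟩ := exists_of_isOpen hU hzU he
  obtain ⟨j, hj⟩ := Function.ne_iff.1 (isRep_pspace_iff.1 he.2).1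
  replace hj : e (Sum.inr j) ≠ 0 := hj
  obtain ⟨t, -, ht⟩ := exists_eq_smul_of_isRep he.2 (hrep z ⟨hzU, hz⟩ e he)
  have ht' : ∀ p, eval e (P p) = t * e (Sum.inr p) := fun p => (congrFun ht p).symm
  -- The coefficient `s` is forced by the `j`-th coordinate. For the others, the cross products `x_j
  -- P_q - x_q P_j` vanish near the point and are differentiated.
  refine ⟨t, (e (Sum.inr j))⁻¹ * (polyDiff (P j) e v - t * v (Sum.inr j)), funext fun q => ?_⟩
  have h1 := polyDiff_eq_zero_of_local hz he hv
    (F := X (Sum.inr j) * P q - X (Sum.inr q) * P j) hD fun w hw e' he' hDe' => by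
      obtain ⟨t', -, ht'⟩ := exists_eq_smul_of_isRep he'.2 (hrep w ⟨hDU w e' he' hDe', hw⟩ e' he')
      have ht'' : ∀ p, eval e' (P p) = t' * e' (Sum.inr p) := fun p => (congrFun ht' p).symm
      rw [map_sub, map_mul, map_mul, eval_X, eval_X, ht'', ht'']
      ring
  rw [polyDiff_sub, polyDiff_mul, polyDiff_mul, polyDiff_X, polyDiff_X, eval_X, eval_X, ht', ht']
    at h1
  simp only [Pi.add_apply, Pi.smul_apply, smul_eq_mul]
  field_simp
  linear_combination h1

end Proj

/-! ### The equivalences and the fibres of the Gauss map. -/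

section Main

variable {k : Type*} [Field k] [IsAlgClosed k] {N n : ℕ} {X : Set (PSpace k N)}
  {Y : Set (Grass k (n + 1) N)}

theorem isIrreducible_image_fst {M M' : Type*} {ι κ : Type} [HomogCoord k M ι]
    [HomogCoord k M' κ] [Fintype ι] [Fintype κ] [FibreCoord k M] [FibreCoord k M']
    {Z : Set (M × M')} (hZ : @IsIrreducible _ (zariski k (M × M')) Z) :
    @IsIrreducible _ (zariski k M) (Prod.fst '' Z) := by
  let _ := zariski k M
  let _ := zariski k (M × M')
  have h : Continuous (Prod.fst : M × M' → M) := ⟨fun _ hU => isOpen_preimage_fst hU⟩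
  exact hZ.image _ h.continuousOn

theorem image_gaussMap (n : ℕ) (X : Set (PSpace k N)) :
    (gaussMap n X).image X = Prod.fst '' gaussPairs n X := by
  ext L
  rw [PFun.mem_image]
  constructor
  · rintro ⟨x, -, hL⟩
    exact ⟨(L, x), hL, rfl⟩
  · rintro ⟨⟨L, x⟩, hL, rfl⟩
    exact ⟨x, mem_of_mem_gaussMap hL, hL⟩

theorem isProjVariety_zclosure_image_gaussMap (hX : IsProjVariety k X) (hd : coneDim k X = n + 1) :
    IsProjVariety k (zclosure k ((gaussMap n X).image X)) := by
  rw [image_gaussMap]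
  exact isProjVariety_zclosure (isIrreducible_image_fst (isIrreducible_gaussPairs hX hd))

theorem mem_zclosure_image_gaussMap {x : PSpace k N} {L : Grass k (n + 1) N}
    (hL : L ∈ gaussMap n X x) : L ∈ zclosure k ((gaussMap n X).image X) :=
  subset_zclosure _ ⟨x, mem_of_mem_gaussMap hL, hL⟩

theorem exists_frame_of_hasDiffRank {x : PSpace k N} {r : ℕ}
    (h : HasDiffRank k X (gaussMap n X) x r) :
    ∃ L ∈ gaussMap n X x, ∃ (c : Fin (N + 1) → k)
      (P : Fin (n + 1) × Fin (N + 1) → MvPolynomial (Fin (N + 1)) k)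
      (D : MvPolynomial (Fin (N + 1)) k), IsRep c x ∧ eval c D ≠ 0 ∧ IsGaussFrame n X P D ∧
      IsRep (fun j => eval c (P j)) L ∧ Module.finrank k ((coneTangent X c).map
        ((rowsIn L.1 (n + 1)).mkQ ∘ₗ frameDiff P c)) = r := by
  have hinf : Infinite k := IsAlgClosed.instInfinite
  obtain ⟨L, hL, c, hc, P, hP, hr⟩ := h
  obtain ⟨D, hD, hPD⟩ := exists_isGaussFrame_of_isLocalExpr hc hP
  obtain ⟨L', hL', hLP⟩ := hPD x (mem_of_mem_gaussMap hL) c hc hD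
  obtain rfl : L' = L := Part.mem_unique hL' hL
  rw [coneTangent_singleton_grass hLP] at hr
  exact ⟨L', hL, c, P, D, hc, hD, hPD, hLP, hr⟩

theorem finrank_map_frameDiff_sup {c : Fin (N + 1) → k} (L : Grass k (n + 1) N)
    (P : Fin (n + 1) × Fin (N + 1) → MvPolynomial (Fin (N + 1)) k) :
    Module.finrank k ((coneTangent X c).map ((rowsIn L.1 (n + 1)).mkQ ∘ₗ frameDiff P c)) +
      (n + 1) * (n + 1) = Module.finrank k ((coneTangent X c).map (frameDiff P c) ⊔
        rowsIn L.1 (n + 1) : Submodule k _) := by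
  rw [← finrank_map_mkQ_comp_add, finrank_rowsIn, L.2]

/-- The kernel of `Φ` at a general point of the image of a separable Gauss map. -/
theorem shrinkRank_add_of_hasDiffRank (hYc : IsProjVariety k Y)
    (hXY : ∀ x, ∀ L ∈ gaussMap n X x, L ∈ Y) {r : ℕ}
    (hr : coneDim k Y = r + (n + 1) * (n + 1)) {x : PSpace k N}
    (h : HasDiffRank k X (gaussMap n X) x r)
    (hL : ∀ L ∈ gaussMap n X x, L ∈ shrinkDom Y) :
    shrinkRank Y + r = n + 1 ∧ ∀ L ∈ gaussMap n X x, (L, x) ∈ shrinkPairs Y := by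
  have hinf : Infinite k := IsAlgClosed.instInfinite
  obtain ⟨L, hLx, c, P, D, hc, hD, hP, hLP, hrank⟩ := exists_frame_of_hasDiffRank h
  have hx := mem_of_mem_gaussMap hLx
  have hT : coneTangent Y (fun j => eval c (P j)) =
      (coneTangent X c).map (frameDiff P c) ⊔ rowsIn L.1 (n + 1) := by
    -- The inclusion always holds; here both sides have dimension `r + (n + 1)²`, which is how
    -- separability enters.
    refine (Submodule.eq_of_le_of_finrank_eq (sup_le ?_ ?_) ?_).symm
    · rintro _ ⟨v, hv, rfl⟩
      exact frameDiff_mem_coneTangent hXY hYc.closed hP hx hc hD hv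
    · exact fibre_le_coneTangent (hXY x L hLx) hLP
    · rw [← finrank_map_frameDiff_sup, hrank,
        finrank_coneTangent_of_mem_shrinkDom hYc (hL L hLx) hLP, hr]
  have hLT := ((mem_gaussMap_iff hc).1 hLx).2
  have hker : coneTangent X c ⊓ LinearMap.ker ((rowsIn L.1 (n + 1)).mkQ ∘ₗ frameDiff P c) =
      kerPhi Y L := by
    ext v
    rw [Submodule.mem_inf, LinearMap.ker_comp, Submodule.ker_mkQ, Submodule.mem_comap]
    constructor
    · rintro ⟨hv, h⟩
      exact (mem_kerPhi_iff_hess hP hx hc hD hLx hLP hT hv).2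
        ((frameDiff_mem_rowsIn_iff hP hx hc hD hLx hLP hv).1 h)
    · intro h
      have hv : v ∈ coneTangent X c := hLT ▸ kerPhi_le Y L h
      exact ⟨hv, (frameDiff_mem_rowsIn_iff hP hx hc hD hLx hLP hv).2
        ((mem_kerPhi_iff_hess hP hx hc hD hLx hLP hT hv).1 h)⟩
  constructor
  · have := finrank_map_add ((rowsIn L.1 (n + 1)).mkQ ∘ₗ frameDiff P c) (coneTangent X c)
    rw [hrank, hker, finrank_kerPhi (hL L hLx), finrank_of_mem_gaussMap hc hLx] at this
    omega
  · intro L' hL'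
    obtain rfl : L' = L := Part.mem_unique hL' hLx
    refine ⟨hL L' hLx, (submodule_le_iff hc _).2 ?_⟩
    -- The point itself lies in `ker Φ`: its Hessian pairings with tangent vectors vanish.
    have hcT := mem_coneTangent_self (k := k) hx hc
    refine (mem_kerPhi_iff_hess hP hx hc hD hLx hLP hT hcT).2 fun F hF w hw => ?_
    rw [hess_comm]
    exact hess_self_eq_zero hw hF

/-- The changes of frame give `(n + 1)²` tangent directions, and the derivatives of the section `(P,
id)` along the cone over `X` give `n + 1` more. -/
theorem le_coneDim_gaussGraph (hX : IsProjVariety k X) (hd : coneDim k X = n + 1) :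
    (n + 1) * (n + 1) + (n + 1) ≤ coneDim k (gaussGraph n X) := by
  have hinf : Infinite k := IsAlgClosed.instInfinite
  obtain ⟨hU, hne, h⟩ := exists_isOpen_finrank_eq_coneDim (k := k)
    (isProjVariety_gaussGraph hX hd).irreducible.1
  obtain ⟨⟨L, x⟩, hzU, hz⟩ := inter_nonempty_of_zclosure hU hne
  obtain ⟨e, he⟩ := exists_rep k (L, x)
  obtain ⟨a, c, ha, hc, rfl⟩ := isRep_sumElim_comp he
  obtain ⟨P, D, hD, hPa, hP⟩ := exists_isGaussFrame hd hz ha hc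
  have hx := mem_of_mem_gaussMap hz
  have hzΓ : (L, x) ∈ gaussGraph n X := subset_zclosure _ hz
  rw [← h _ ⟨hzU, hzΓ⟩ _ he]
  have hfin : Module.finrank k (rowsIn L.1 (n + 1) × coneTangent X c) =
      (n + 1) * (n + 1) + (n + 1) := by
    rw [Module.finrank_prod, finrank_rowsIn, L.2, finrank_of_mem_gaussMap hc hz]
  rw [← hfin]
  let f : (rowsIn L.1 (n + 1) × coneTangent X c) →ₗ[k]
      ((Fin (n + 1) × Fin (N + 1)) ⊕ Fin (N + 1) → k) :=
    { toFun := fun p => Sum.elim (p.1.1 + frameDiff P c p.2.1) p.2.1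
      map_add' := fun p q => by
        ext i
        rcases i with i | i
        · simp only [Sum.elim_inl, Pi.add_apply, Prod.fst_add, Prod.snd_add, Submodule.coe_add,
            map_add]
          ring
        · rfl
      map_smul' := fun t p => by
        ext i
        rcases i with i | i
        · simp [mul_add]
        · rfl }
  refine LinearMap.finrank_le_finrank_of_injective
    (f := f.codRestrict (coneTangent (gaussGraph n X) (Sum.elim a c)) ?_) ?_
  · rintro ⟨u, v⟩
    have h1 : Sum.elim u.1 0 ∈ coneTangent (gaussGraph n X) (Sum.elim a c) :=
      fibre_le_coneTangent hzΓ he ⟨u.2, zero_mem x.submodule⟩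
    have h2 := sumElim_mem_coneTangent_gaussGraph hP hx hc hD v.2
    rw [hPa] at h2
    have h3 : f (u, v) = Sum.elim u.1 0 + Sum.elim (frameDiff P c v.1) v.1 := by
      ext i
      rcases i with i | i <;> simp [f]
    rw [h3]
    exact add_mem h1 h2
  · rintro ⟨u, v⟩ ⟨u', v'⟩ huv
    have h1 : Sum.elim (u.1 + frameDiff P c v.1) v.1 =
        Sum.elim (u'.1 + frameDiff P c v'.1) v'.1 := congrArg Subtype.val huv
    have hv : v = v' := Subtype.ext (funext fun i => congrFun h1 (Sum.inr i))
    subst hv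
    have hu : u = u' := Subtype.ext (funext fun i => add_right_cancel (congrFun h1 (Sum.inl i)))
    rw [hu]

/-- General points of the graph lie in the pull-back because `x` lies in `ker Φ`; both sets are
irreducible and closed, so a comparison of dimensions concludes. -/
theorem gaussGraph_eq_shrinkPullback_of_separable (hX : IsProjVariety k X)
    (hd : coneDim k X = n + 1) (hYc : IsProjVariety k Y)
    (hY : Y = zclosure k ((gaussMap n X).image X)) {r : ℕ}
    (hrank : HasRank k X (gaussMap n X) r) (hr : zdim k Y = r) :
    gaussGraph n X = shrinkPullback Y ∧ shrinkRank Y + r = n + 1 := by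
  have hr' := (coneDim_eq_of_zdim hYc).1 hr
  have hXY : ∀ x, ∀ L ∈ gaussMap n X x, L ∈ Y := fun x L hL => by
    rw [hY]
    exact mem_zclosure_image_gaussMap hL
  obtain ⟨U, hU, hUX, hUr⟩ := hrank
  obtain ⟨U₀, hU₀, hne, hU₀Y⟩ := exists_isOpen_shrinkDom hYc
  rw [hY] at hne
  obtain ⟨L₀, hL₀U, x₀, -, hL₀⟩ := inter_nonempty_of_zclosure hU₀ hne
  obtain ⟨V, hV, hx₀V, hVU⟩ := exists_isOpen_gauss_preimage hd hL₀ hU₀ hL₀U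
  have key : ∀ x ∈ U ∩ V ∩ X, shrinkRank Y + r = n + 1 ∧
      ∀ L ∈ gaussMap n X x, (L, x) ∈ shrinkPairs Y := by
    rintro x ⟨⟨hxU, hxV⟩, hx⟩
    refine shrinkRank_add_of_hasDiffRank hYc hXY hr' (hUr x ⟨hxU, hx⟩) fun L hL => ?_
    obtain ⟨L', hL', hLU⟩ := hVU x ⟨hxV, hx⟩
    obtain rfl : L' = L := Part.mem_unique hL' hL
    exact hU₀Y ⟨hLU, hXY x L' hL⟩
  obtain ⟨x₁, hx₁⟩ := inter_inter_nonempty hX.irreducible hU hV hUX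
    ⟨x₀, hx₀V, mem_of_mem_gaussMap hL₀⟩
  have hs := (key x₁ hx₁).1
  refine ⟨?_, hs⟩
  obtain ⟨L₁, hL₁, -⟩ := hVU x₁ ⟨hx₁.1.2, hx₁.2⟩
  have hle : gaussGraph n X ⊆ shrinkPullback Y := by
    refine zclosure_subset ?_ (isClosed_shrinkPullback Y)
    refine (subset_zclosure_inter (isIrreducible_gaussPairs hX hd)
      (isOpen_preimage_snd (isOpen_inter hU hV)) ⟨(L₁, x₁), hx₁.1, hL₁⟩).trans ?_
    refine zclosure_subset ?_ (isClosed_shrinkPullback Y)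
    rintro ⟨L, x⟩ ⟨hxUV, hz⟩
    exact shrinkPairs_subset Y ((key x ⟨hxUV, mem_of_mem_gaussMap hz⟩).2 L hz)
  -- A strict inclusion would make `coneDim` strictly smaller. But the graph has at least `(n + 1)²
  -- + (n + 1)`, and the pull-back at most `coneDim Y + shrinkRank Y`, the same number since
  -- `shrinkRank Y + r = n + 1`.
  by_contra hne'
  have hz₁ := (key x₁ hx₁).2 L₁ hL₁
  have hlt := coneDim_lt (isProjVariety_gaussGraph hX hd).irreducible
    (isProjVariety_shrinkPullback hYc ⟨_, shrinkPairs_subset Y hz₁⟩).irreducible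
    (isProjVariety_gaussGraph hX hd).closed (hle.ssubset_of_ne hne')
  obtain ⟨a, ha⟩ := exists_rep k L₁
  obtain ⟨c, hc⟩ := exists_rep k x₁
  have h1 := coneDim_le (k := k) (shrinkPairs_subset Y hz₁) (isRep_sumElim ha hc)
  have h2 := finrank_coneTangent_shrinkPullback_le hYc hz₁.1 (shrinkPairs_subset Y hz₁) ha hc
  have h3 := le_coneDim_gaussGraph hX hd
  omega

/-- The second projection of the graph of the Gauss map. -/
theorem proj₂_gaussGraph (hX : IsProjVariety k X) (hdim : zdim k X = n) :
    IsSeparableMap k (gaussGraph n X) (proj₂ k (n + 1) N) ∧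
      IsGenericallyFinite k (gaussGraph n X) (proj₂ k (n + 1) N) ∧
      (proj₂ k (n + 1) N).image (gaussGraph n X) = X := by
  have hinf : Infinite k := IsAlgClosed.instInfinite
  have hd := (coneDim_eq_of_zdim_pspace hX).1 hdim
  have himg : Prod.snd '' gaussGraph n X = X := by
    refine Set.Subset.antisymm ?_ ?_
    · rintro _ ⟨z, hz, rfl⟩
      exact snd_mem_of_mem_gaussGraph hX hz
    -- The image is closed and contains the smooth points, which are dense in `X`.
    · refine (subset_zclosure_inter hX.irreducible (isOpen_smooth n X)
        (smooth_nonempty hX hd)).trans ?_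
      refine zclosure_subset ?_ (isClosed_image_snd (isProjVariety_gaussGraph hX hd))
      rintro x ⟨hx, hxX⟩
      obtain ⟨L, hL⟩ := exists_mem_gaussMap_of_le hd hx hxX
      exact ⟨(L, x), subset_zclosure _ hL, rfl⟩
  obtain ⟨x₀, hx₀, hx₀X⟩ := smooth_nonempty hX hd
  rw [image_proj₂, himg]
  refine ⟨⟨n, ⟨{z | z.2 ∈ {x : PSpace k N | ∀ c : Fin (N + 1) → k, IsRep c x →
      Module.finrank k (coneTangent X c) ≤ n + 1}}, isOpen_preimage_snd (isOpen_smooth n X), ?_,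
      ?_⟩, ?_⟩, ⟨_, isOpen_smooth n X, ?_, ?_⟩, rfl⟩
  · obtain ⟨L, hL⟩ := exists_mem_gaussMap_of_le hd hx₀ hx₀X
    exact ⟨(L, x₀), hx₀, subset_zclosure _ hL⟩
  · rintro ⟨L, x⟩ ⟨hx, hz⟩
    obtain ⟨e, he⟩ := exists_rep k (L, x)
    obtain ⟨a, c, ha, hc, rfl⟩ := isRep_sumElim_comp he
    have hL := mem_gaussMap_of_mem_gaussGraph hX hz hc (hx c hc)
    have hxX := mem_of_mem_gaussMap hL
    obtain ⟨P, D, hD, rfl, hP⟩ := exists_isGaussFrame hd hL ha hc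
    refine ⟨x, mem_proj₂.2 rfl, _, he, fun p => MvPolynomial.X (Sum.inr p),
      ⟨Set.univ, @isOpen_univ _ (zariski k _), trivial, fun z _ => ⟨z.2, mem_proj₂.2 rfl,
        fun b hb => by simpa using hb.2⟩⟩, ?_⟩
    have hrep : IsRep (fun p => eval (Sum.elim (fun j => eval c (P j)) c)
        (MvPolynomial.X (Sum.inr p) :
          MvPolynomial ((Fin (n + 1) × Fin (N + 1)) ⊕ Fin (N + 1)) k)) x := by
      simpa using hc
    rw [coneTangent_singleton_pspace hrep]
    have hpi : (LinearMap.pi fun p => polyDiff (MvPolynomial.X (Sum.inr p) :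
        MvPolynomial ((Fin (n + 1) × Fin (N + 1)) ⊕ Fin (N + 1)) k)
          (Sum.elim (fun j => eval c (P j)) c)) = inrₗ k _ _ := by
      refine LinearMap.ext fun v => funext fun p => ?_
      simp
    rw [hpi]
    -- Surjectivity comes from the local section of the graph over the smooth locus. Dividing by the
    -- line of `x` then leaves rank `n`.
    have hmap : (coneTangent (gaussGraph n X) (Sum.elim (fun j => eval c (P j)) c)).map
        (inrₗ k _ _) = coneTangent X c := by
      refine le_antisymm ?_ fun v hv => ⟨_, sumElim_mem_coneTangent_gaussGraph hP hxX hc hD hv, rfl⟩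
      rintro _ ⟨v, hv, rfl⟩
      exact inr_mem_coneTangent_sumElim (fun z hz => snd_mem_of_mem_gaussGraph hX hz) hv
    have h1 := finrank_map_mkQ_comp_add
      (coneTangent (gaussGraph n X) (Sum.elim (fun j => eval c (P j)) c)) (inrₗ k _ _) x.submodule
    have h2 : x.submodule ≤ coneTangent X c :=
      (submodule_le_iff hc _).2 (mem_coneTangent_self hxX hc)
    rw [hmap, sup_eq_left.2 h2, Projectivization.finrank_submodule,
      finrank_of_mem_gaussMap hc hL] at h1
    omega
  · rw [image_proj₂, himg, zclosure_eq hX.closed, hdim]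
  · rw [image_proj₂, himg]
    exact ⟨x₀, hx₀, hx₀X⟩
  · intro x hx
    refine Set.Subsingleton.finite ?_
    rintro ⟨L, y⟩ ⟨hz, hy⟩ ⟨L', y'⟩ ⟨hz', hy'⟩
    obtain rfl : x = y := mem_proj₂.1 hy
    obtain rfl : x = y' := mem_proj₂.1 hy'
    obtain ⟨c, hc⟩ := exists_rep k x
    rw [Part.mem_unique (mem_gaussMap_of_mem_gaussGraph hX hz hc (hx c hc))
      (mem_gaussMap_of_mem_gaussGraph hX hz' hc (hx c hc))]

/-- If the second projection is separable onto `X`, then the pull-back is the graph of the Gauss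
map. -/
theorem gaussGraph_eq_shrinkPullback_of_proj₂ (hX : IsProjVariety k X) (hdim : zdim k X = n)
    (hY : IsProjVariety k Y)
    (hsep : IsSeparableMap k (shrinkPullback Y) (proj₂ k (n + 1) N))
    (himg : (proj₂ k (n + 1) N).image (shrinkPullback Y) = X) :
    gaussGraph n X = shrinkPullback Y := by
  have hinf : Infinite k := IsAlgClosed.instInfinite
  have hd := (coneDim_eq_of_zdim_pspace hX).1 hdim
  obtain ⟨r, ⟨U, hU, hUZ, hUr⟩, hr⟩ := hsep
  rw [himg, zclosure_eq hX.closed, hdim] at hr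
  -- The image is `X`, so the rank of the projection is `n`.
  obtain rfl : n = r := by exact_mod_cast hr
  rw [image_proj₂] at himg
  have hZX : ∀ z ∈ shrinkPullback Y, z.2 ∈ X := fun z hz => himg ▸ ⟨z, hz, rfl⟩
  have hne : (shrinkPullback Y).Nonempty := hUZ.mono Set.inter_subset_right
  have hZ := isProjVariety_shrinkPullback hY hne
  obtain ⟨z₀, ⟨hz₀Y, U₀, hU₀, hz₀U, hU₀r⟩, hz₀⟩ := shrinkPairs_nonempty hne
  have hU₁ : IsOpen[zariski k _] {z : Grass k (n + 1) N × PSpace k N | z.1 ∈ U₀} :=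
    isOpen_preimage_fst hU₀
  have hU₂ := isOpen_preimage_snd (k := k) (M := Grass k (n + 1) N) (isOpen_smooth n X)
  set O := U ∩ ({z : Grass k (n + 1) N × PSpace k N | z.1 ∈ U₀} ∩ {z | z.2 ∈
    {x : PSpace k N | ∀ c : Fin (N + 1) → k, IsRep c x →
      Module.finrank k (coneTangent X c) ≤ n + 1}}) with hOdef
  have hO : IsOpen[zariski k _] O := isOpen_inter hU (isOpen_inter hU₁ hU₂)
  have hOZ : (O ∩ shrinkPullback Y).Nonempty := by
    refine inter_inter_nonempty hZ.irreducible hU (isOpen_inter hU₁ hU₂) hUZ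
      (inter_inter_nonempty hZ.irreducible hU₁ hU₂ ⟨z₀, hz₀U,
        shrinkPairs_subset Y ⟨⟨hz₀Y, U₀, hU₀, hz₀U, hU₀r⟩, hz₀⟩⟩ ?_)
    obtain ⟨x, hx, hxX⟩ := smooth_nonempty hX hd
    rw [← himg] at hxX
    obtain ⟨z, hz, rfl⟩ := hxX
    exact ⟨z, hx, hz⟩
  have hW : O ∩ shrinkPullback Y ⊆ gaussPairs n X := by
    rintro ⟨L, x⟩ ⟨⟨hzU, hLU, hx⟩, hz⟩
    have hLd : L ∈ shrinkDom Y := ⟨fst_mem_of_mem_shrinkPullback hY hz, U₀, hU₀, hLU, hU₀r⟩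
    obtain ⟨y, hy, e, he, P, hP, hrk⟩ := hUr _ ⟨hzU, hz⟩
    obtain rfl : y = x := mem_proj₂.1 hy
    obtain ⟨a, c, ha, hc, rfl⟩ := isRep_sumElim_comp he
    change IsRep c y at hc
    have hyX := hZX _ hz
    have hPrep : IsRep (fun p => eval (Sum.elim a c) (P p)) y := by
      obtain ⟨U', -, hzU', h'⟩ := hP
      obtain ⟨y', hy', h''⟩ := h' _ ⟨hzU', hz⟩
      have := h'' _ he
      rwa [mem_proj₂.1 hy'] at this
    rw [coneTangent_singleton_pspace hPrep] at hrk
    have h1 := finrank_map_mkQ_comp_add (coneTangent (shrinkPullback Y) (Sum.elim a c))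
      (LinearMap.pi fun j => polyDiff (P j) (Sum.elim a c)) y.submodule
    rw [hrk, Projectivization.finrank_submodule] at h1
    have hkey : ∀ E : Submodule k (Fin (N + 1) → k), c ∈ E →
        (∀ v ∈ coneTangent (shrinkPullback Y) (Sum.elim a c), (fun p => v (Sum.inr p)) ∈ E) →
        (coneTangent (shrinkPullback Y) (Sum.elim a c)).map
          (LinearMap.pi fun j => polyDiff (P j) (Sum.elim a c)) ⊔ y.submodule ≤ E := by
      intro E hcE hE
      refine sup_le ?_ ((submodule_le_iff hc _).2 hcE)
      rintro _ ⟨v, hv, rfl⟩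
      obtain ⟨t, s, hts⟩ := diff_proj₂_eq hz hP he hv
      change (fun p => polyDiff (P p) (Sum.elim a c) v) ∈ E
      rw [hts]
      exact add_mem (E.smul_mem _ (hE v hv)) (E.smul_mem _ hcE)
    -- The image of the differential together with the line of `x` has dimension `n + 1`. It lies
    -- both in `L` and in the tangent space at `x`, neither of which is larger, so all three
    -- coincide.
    have hL := hkey L.1
      (kerPhi_le Y L ((submodule_le_iff hc _).1 ((mem_shrinkPullback_iff hY hLd).1 hz)))
      fun v hv => inr_mem_of_mem_coneTangent_shrinkPullback hY hLd hz ha hc hv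
    have hT := hkey (coneTangent X c) (mem_coneTangent_self hyX hc)
      fun v hv => inr_mem_coneTangent_sumElim hZX hv
    refine (mem_gaussMap_iff hc).2 ⟨hyX, ?_⟩
    rw [← Submodule.eq_of_le_of_finrank_eq hL (h1.symm.trans L.2.symm)]
    exact Submodule.eq_of_le_of_finrank_le hT ((hx c hc).trans h1.le)
  have hZW := subset_zclosure_inter hZ.irreducible hO hOZ
  refine Set.Subset.antisymm (zclosure_subset ?_ hZ.closed) (hZW.trans (zclosure_mono hW))
  -- The dense part `O` of the pull-back consists of points of the graph and projects densely to
  -- `X`, so it is also dense in the graph.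
  refine (gaussPairs_subset_zclosure hd hW ?_).trans
    (zclosure_subset Set.inter_subset_right hZ.closed)
  rw [← himg]
  rintro _ ⟨z, hz, rfl⟩
  exact snd_mem_of_mem_zclosure (isClosed_zclosure _) (fun w hw => subset_zclosure _ (Set.mem_image_of_mem _ hw))
    (hZW hz)

/-- Every tangent vector of `Y` lifts to the pull-back, which is the graph; the lift shows that it
comes from `X` through the differential of the Gauss map, up to a change of frame. -/
theorem separable_of_gaussGraph_eq (hX : IsProjVariety k X) (hd : coneDim k X = n + 1)
    (hY : IsProjVariety k Y) (h : gaussGraph n X = shrinkPullback Y) :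
    IsSeparableMap k X (gaussMap n X) ∧ Y = zclosure k ((gaussMap n X).image X) := by
  have hinf : Infinite k := IsAlgClosed.instInfinite
  have hXY : ∀ x, ∀ L ∈ gaussMap n X x, L ∈ Y := fun x L hL => by
    have : (L, x) ∈ shrinkPullback Y := by
      rw [← h]
      exact subset_zclosure _ hL
    exact fst_mem_of_mem_shrinkPullback hY this
  obtain ⟨U₀, hU₀, hne, hU₀Y⟩ := exists_isOpen_shrinkDom hY
  have hYeq : Y = zclosure k ((gaussMap n X).image X) := by
    refine Set.Subset.antisymm ?_ (zclosure_subset ?_ hY.closed)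
    · refine (subset_zclosure_inter hY.irreducible hU₀ hne).trans
        (zclosure_subset (fun L hL => ?_) (isClosed_zclosure _))
      have hLd := hU₀Y hL
      obtain ⟨z, hz⟩ := shrinkPairs_nonempty (Y := Y)
        (h ▸ (isProjVariety_gaussGraph hX hd).irreducible.1)
      -- The graph is nonempty, so `ker Φ` is nonzero at some plane, and its dimension is constant
      -- on the domain of the shrinking map. Thus every such plane occurs in the pull-back.
      have hpos : 0 < Module.finrank k (kerPhi Y L) := by
        rw [finrank_kerPhi hLd, ← finrank_kerPhi hz.1]
        have := Submodule.finrank_mono hz.2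
        rw [Projectivization.finrank_submodule] at this
        omega
      have : Nontrivial (kerPhi Y L) := Module.nontrivial_of_finrank_pos hpos
      obtain ⟨v, hv⟩ := exists_ne (0 : kerPhi Y L)
      have hv0 : v.1 ≠ 0 := fun h0 => hv (Subtype.ext h0)
      have hLx : (L, (Projectivization.mk k v.1 hv0 : PSpace k N)) ∈ gaussGraph n X := by
        rw [h, mem_shrinkPullback_iff hY hLd]
        exact (submodule_le_iff ⟨hv0, rfl⟩ _).2 v.2
      exact fst_mem_of_mem_zclosure (isClosed_zclosure _)
        (fun w hw => mem_zclosure_image_gaussMap hw) hLx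
    · rintro L ⟨x, -, hL⟩
      exact hXY x L hL
  refine ⟨?_, hYeq⟩
  rw [IsSeparableMap, ← hYeq]
  refine ⟨coneDim k Y - (n + 1) * (n + 1), ?_, zdim_eq_coneDim_sub hY⟩
  have hle : (n + 1) * (n + 1) ≤ coneDim k Y := fdim_le_coneDim (k := k) hY.irreducible.1
  rw [hYeq] at hne
  obtain ⟨L₀, hL₀U, x₀, -, hL₀⟩ := inter_nonempty_of_zclosure hU₀ hne
  obtain ⟨V, hV, hx₀V, hVU⟩ := exists_isOpen_gauss_preimage hd hL₀ hU₀ hL₀U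
  refine ⟨V, hV, ⟨x₀, hx₀V, mem_of_mem_gaussMap hL₀⟩, fun x hx => ?_⟩
  obtain ⟨L, hL, hLU⟩ := hVU x hx
  have hLd : L ∈ shrinkDom Y := hU₀Y ⟨hLU, hXY x L hL⟩
  obtain ⟨c, hc⟩ := exists_rep k x
  obtain ⟨P, hPl⟩ := exists_isLocalExpr_gaussMap hd hL
  obtain ⟨D, hD, hP⟩ := exists_isGaussFrame_of_isLocalExpr hc hPl
  obtain ⟨L', hL', hLP⟩ := hP x hx.2 c hc hD
  obtain rfl : L' = L := Part.mem_unique hL' hL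
  refine ⟨L', hL, c, hc, P, hPl, ?_⟩
  rw [coneTangent_singleton_grass hLP]
  have hLT := ((mem_gaussMap_iff hc).1 hL).2
  have hz : (L', x) ∈ shrinkPullback Y := by
    rw [← h]
    exact subset_zclosure _ hL
  have hT : (coneTangent X c).map (frameDiff P c) ⊔ rowsIn L'.1 (n + 1) =
      coneTangent Y (fun j => eval c (P j)) := by
    refine le_antisymm (sup_le ?_ (fibre_le_coneTangent (hXY x L' hL) hLP)) fun b hb => ?_
    · rintro _ ⟨v, hv, rfl⟩
      exact frameDiff_mem_coneTangent hXY hY.closed hP hx.2 hc hD hv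
    · obtain ⟨w, hw⟩ := exists_sumElim_mem_coneTangent_shrinkPullback hY hLd hz hLP hc hb
      rw [← h] at hw
      have hwT : w ∈ coneTangent X c :=
        inr_mem_coneTangent_sumElim (fun z hz => snd_mem_of_mem_gaussGraph hX hz) hw
      refine Submodule.mem_sup.2 ⟨frameDiff P c w, ⟨w, hwT, rfl⟩, b - frameDiff P c w,
        fun i => ?_, add_sub_cancel _ _⟩
      rw [hLT]
      refine mem_coneTangent.2 fun F hF => ?_
      -- Both `(b, w)` and `(dP(w), w)` are tangent to the graph. Their Hessian relations have the
      -- same first term, so `b - dP(w)` is killed by the equations of the tangent space, which is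
      -- `L`.
      have h1 := hess_add_of_mem_coneTangent_gaussGraph hw hF i
      have h2 := hess_add_polyDiff_frameDiff hP hx.2 hc hD hwT hF i
      simp only [Sum.elim_inl, Sum.elim_inr] at h1
      rw [row_sub, map_sub, sub_eq_zero]
      exact add_left_cancel (h1.trans h2.symm)
  have h1 := finrank_map_frameDiff_sup (X := X) (c := c) L' P
  rw [hT, finrank_coneTangent_of_mem_shrinkDom hY hLd hLP] at h1
  change Module.finrank k ((coneTangent X c).map
    ((rowsIn L'.1 (n + 1)).mkQ ∘ₗ frameDiff P c)) = _
  omega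

/-! ### Linear subspaces -/

theorem isProjVariety_linear {E : Submodule k (Fin (N + 1) → k)} (hE : E ≠ ⊥) :
    IsProjVariety k {x : PSpace k N | x.submodule ≤ E} := by
  have hinf : Infinite k := IsAlgClosed.instInfinite
  constructor
  · refine isClosed_of_forall (k := k) fun x hx => ?_
    obtain ⟨c, hc⟩ := exists_rep k x
    change x.submodule ≤ E
    rw [submodule_le_iff hc]
    by_contra hcon
    obtain ⟨f, hf, hf'⟩ := Submodule.exists_le_ker_of_notMem hcon
    let g : (Fin (N + 1) → k) →ₗ[k] (Unit → k) := LinearMap.pi fun _ => f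
    have := hx c hc (linPoly g ()) (mem_coneIdeal.2 fun y hy b hb => by
      rw [eval_linPoly]
      exact hf' ((submodule_le_iff hb _).1 hy))
    rw [eval_linPoly] at this
    exact hf this
  · obtain ⟨v, hv, hv0⟩ := Submodule.exists_mem_ne_zero_of_ne_bot hE
    have hne : ({x : PSpace k N | x.submodule ≤ E}).Nonempty :=
      ⟨Projectivization.mk k v hv0, (submodule_le_iff ⟨hv0, rfl⟩ _).2 hv⟩
    refine isIrreducible_of_isPrime (k := k) hne ⟨?_, fun {F G} hFG => ?_⟩
    · obtain ⟨z, hz⟩ := hne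
      obtain ⟨e, he⟩ := exists_rep k z
      intro h
      have := mem_coneIdeal.1 ((Ideal.eq_top_iff_one _).1 h) z hz e he
      simp at this
    · by_contra! hcon
      obtain ⟨x, hx, b, hb, hF⟩ := notMem_coneIdeal.1 hcon.1
      obtain ⟨y, hy, c, hc, hG⟩ := notMem_coneIdeal.1 hcon.2
      obtain ⟨p, hp⟩ := Function.ne_iff.1 (isRep_pspace_iff.1 hb).1
      obtain ⟨t, ht1, ht2⟩ := exists_line_eval_ne_zero (F := MvPolynomial.X p * F) (a := b) (b := c)
        (by rw [map_mul, eval_X]; exact mul_ne_zero hp hF) hG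
      rw [map_mul, eval_X, mul_ne_zero_iff] at ht1
      have h0 : b + t • (c - b) ≠ 0 := fun h0 => ht1.1 (congrFun h0 p)
      have hbE := (submodule_le_iff hb _).1 hx
      have hcE := (submodule_le_iff hc _).1 hy
      have := mem_coneIdeal.1 hFG (Projectivization.mk k _ h0)
        ((submodule_le_iff ⟨h0, rfl⟩ _).2 (add_mem hbE (E.smul_mem t (sub_mem hcE hbE)))) _
        ⟨h0, rfl⟩
      rw [map_mul] at this
      exact mul_ne_zero ht1.2 ht2 this

/-- Since the graph is the pull-back, the fibre over `L` consists of the smooth points of `X` in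
`ℙ(ker Φ)`; it is an open part of a linear space, dense as soon as it is nonempty. -/
theorem exists_isOpen_fibre_linear (hX : IsProjVariety k X)
    (hY : IsProjVariety k Y) (hYX : Y = zclosure k ((gaussMap n X).image X))
    (h : gaussGraph n X = shrinkPullback Y) :
    ∃ U : Set (Grass k (n + 1) N), IsOpen[zariski k _] U ∧ (U ∩ Y).Nonempty ∧
      ∀ L ∈ U ∩ Y, L ∈ shrinkDom Y ∧
        zclosure k {x | L ∈ gaussMap n X x} = {x | x.submodule ≤ kerPhi Y L} := by
  have hinf : Infinite k := IsAlgClosed.instInfinite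
  obtain ⟨U₀, hU₀, hne, hU₀Y⟩ := exists_isOpen_shrinkDom hY
  have hne' := hne
  rw [hYX] at hne'
  obtain ⟨L₀, hL₀U, x₀, -, hL₀⟩ := inter_nonempty_of_zclosure hU₀ hne'
  have hL₀Y : L₀ ∈ Y := by
    rw [hYX]
    exact mem_zclosure_image_gaussMap hL₀
  have hL₀d := hU₀Y ⟨hL₀U, hL₀Y⟩
  obtain ⟨a₀, ha₀⟩ := exists_rep k L₀
  obtain ⟨c₀, hc₀⟩ := exists_rep k x₀
  have hz₀ : (L₀, x₀) ∈ shrinkPullback Y := by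
    rw [← h]
    exact subset_zclosure _ hL₀
  obtain ⟨σ, D, hD, hσ, hs⟩ := exists_section hY hL₀d ha₀
    ((submodule_le_iff hc₀ _).1 ((mem_shrinkPullback_iff hY hL₀d).1 hz₀))
  have hx₀ : x₀ ∈ {x : PSpace k N | ∀ c : Fin (N + 1) → k, IsRep c x →
      Module.finrank k (coneTangent X c) ≤ n + 1} := fun c hc =>
    (finrank_of_mem_gaussMap hc hL₀).le
  obtain ⟨D', hD', hs'⟩ := exists_of_isOpen (isOpen_smooth n X) hx₀ hc₀
  obtain ⟨p, hp⟩ := Function.ne_iff.1 (isRep_pspace_iff.1 hc₀).1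
  -- A section of `ker Φ` through the smooth point `x₀` stays nonzero and smooth on this open set,
  -- so all fibres over it are nonempty.
  refine ⟨basicOpen _ (D * σ p * bind₁ σ D'), isOpen_basicOpen _, ⟨L₀, ⟨a₀, ha₀, ?_⟩, hL₀Y⟩, ?_⟩
  · rw [map_mul, map_mul, eval_bind₁, hσ, show eval a₀ (σ p) = c₀ p from congrFun hσ p]
    exact mul_ne_zero (mul_ne_zero hD hp) hD'
  rintro L ⟨⟨a, ha, hDa⟩, hLY⟩
  rw [map_mul, map_mul, mul_ne_zero_iff, mul_ne_zero_iff, eval_bind₁] at hDa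
  obtain ⟨hLd, hsE⟩ := hs a L hLY ha hDa.1.1
  refine ⟨hLd, ?_⟩
  have h0 : (fun p => eval a (σ p)) ≠ 0 := fun h0 => hDa.1.2 (congrFun h0 p)
  have hE : kerPhi Y L ≠ ⊥ := fun hE => h0 (by rwa [hE, Submodule.mem_bot] at hsE)
  have hfib : {x | L ∈ gaussMap n X x} = {x : PSpace k N | ∀ c : Fin (N + 1) → k, IsRep c x →
      Module.finrank k (coneTangent X c) ≤ n + 1} ∩ {x | x.submodule ≤ kerPhi Y L} := by
    ext x
    constructor
    · intro hL
      refine ⟨fun c hc => (finrank_of_mem_gaussMap hc hL).le, ?_⟩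
      have hz : (L, x) ∈ shrinkPullback Y := by
        rw [← h]
        exact subset_zclosure _ hL
      exact (mem_shrinkPullback_iff hY hLd).1 hz
    · rintro ⟨hx, hxE⟩
      obtain ⟨c, hc⟩ := exists_rep k x
      refine mem_gaussMap_of_mem_gaussGraph hX ?_ hc (hx c hc)
      rw [h]
      exact (mem_shrinkPullback_iff hY hLd).2 hxE
  have hlin := isProjVariety_linear (N := N) hE
  rw [hfib]
  refine Set.Subset.antisymm (zclosure_subset Set.inter_subset_right hlin.closed) ?_
  refine subset_zclosure_inter hlin.irreducible (isOpen_smooth n X)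
    ⟨Projectivization.mk k _ h0, hs' _ _ ⟨h0, rfl⟩ hDa.2, (submodule_le_iff ⟨h0, rfl⟩ _).2 hsE⟩

theorem nonempty_of_zdim_eq {M : Type*} {ι : Type} [HomogCoord k M ι] {Z : Set M} {m : ℕ}
    (h : zdim k Z = m) : Z.Nonempty := by
  by_contra hne
  rw [Set.not_nonempty_iff_eq_empty] at hne
  subst hne
  let _ := (zariski k M).induced (Subtype.val : (∅ : Set M) → M)
  have : IsEmpty (TopologicalSpace.IrreducibleCloseds (∅ : Set M)) :=
    ⟨fun Z => Z.2.1.elim fun x _ => x.2⟩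
  have h1 : zdim k (∅ : Set M) = ⊥ := Order.krullDim_eq_bot
  rw [h1] at h
  exact WithBot.bot_ne_coe h

theorem tfae_gaussMap (hX : IsProjVariety k X) (hdim : zdim k X = n) (hY : IsProjVariety k Y) :
    List.TFAE [
      IsSeparableMap k X (gaussMap n X) ∧ Y = zclosure k ((gaussMap n X).image X),
      gaussGraph n X = shrinkPullback Y,
      IsSeparableMap k (shrinkPullback Y) (proj₂ k (n + 1) N) ∧
        IsGenericallyFinite k (shrinkPullback Y) (proj₂ k (n + 1) N) ∧
        (proj₂ k (n + 1) N).image (shrinkPullback Y) = X] := by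
  have hd := (coneDim_eq_of_zdim_pspace hX).1 hdim
  tfae_have 1 → 2 := by
    rintro ⟨⟨r, hr, hr'⟩, hYX⟩
    rw [← hYX] at hr'
    exact (gaussGraph_eq_shrinkPullback_of_separable hX hd hY hYX hr hr').1
  tfae_have 2 → 3 := by
    intro h
    rw [← h]
    exact proj₂_gaussGraph hX hdim
  tfae_have 3 → 2 := fun h => gaussGraph_eq_shrinkPullback_of_proj₂ hX hdim hY h.1 h.2.2
  tfae_have 2 → 1 := separable_of_gaussGraph_eq hX hd hY
  tfae_finish

end Main

end GaussMaps

end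

theorem mainTheorem7 (k : Type*) [Field k] [IsAlgClosed k] (N n : ℕ) :
    (∀ (X : Set (GaussMaps.PSpace k N)) (Y : Set (GaussMaps.Grass k (n + 1) N)),
      GaussMaps.IsProjVariety k X → GaussMaps.zdim k X = n → GaussMaps.IsProjVariety k Y →
      List.TFAE [
        GaussMaps.IsSeparableMap k X (GaussMaps.gaussMap n X) ∧
          Y = GaussMaps.zclosure k ((GaussMaps.gaussMap n X).image X),
        GaussMaps.gaussGraph n X = GaussMaps.shrinkPullback Y,
        GaussMaps.IsSeparableMap k (GaussMaps.shrinkPullback Y) (GaussMaps.proj₂ k (n + 1) N) ∧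
          GaussMaps.IsGenericallyFinite k (GaussMaps.shrinkPullback Y)
            (GaussMaps.proj₂ k (n + 1) N) ∧
          (GaussMaps.proj₂ k (n + 1) N).image (GaussMaps.shrinkPullback Y) = X]) ∧
    (∀ X : Set (GaussMaps.PSpace k N),
      GaussMaps.IsProjVariety k X → GaussMaps.zdim k X = n →
      GaussMaps.IsSeparableMap k X (GaussMaps.gaussMap n X) →
      ∃ U : Set (GaussMaps.Grass k (n + 1) N),
        IsOpen[GaussMaps.zariski k (GaussMaps.Grass k (n + 1) N)] U ∧
        (U ∩ GaussMaps.zclosure k ((GaussMaps.gaussMap n X).image X)).Nonempty ∧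
        ∀ L ∈ U ∩ GaussMaps.zclosure k ((GaussMaps.gaussMap n X).image X),
          ∃ E : Submodule k (Fin (N + 1) → k),
            GaussMaps.zclosure k {x | L ∈ GaussMaps.gaussMap n X x} = {x | x.submodule ≤ E} ∧
            (Module.finrank k E : WithBot ℕ∞) +
              GaussMaps.zdim k (GaussMaps.zclosure k ((GaussMaps.gaussMap n X).image X)) = n + 1) ∧
    (∀ Y : Set (GaussMaps.Grass k (n + 1) N), GaussMaps.IsProjVariety k Y →
      ((∃ X : Set (GaussMaps.PSpace k N),
          GaussMaps.IsProjVariety k X ∧ GaussMaps.zdim k X = n ∧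
          GaussMaps.IsSeparableMap k X (GaussMaps.gaussMap n X) ∧
          Y = GaussMaps.zclosure k ((GaussMaps.gaussMap n X).image X)) ↔
        GaussMaps.IsSeparableMap k (GaussMaps.shrinkPullback Y) (GaussMaps.proj₂ k (n + 1) N) ∧
          GaussMaps.IsGenericallyFinite k (GaussMaps.shrinkPullback Y)
            (GaussMaps.proj₂ k (n + 1) N) ∧
          GaussMaps.zdim k
            ((GaussMaps.proj₂ k (n + 1) N).image (GaussMaps.shrinkPullback Y)) = n)) := by
  open GaussMaps in
  have hinf : Infinite k := IsAlgClosed.instInfinite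
  refine ⟨fun X Y hX hdim hY => tfae_gaussMap hX hdim hY, fun X hX hdim hsep => ?_,
    fun Y hY => ⟨?_, ?_⟩⟩
  · have hd := (coneDim_eq_of_zdim_pspace hX).1 hdim
    have hY := isProjVariety_zclosure_image_gaussMap hX hd
    obtain ⟨r, hr, hr'⟩ := hsep
    obtain ⟨h, hs⟩ := gaussGraph_eq_shrinkPullback_of_separable hX hd hY rfl hr hr'
    obtain ⟨U, hU, hne, hUY⟩ := exists_isOpen_fibre_linear hX hY rfl h
    refine ⟨U, hU, hne, fun L hL => ⟨_, (hUY L hL).2, ?_⟩⟩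
    rw [finrank_kerPhi (hUY L hL).1, hr']
    -- With vector-space dimensions the formula is `shrinkRank Y + r = n + 1`; the projective
    -- dimension `n - dim Y` is one less than that of the subspace.
    exact_mod_cast hs
  · rintro ⟨X, hX, hdim, hsep, hYX⟩
    have h13 := (tfae_gaussMap hX hdim hY).out 0 2
    obtain ⟨h1, h2, h3⟩ := h13.1 ⟨hsep, hYX⟩
    exact ⟨h1, h2, by rw [h3, hdim]⟩
  · rintro ⟨h1, h2, h3⟩
    -- The empty set has dimension `⊥`, so dimension `n` rules out an empty pull-back. The variety
    -- sought is the image itself, closed by completeness.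
    have hne := nonempty_of_zdim_eq h3
    rw [image_proj₂] at hne
    have hZ := isProjVariety_shrinkPullback hY hne.of_image
    have hX : IsProjVariety k ((proj₂ k (n + 1) N).image (shrinkPullback Y)) := by
      rw [image_proj₂]
      exact ⟨isClosed_image_snd hZ, isIrreducible_image_snd hZ.irreducible⟩
    have h31 := (tfae_gaussMap hX h3 hY).out 2 0
    obtain ⟨h4, h5⟩ := h31.1 ⟨h1, h2, rfl⟩
    exact ⟨_, hX, h3, h4, h5⟩
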